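/- **Setting.** A *hyperelliptic graph* is a finite connected (multi)graph $G$ with vertex set $\mathrm{Vert}(G)$ and edge set $\mathrm{Ed}(G)$, together with an involution $\iota$ (acting on vertices and edges) such that: every edge is a closed interval with two distinct terminal points; $\iota(e)\ne e$ for every edge $e$; at least three edges start from every vertex $v$ with $\iota(v)\neq v$; and $G/\langle\iota\rangle$ is a tree. A bar denotes classes modulo $\iota$, and $\mathrm{Ed}(G)^\sim=\mathrm{Ed}(G)/\langle\iota\rangle$. An edge $e$ is disjoint, one-jointed or two-jointed if $e\cap\iota(e)$ consists of $0$, $1$ or $2$ points. For a non-fixed vertex $v$, $\nu_G(v)$ is the number of disjoint and one-jointed edges starting from $v$. For $S\subset \mathrm{Ed}(G)^\sim$, $G^S$ is the graph with involution obtained by contracting all edges $e$ with $\bar e\notin S$; a divisor $D=\sum_v a_v v$ on $G$ induces on it the divisor $D^S$ whose coefficient at a vertex is the sum of the coefficients $a_v$ of the vertices $v$ of $G$ mapped to it. An irreducible component (block) of $G$ is called simple if it consists of two two-jointed edges; $G$ is semisimple if all its irreducible components are simple. The size $\mathrm{sz}(G)$ is the sum over the irreducible components $G_i$ of $1$ if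 $G_i$ is simple and of (number of classes of one-jointed edges of $G_i$)$\,-1$ otherwise. With indeterminates $X_{\bar e}$ ($\bar e\in \mathrm{Ed}(G)^\sim$) and $n=\mathrm{sz}(G)$, put $$L_G=\sum_{|S|=n}\delta_S\prod_{\bar e\in S}X_{\bar e},\qquad M_G=\sum_{|S|=n+1}c_S\prod_{\bar e\in S}X_{\bar e},$$ where $S$ runs over subsets of $\mathrm{Ed}(G)^\sim$; $\delta_S=1$ if $G^S$ is a semisimple hyperelliptic graph of size $n$ and $\delta_S=0$ otherwise; $c_S=\nu-2$ if $G^S$ has exactly one $\iota$-class of non-fixed vertices, $\nu$ being the number of edges of $G^S$ starting from a representative of it, and $c_S=0$ otherwise. Let $\lambda$ assign a length $l_{\bar e}>0$ to every class $\bar e\in \mathrm{Ed}(G)^\sim$, and regard $G$ as a metrized graph in which $e$ has length $l_{\bar e}$. Let $\Delta$ be the Laplacian, $\Delta f=-f''\,dx-\sum_p(\text{sum of the outgoing derivatives of } f \text{ at } p)\,\delta_p$, understood in the sense of distributions. For a real divisor $D=\sum_v a_vv$ on $\mathrm{Vert}(G)$ with $\deg D=\sum_v a_v\ne-2$, the admissible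 constant is $$\epsilon(G;\lambda,D)=2\deg(D)\,c-g(D,D),$$ where $\mu$ is a signed measure on $G$ and $g$ a symmetric continuous function on $G\times G$ such that $\int_G\mu=1$, $\Delta_y g(x,y)=\delta_x-\mu$ and $\int_G g(x,y)\,\mu(y)=0$ for every $x$, and $g(D,y)+g(y,y)=c$ is constant in $y$. **Theorem.** Let $G$ be a hyperelliptic graph and $$D=\sum_{v\text{ non-fixed}}(\nu_G(v)-2)\,v+\sum_{v'\text{ fixed}}a_{v'}v',\qquad a_{v'}\in\mathbb R,$$ with $\deg D+2\neq0$. For $\bar e\in \mathrm{Ed}(G)^\sim$ put $w(\bar e)=\min\{a,b\}$, where $a,b$ are the coefficients of $D^{\{\bar e\}}$ at the two vertices of $G^{\{\bar e\}}$. Then for every $\lambda=(l_{\bar e})$ with all $l_{\bar e}>0$ the admissible constant $\epsilon(G;\lambda,D)$ exists and is unique, $L_G(\lambda)\neq0$, and $$\epsilon(G;\lambda,D)=\sum_{\bar e\in \mathrm{Ed}(G)^\sim}\left(\frac23\,\frac{\deg D}{\deg D+2}+\frac{w(\bar e)\,(\deg D-w(\bar e))}{\deg D+2}\right)l_{\bar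 e}+\frac23\,\frac{\deg D}{\deg D+2}\,\frac{M_G(\lambda)}{L_G(\lambda)}.$$ That is, $\epsilon(G,D)$ equals this rational function of the edge lengths. -/

import Mathlib

open MeasureTheory MvPolynomial

/-- A multigraph with vertex set `V` and edge set `E`. The orientation of the edges only serves to
parametrize them; loops and parallel edges are not excluded here. -/
structure MultiGraph (V E : Type*) where
  src : E → V
  tgt : E → V

namespace MultiGraph

variable {V E : Type*} (G : MultiGraph V E)

/-- The set of terminal points of an edge. -/
def ends (e : E) : Set V := {G.src e, G.tgt e}

/-- Two vertices are equivalent if they are connected by a chain of edges belonging to `T`. -/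
def joined (T : Set E) : Setoid V :=
  Relation.EqvGen.setoid fun u v => ∃ e ∈ T, G.src e = u ∧ G.tgt e = v

/-- Connectedness (in particular a connected graph is nonempty). -/
def Connected : Prop :=
  Nonempty V ∧ ∀ u v : V, G.joined Set.univ u v

/-- The graph contains no circle (neither a loop edge, nor a pair of parallel edges, nor a longer
circuit): the terminal points of an edge are never joined by the other edges. -/
def IsAcyclic : Prop :=
  ∀ e : E, ¬ G.joined {e}ᶜ (G.src e) (G.tgt e)

/-- The number of edges that start from `v`. -/
noncomputable def degree (v : V) : ℕ := {e : E | v ∈ G.ends e}.ncard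

/-- Two edges lie in the same irreducible component (block) if no vertex `v` separates them, i.e. if
for every vertex `v` they lie, after removing `v`, in the same connected component. -/
def SameBlock (e f : E) : Prop :=
  ∀ v : V, Relation.ReflTransGen
    (fun a b : E => ∃ u : V, u ≠ v ∧ u ∈ G.ends a ∧ u ∈ G.ends b) e f

/-- The irreducible components of the graph, each given by its set of edges. -/
def blocks : Set (Set E) := Set.range fun e => {f | G.SameBlock e f}

end MultiGraph

/-- A multigraph with an involution `ι` acting on vertices and edges. The auxiliary orientation is
taken to be `ι`-equivariant, which is possible as soon as no edge is mapped to itself. -/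
structure InvGraph (V E : Type*) extends MultiGraph V E where
  iV : V → V
  iE : E → E
  iV_iV : ∀ v, iV (iV v) = v
  iE_iE : ∀ e, iE (iE e) = e
  src_iE : ∀ e, src (iE e) = iV (src e)
  tgt_iE : ∀ e, tgt (iE e) = iV (tgt e)

namespace InvGraph

variable {V E : Type*} (G : InvGraph V E)

/-- The orbit relation of the involution on edges. -/
def edgeSetoid : Setoid E where
  r e f := e = f ∨ e = G.iE f
  iseqv := by
    refine ⟨fun e => Or.inl rfl, ?_, ?_⟩
    · rintro e f (rfl | rfl)
      · exact Or.inl rfl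
      · exact Or.inr (G.iE_iE f).symm
    · rintro e f g (rfl | rfl) (rfl | rfl)
      · exact Or.inl rfl
      · exact Or.inr rfl
      · exact Or.inr rfl
      · exact Or.inl (G.iE_iE g)

/-- The orbit relation of the involution on vertices. -/
def vertSetoid : Setoid V where
  r u v := u = v ∨ u = G.iV v
  iseqv := by
    refine ⟨fun e => Or.inl rfl, ?_, ?_⟩
    · rintro e f (rfl | rfl)
      · exact Or.inl rfl
      · exact Or.inr (G.iV_iV f).symm
    · rintro e f g (rfl | rfl) (rfl | rfl)
      · exact Or.inl rfl
      · exact Or.inr rfl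
      · exact Or.inr rfl
      · exact Or.inl (G.iV_iV g)

/-- The set of edges modulo the involution. -/
def EdgeClass : Type _ := Quotient G.edgeSetoid

/-- The set of vertices modulo the involution. -/
def VertClass : Type _ := Quotient G.vertSetoid

/-- The class of an edge modulo the involution. -/
def cls (e : E) : G.EdgeClass := Quotient.mk G.edgeSetoid e

/-- The class of a vertex modulo the involution. -/
def vcls (v : V) : G.VertClass := Quotient.mk G.vertSetoid v

instance [Finite E] : Finite G.EdgeClass :=
  inferInstanceAs (Finite (Quotient G.edgeSetoid))

noncomputable instance [Finite E] : Fintype G.EdgeClass := Fintype.ofFinite _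

theorem cls_iE (e : E) : G.cls (G.iE e) = G.cls e := Quotient.sound (Or.inr rfl)

/-- The quotient graph of `G` by the involution. -/
def quotientGraph : MultiGraph G.VertClass G.EdgeClass where
  src := Quotient.lift (fun e => G.vcls (G.src e)) (by
    rintro e f (rfl | rfl)
    · rfl
    · exact Quotient.sound (Or.inr (G.src_iE f)))
  tgt := Quotient.lift (fun e => G.vcls (G.tgt e)) (by
    rintro e f (rfl | rfl)
    · rfl
    · exact Quotient.sound (Or.inr (G.tgt_iE f)))

/-- A vertex fixed by the involution. -/
def IsFixed (v : V) : Prop := G.iV v = v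

/-- Hyperelliptic graphs: connected, every edge is a closed interval (not a circle), no edge is
mapped to itself by the involution, at least three edges start from every non-fixed vertex, and the
quotient by the involution is a tree. -/
structure IsHyperelliptic : Prop where
  connected : G.Connected
  interval : ∀ e, G.src e ≠ G.tgt e
  edge_ne : ∀ e, G.iE e ≠ e
  three_le : ∀ v, ¬ G.IsFixed v → 3 ≤ G.degree v
  tree : G.quotientGraph.IsAcyclic

/-- The number of points of `e ∩ ι(e)`, for an edge `e` with `ι(e) ≠ e`: the number of common
terminal points of the two edges. An edge is disjoint, one-jointed or two-jointed according to
whether this number is 0, 1 or 2. -/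
noncomputable def jointing (e : E) : ℕ := (G.ends e ∩ G.ends (G.iE e)).ncard

/-- `ν_G(v)`, the number of disjoint edges starting from `v` plus the number of one-jointed edges
starting from `v`. -/
noncomputable def nu (v : V) : ℕ :=
  {e : E | v ∈ G.ends e ∧ G.jointing e = 0}.ncard +
    {e : E | v ∈ G.ends e ∧ G.jointing e = 1}.ncard

/-- An irreducible component is simple if it consists of two two-jointed edges. -/
def IsSimpleBlock (B : Set E) : Prop := B.ncard = 2 ∧ ∀ e ∈ B, G.jointing e = 2

open Classical in
/-- The size of an irreducible component: 1 if it is simple, and the number of classes of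
one-jointed edges minus 1 otherwise. -/
noncomputable def blockSize (B : Set E) : ℕ :=
  if G.IsSimpleBlock B then 1 else (G.cls '' {e ∈ B | G.jointing e = 1}).ncard - 1

/-- The size of `G`: the sum of the sizes of its irreducible components. -/
noncomputable def size [Finite E] : ℕ :=
  ∑ B ∈ (Set.toFinite G.blocks).toFinset, G.blockSize B

/-- Every irreducible component is simple. -/
def IsSemisimple : Prop := ∀ B ∈ G.blocks, G.IsSimpleBlock B

/-- The edges whose classes belong to `T`. -/
def edgesOver (T : Set G.EdgeClass) : Set E := {e | G.cls e ∈ T}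

theorem joined_iV (T : Set G.EdgeClass) (u v : V) (h : G.joined (G.edgesOver T) u v) :
    G.joined (G.edgesOver T) (G.iV u) (G.iV v) := by
  induction h with
  | rel x y h =>
    obtain ⟨e, he, rfl, rfl⟩ := h
    refine Relation.EqvGen.rel _ _ ⟨G.iE e, ?_, G.src_iE e, G.tgt_iE e⟩
    simpa [edgesOver, cls_iE] using he
  | refl x => exact Relation.EqvGen.refl _
  | symm x y _ ih => exact Relation.EqvGen.symm _ _ ih
  | trans x y z _ _ ih₁ ih₂ => exact Relation.EqvGen.trans _ _ _ ih₁ ih₂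

/-- The vertices of the graph obtained by contracting the edges over `T`. -/
abbrev ContrVert (T : Set G.EdgeClass) : Type _ := Quotient (G.joined (G.edgesOver T))

/-- The edges of the graph obtained by contracting the edges over `T`. -/
abbrev ContrEdge (T : Set G.EdgeClass) : Type _ := {e : E // G.cls e ∉ T}

/-- The vertex of the contracted graph to which a vertex goes. -/
def toContr (T : Set G.EdgeClass) (v : V) : G.ContrVert T := Quotient.mk _ v

/-- The graph `G_T` obtained by contracting all edges whose class is in `T`. -/
def contract (T : Set G.EdgeClass) : InvGraph (G.ContrVert T) (G.ContrEdge T) where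
  src e := G.toContr T (G.src e)
  tgt e := G.toContr T (G.tgt e)
  iV := Quotient.map G.iV (G.joined_iV T)
  iE e := ⟨G.iE e, by rw [G.cls_iE]; exact e.2⟩
  iV_iV := by
    rintro ⟨v⟩
    exact congrArg (G.toContr T) (G.iV_iV v)
  iE_iE e := Subtype.ext (G.iE_iE e)
  src_iE e := congrArg (G.toContr T) (G.src_iE e)
  tgt_iE e := congrArg (G.toContr T) (G.tgt_iE e)

/-- The graph `G^S` obtained by contracting all edges whose class is not in `S`. -/
def keep (S : Set G.EdgeClass) : InvGraph (G.ContrVert Sᶜ) (G.ContrEdge Sᶜ) := G.contract Sᶜ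

open Classical in
/-- The polynomial `L_G`: the sum, over the sets `S` of `n = sz(G)` edge classes such that `G^S` is
a semisimple hyperelliptic graph of size `n`, of the products of the variables `X_ē`, `ē ∈ S`. -/
noncomputable def polyL [Finite E] : MvPolynomial G.EdgeClass ℚ :=
  ∑ S ∈ Finset.univ.powersetCard G.size,
    if (G.keep S).IsHyperelliptic ∧ (G.keep S).IsSemisimple ∧ (G.keep S).size = G.size then
      ∏ ē ∈ S, X ē
    else 0

/-- The classes of non-fixed vertices. -/
def nonFixedClasses : Set G.VertClass := {x | ∃ v, ¬ G.IsFixed v ∧ G.vcls v = x}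

theorem exists_nonFixed (h : G.nonFixedClasses.ncard = 1) : ∃ v, ¬ G.IsFixed v := by
  obtain ⟨x, hx⟩ := Set.ncard_eq_one.mp h
  obtain ⟨v, hv, _⟩ : x ∈ G.nonFixedClasses := by simp [hx]
  exact ⟨v, hv⟩

open Classical in
/-- `ν - 2`, where `ν` is the number of edges starting from a representative of the unique class of
non-fixed vertices, if there is exactly one such class, and 0 otherwise. -/
noncomputable def coeffM : ℚ :=
  if h : G.nonFixedClasses.ncard = 1 then
    (G.degree (Classical.choose (G.exists_nonFixed h)) : ℚ) - 2
  else 0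

/-- The polynomial `M_G`: the sum over the sets `S` of `sz(G) + 1` edge classes of the products of
the variables `X_ē`, `ē ∈ S`, with coefficient `coeffM` of `G^S`. -/
noncomputable def polyM [Finite E] : MvPolynomial G.EdgeClass ℚ :=
  ∑ S ∈ Finset.univ.powersetCard (G.size + 1), C (G.keep (S : Set G.EdgeClass)).coeffM * ∏ ē ∈ S, X ē

open Classical in
/-- The polarization induced by `D` on the graph obtained by contracting the edges over `T`. -/
noncomputable def contrDiv [Fintype V] (T : Set G.EdgeClass) (D : V → ℝ) (x : G.ContrVert T) : ℝ :=
  ∑ v with G.toContr T v = x, D v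

/-- `w(ē) = min {a, b}`, where `a` and `b` are the coefficients of the polarization induced by `D`
on `G^ē` at the two vertices of `G^ē`, i.e. at the terminal points of the image of `e`. -/
noncomputable def weight [Fintype V] (D : V → ℝ) (ē : G.EdgeClass) : ℝ :=
  min (G.contrDiv {ē}ᶜ D (G.toContr {ē}ᶜ (G.src (Quotient.out ē))))
    (G.contrDiv {ē}ᶜ D (G.toContr {ē}ᶜ (G.tgt (Quotient.out ē))))

/-! ### Metrized graphs -/

/-- The involution-invariant Lebesgue measures: a positive length for every class of edges. -/
abbrev Lengths : Type _ := {ℓ : G.EdgeClass → ℝ // ∀ ē, 0 < ℓ ē}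

variable {G}

/-- The length of an edge. -/
def Lengths.len (ℓ : G.Lengths) (e : E) : ℝ := ℓ.1 (G.cls e)

theorem Lengths.len_nonneg (ℓ : G.Lengths) (e : E) : 0 ≤ ℓ.len e := (ℓ.2 _).le

/-- The disjoint union of the vertices and of one interval `[0, ℓ(e)]` for each edge `e`. -/
abbrev PrePoint (ℓ : G.Lengths) : Type _ := V ⊕ Σ e : E, Set.Icc (0 : ℝ) (ℓ.len e)

/-- The end points of each interval are glued to the terminal points of the edge. -/
def Glue (ℓ : G.Lengths) (p q : PrePoint ℓ) : Prop :=
  ∃ (e : E) (t : Set.Icc (0 : ℝ) (ℓ.len e)), p = Sum.inr ⟨e, t⟩ ∧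
    (((t : ℝ) = 0 ∧ q = Sum.inl (G.src e)) ∨ ((t : ℝ) = ℓ.len e ∧ q = Sum.inl (G.tgt e)))

/-- The topological space underlying the metrized graph. -/
def Space (ℓ : G.Lengths) : Type _ := Quot (Glue ℓ)

/-- The quotient topology, the set of vertices being discrete. -/
instance (ℓ : G.Lengths) : TopologicalSpace (Space ℓ) :=
  letI : TopologicalSpace V := ⊥
  inferInstanceAs (TopologicalSpace (Quot (Glue ℓ)))

instance (ℓ : G.Lengths) : MeasurableSpace (Space ℓ) := borel _

instance (ℓ : G.Lengths) : BorelSpace (Space ℓ) := ⟨rfl⟩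

/-- A vertex as a point of the metrized graph. -/
def vert (ℓ : G.Lengths) (v : V) : Space ℓ := Quot.mk _ (Sum.inl v)

/-- The arc-length parametrization of the edge `e` by `[0, ℓ(e)]` (extended by constants). -/
noncomputable def onEdge (ℓ : G.Lengths) (e : E) (t : ℝ) : Space ℓ :=
  Quot.mk _ (Sum.inr ⟨e, Set.projIcc 0 (ℓ.len e) (ℓ.len_nonneg e) t⟩)

/-- `Δ f = ρ` in the sense of distributions, for a continuous function `f` and a signed
measure `ρ`. The Laplacian of a function `φ` which is given on each edge `e` by a twice continuously
differentiable function `u e` of the arc length is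
`- φ'' dx - ∑ᵥ (sum of the outgoing derivatives of φ at v) δᵥ`,
so that `Δ f = ρ` means `∫ φ dρ = ∫ f d(Δ φ)` for all such `φ`. -/
def HasLaplacian [Fintype E] (ℓ : G.Lengths) (f : Space ℓ → ℝ) (ρ : SignedMeasure (Space ℓ)) :
    Prop :=
  ∀ (φ : Space ℓ → ℝ) (u : E → ℝ → ℝ), (∀ e, ContDiff ℝ 2 (u e)) →
    (∀ e, ∀ t ∈ Set.Icc 0 (ℓ.len e), φ (onEdge ℓ e t) = u e t) →
    ∫ᵛ x, φ x ∂<•ρ =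
      - (∑ e, ∫ t in (0 : ℝ)..ℓ.len e, f (onEdge ℓ e t) * deriv (deriv (u e)) t)
      - ∑ e, (f (vert ℓ (G.src e)) * deriv (u e) 0
          - f (vert ℓ (G.tgt e)) * deriv (u e) (ℓ.len e))

/-- `μ` and `g` are the admissible measure and the Green function of the metrized graph with
polarization `D`, and `c` is the constant `g(D, y) + g(y, y)`. -/
structure IsAdmissible [Fintype V] [Fintype E] (ℓ : G.Lengths) (D : V → ℝ)
    (μ : SignedMeasure (Space ℓ)) (g : Space ℓ → Space ℓ → ℝ) (c : ℝ) : Prop where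
  total : μ Set.univ = 1
  symm : ∀ x y, g x y = g y x
  cont : Continuous fun p : Space ℓ × Space ℓ => g p.1 p.2
  laplacian : ∀ x, HasLaplacian ℓ (g x) ((Measure.dirac x).toSignedMeasure - μ)
  integral : ∀ x, ∫ᵛ y, g x y ∂<•μ = 0
  const : ∀ y, ∑ v, D v * g (vert ℓ v) y + g y y = c

/-- `ε` is the admissible constant `2 deg(D) c - g(D, D)` of the metrized graph with
polarization `D`, computed from its admissible measure and its Green function. -/
def IsAdmissibleConstant [Fintype V] [Fintype E] (ℓ : G.Lengths) (D : V → ℝ) (ε : ℝ) : Prop :=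
  ∃ μ g c, IsAdmissible ℓ D μ g c ∧
    ε = 2 * (∑ v, D v) * c - ∑ v, ∑ w, D v * D w * g (vert ℓ v) (vert ℓ w)

end InvGraph

/-! The admissible constant is first expressed through any Green kernel `N` on the finite vertex set
with potential 0 at a base vertex `v₀`. Extending `N` linearly over the edges and adding the Green
functions of the intervals gives a kernel with Laplacian `δ_x - δ_{v₀}`. The admissible Green
function is this kernel plus `h(x) + h(y)` plus a constant: constancy of `g(D,y) + g(y,y)` dictates
`h` (here `deg D + 2 ≠ 0` enters), the normalization dictates that the constant is the Dirichlet
energy `E` of `h`, and one finds `ε = d (d + 2) E - N(D,D)` with `d = deg D`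
(`isAdmissibleConstant_iff`).

For a hyperelliptic graph take `v₀` fixed by `ι` and split functions into even and odd ones. Even
functions live on the quotient tree. A double cover of a forest is trivial, so after a choice of
signs on the two sheets odd functions become functions on the tree that vanish at the classes of
fixed vertices. Hence `N` is half the path kernel of the tree plus half its Dirichlet Green function
`γ`, twisted by the signs (`isGreenKernel`). Since `D` is invariant off the fixed vertices, its
potential sees only the even part, and `γ` enters `E` only through the values `N(v,v)` and the
resistances between the ends of edges. On a tree `c (γ(a,a) γ(b,b) - γ(a,b)²) = γ(a,b)` for the ends
`a`, `b` of an edge of conductance `c`; this turns the terms of `E` quadratic in `γ`, together with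
the resistances, into a multiple of `Θ = Σ_x (deg x - 2) γ(x,x)` (`sum_degree_sub_two_mul_green`).
The remaining linear terms are multiples of `Θ` by summation along the tree, and in total `(d + 2)²
E` is an explicit sum over the edge classes plus `2Θ/3` (`admEnergy_hypKernel`).

It remains that `Θ = M_G / L_G`. Counting Euler characteristics block by block, `sz(G)` is the
number of edge classes minus the number of non-fixed vertex classes (`size_add`). So the complements
of the sets in `L_G` are the spanning forests rooted at the fixed classes, and the weighted
matrix-tree theorem identifies `L_G` with the product of all lengths times the determinant of the
Dirichlet Laplacian. This determinant times `γ(x,x)` sums the forests with the additional root `x`.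
When `x` runs over the one component `C` of such a forest that contains no fixed class, `Σ (deg x -
2)` is the number of edges leaving `C` minus 2, which is the coefficient `ν - 2` in `M_G`. -/

set_option linter.unusedSectionVars false

/-! ### The metrized graph: functions, continuity, integration -/

namespace InvGraph

variable {V E : Type*} {G : InvGraph V E}

theorem Lengths.len_pos (ℓ : G.Lengths) (e : E) : 0 < ℓ.len e := ℓ.2 _

theorem onEdge_of_mem (ℓ : G.Lengths) (e : E) (t : Set.Icc (0 : ℝ) (ℓ.len e)) :
    onEdge ℓ e t = Quot.mk _ (Sum.inr ⟨e, t⟩) := by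
  simp only [onEdge, Set.projIcc_val]
  rfl

theorem onEdge_zero (ℓ : G.Lengths) (e : E) : onEdge ℓ e 0 = vert ℓ (G.src e) :=
  Quot.sound ⟨e, _, rfl, Or.inl ⟨by simp, rfl⟩⟩

theorem onEdge_len (ℓ : G.Lengths) (e : E) : onEdge ℓ e (ℓ.len e) = vert ℓ (G.tgt e) :=
  Quot.sound ⟨e, _, rfl, Or.inr ⟨by simp, rfl⟩⟩

theorem space_cases {ℓ : G.Lengths} (x : Space ℓ) :
    (∃ v, x = vert ℓ v) ∨ ∃ e, ∃ t ∈ Set.Icc 0 (ℓ.len e), x = onEdge ℓ e t := by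
  obtain ⟨p, rfl⟩ := Quot.exists_rep x
  rcases p with (v | ⟨e, t⟩)
  · exact Or.inl ⟨v, rfl⟩
  · exact Or.inr ⟨e, t, t.2, (onEdge_of_mem ℓ e t).symm⟩

/-- A function on the metrized graph, given by its values at the vertices and on the edges. -/
def glueFun {α : Type*} (ℓ : G.Lengths) (a : V → α) (u : E → ℝ → α)
    (h₀ : ∀ e, u e 0 = a (G.src e)) (h₁ : ∀ e, u e (ℓ.len e) = a (G.tgt e)) : Space ℓ → α :=
  Quot.lift (Sum.elim a fun p => u p.1 p.2) (by
    rintro _ _ ⟨e, t, rfl, (⟨h, rfl⟩ | ⟨h, rfl⟩)⟩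
    · simp [h, h₀]
    · simp [h, h₁])

section glueFun
variable {α : Type*} (ℓ : G.Lengths) (a : V → α) (u : E → ℝ → α)
    (h₀ : ∀ e, u e 0 = a (G.src e)) (h₁ : ∀ e, u e (ℓ.len e) = a (G.tgt e))

@[simp] theorem glueFun_vert (v : V) : glueFun ℓ a u h₀ h₁ (vert ℓ v) = a v := rfl

theorem glueFun_onEdge (e : E) {t : ℝ} (ht : t ∈ Set.Icc 0 (ℓ.len e)) :
    glueFun ℓ a u h₀ h₁ (onEdge ℓ e t) = u e t := by
  rw [show onEdge ℓ e t = _ from onEdge_of_mem ℓ e ⟨t, ht⟩]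
  rfl

end glueFun

theorem continuous_onEdge (ℓ : G.Lengths) (e : E) : Continuous (onEdge ℓ e) := by
  let : TopologicalSpace V := ⊥
  exact continuous_quot_mk.comp (continuous_inr.comp
    (continuous_sigmaMk.comp (continuous_projIcc (h := ℓ.len_nonneg e))))

theorem continuous_of_edges {α : Type*} [TopologicalSpace α] {ℓ : G.Lengths} {f : Space ℓ → α}
    (hf : ∀ e, ContinuousOn (fun t => f (onEdge ℓ e t)) (Set.Icc 0 (ℓ.len e))) :
    Continuous f := by
  let : TopologicalSpace V := ⊥
  have : DiscreteTopology V := ⟨rfl⟩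
  refine continuous_quot_lift (r := Glue ℓ) (f := fun p => f (Quot.mk _ p)) (fun a b h => by
    rw [Quot.sound h]) ?_ |>.congr ?_
  · refine continuous_sum_dom.2 ⟨continuous_of_discreteTopology, continuous_sigma fun e => ?_⟩
    have := continuousOn_iff_continuous_domRestrict.1 (hf e)
    refine this.congr fun t => ?_
    simp only [Set.domRestrict_apply]
    rw [onEdge_of_mem]
    rfl
  · rintro ⟨p⟩
    rfl

instance [Finite V] [Finite E] (ℓ : G.Lengths) : CompactSpace (Space ℓ) := by
  let : TopologicalSpace V := ⊥
  have : DiscreteTopology V := ⟨rfl⟩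
  exact inferInstanceAs (CompactSpace (Quot (Glue ℓ)))

theorem integrable_of_continuous [Finite V] [Finite E] {ℓ : G.Lengths}
    (μ : SignedMeasure (Space ℓ)) {f : Space ℓ → ℝ} (hf : Continuous f) : μ.Integrable f := by
  have : IsFiniteMeasure μ.variation := by
    rw [← SignedMeasure.totalVariation_eq_variation]; infer_instance
  obtain ⟨C, hC⟩ := isCompact_univ.exists_bound_of_continuousOn hf.continuousOn
  exact Integrable.of_bound hf.measurable.aestronglyMeasurable C
    (Filter.Eventually.of_forall fun x => hC x trivial)

theorem integral_dirac_toSignedMeasure [Finite V] [Finite E] {ℓ : G.Lengths} {f : Space ℓ → ℝ}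
    (hf : Continuous f) (x : Space ℓ) :
    ∫ᵛ y, f y ∂<•(Measure.dirac x).toSignedMeasure = f x := by
  rw [VectorMeasure.integral_toSignedMeasure]
  exact integral_dirac' f x hf.measurable.stronglyMeasurable

/-- The length measure on an edge. -/
noncomputable def edgeMeasure (ℓ : G.Lengths) (e : E) : Measure (Space ℓ) :=
  (volume.restrict (Set.Ioc 0 (ℓ.len e))).map (onEdge ℓ e)

instance (ℓ : G.Lengths) (e : E) : IsFiniteMeasure (edgeMeasure ℓ e) := by
  unfold edgeMeasure; infer_instance

theorem integral_edgeMeasure {ℓ : G.Lengths} {f : Space ℓ → ℝ} (hf : Continuous f) (e : E) :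
    ∫ᵛ y, f y ∂<•(edgeMeasure ℓ e).toSignedMeasure = ∫ t in (0 : ℝ)..ℓ.len e, f (onEdge ℓ e t) := by
  rw [VectorMeasure.integral_toSignedMeasure, edgeMeasure,
    integral_map (continuous_onEdge ℓ e).measurable.aemeasurable
      hf.measurable.aestronglyMeasurable,
    intervalIntegral.integral_of_le (ℓ.len_nonneg e)]

end InvGraph

/-! ### Calculus on an interval -/

section
variable {u : ℝ → ℝ}

theorem ContDiff.hasDerivAt_of_two (hu : ContDiff ℝ 2 u) (t : ℝ) :
    HasDerivAt u (deriv u t) t ∧ HasDerivAt (deriv u) (deriv (deriv u) t) t ∧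
      Continuous (deriv (deriv u)) := by
  have h1 : ContDiff ℝ 1 (deriv u) := by
    have : ContDiff ℝ (1 + 1) u := by simpa [one_add_one_eq_two] using hu
    exact (contDiff_succ_iff_deriv.1 this).2.2
  exact ⟨(hu.differentiable (by norm_num) t).hasDerivAt, (h1.differentiable (by norm_num) t).hasDerivAt,
    (h1.continuous_deriv le_rfl)⟩

/-- Integration of `f u''` for a quadratic polynomial `f`. -/
theorem integral_quadratic_mul_deriv_deriv (hu : ContDiff ℝ 2 u) (a b c s t : ℝ) :
    ∫ x in s..t, (a + b * x + c * x ^ 2) * deriv (deriv u) x =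
      ((a + b * t + c * t ^ 2) * deriv u t - (b + 2 * c * t) * u t)
      - ((a + b * s + c * s ^ 2) * deriv u s - (b + 2 * c * s) * u s)
      + 2 * c * ∫ x in s..t, u x := by
  have key : ∫ x in s..t, ((a + b * x + c * x ^ 2) * deriv (deriv u) x - 2 * c * u x) =
      ((a + b * t + c * t ^ 2) * deriv u t - (b + 2 * c * t) * u t)
      - ((a + b * s + c * s ^ 2) * deriv u s - (b + 2 * c * s) * u s) := by
    refine intervalIntegral.integral_eq_sub_of_hasDerivAt
      (f := fun x => (a + b * x + c * x ^ 2) * deriv u x - (b + 2 * c * x) * u x) (fun x _ => ?_) ?_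
    · obtain ⟨h1, h2, -⟩ := hu.hasDerivAt_of_two x
      have hp : HasDerivAt (fun x : ℝ => a + b * x + c * x ^ 2) (b + 2 * c * x) x := by
        have := (((hasDerivAt_id x).const_mul b).const_add a).add (((hasDerivAt_id x).pow 2).const_mul c)
        refine this.congr_deriv ?_
        simp; ring
      have hq : HasDerivAt (fun x : ℝ => b + 2 * c * x) (2 * c) x := by
        have := ((hasDerivAt_id x).const_mul (2 * c)).const_add b
        refine this.congr_deriv ?_
        simp
      refine ((hp.mul h2).sub (hq.mul h1)).congr_deriv ?_
      ring
    · have := (hu.hasDerivAt_of_two 0).2.2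
      have := hu.continuous
      exact (by fun_prop : Continuous _).intervalIntegrable _ _
  have h3 := (hu.hasDerivAt_of_two 0).2.2
  have h4 := hu.continuous
  rw [intervalIntegral.integral_sub ((by fun_prop : Continuous _).intervalIntegrable _ _)
    ((by fun_prop : Continuous _).intervalIntegrable _ _), intervalIntegral.integral_const_mul] at key
  linarith

/-- Integration of `f u''` where `f` is the Green function of an interval. -/
theorem integral_green_mul_deriv_deriv (hu : ContDiff ℝ 2 u) {l s : ℝ} (hl : 0 < l)
    (hs : s ∈ Set.Icc 0 l) :
    ∫ x in (0 : ℝ)..l, (min s x - s * x / l) * deriv (deriv u) x =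
      (1 - s / l) * u 0 + s / l * u l - u s := by
  have h3 := (hu.hasDerivAt_of_two 0).2.2
  have hi : ∀ a b : ℝ, IntervalIntegrable (fun x => (min s x - s * x / l) * deriv (deriv u) x) volume a b :=
    fun a b => (by fun_prop : Continuous _).intervalIntegrable _ _
  rw [← intervalIntegral.integral_add_adjacent_intervals (hi 0 s) (hi s l)]
  have e1 : ∫ x in (0 : ℝ)..s, (min s x - s * x / l) * deriv (deriv u) x =
      ∫ x in (0 : ℝ)..s, (0 + (1 - s / l) * x + 0 * x ^ 2) * deriv (deriv u) x := by
    refine intervalIntegral.integral_congr fun x hx => ?_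
    rw [Set.uIcc_of_le hs.1] at hx
    simp only [min_eq_right hx.2]; ring
  have e2 : ∫ x in s..l, (min s x - s * x / l) * deriv (deriv u) x =
      ∫ x in s..l, (s + (- (s / l)) * x + 0 * x ^ 2) * deriv (deriv u) x := by
    refine intervalIntegral.integral_congr fun x hx => ?_
    rw [Set.uIcc_of_le hs.2] at hx
    simp only [min_eq_left hx.1]; ring
  rw [e1, e2, integral_quadratic_mul_deriv_deriv hu, integral_quadratic_mul_deriv_deriv hu]
  field_simp
  ring

theorem integral_bump {l : ℝ} (hl : 0 < l) : ∫ x in (0 : ℝ)..l, x * (1 - x / l) = l ^ 2 / 6 := by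
  have : (fun x : ℝ => x * (1 - x / l)) = fun x => x - l⁻¹ * x ^ 2 := by
    ext x; field_simp
  rw [this, intervalIntegral.integral_sub (by simp)
    ((by fun_prop : Continuous _).intervalIntegrable _ _), intervalIntegral.integral_const_mul]
  simp; field_simp; norm_num

theorem integral_affine (a b l : ℝ) (hl : 0 < l) :
    ∫ x in (0 : ℝ)..l, ((1 - x / l) * a + x / l * b) = l * (a + b) / 2 := by
  have : (fun x : ℝ => (1 - x / l) * a + x / l * b) = fun x => a + ((b - a) / l) * x := by
    ext x; field_simp; ring
  rw [this, intervalIntegral.integral_add (by simp)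
    ((by fun_prop : Continuous _).intervalIntegrable _ _), intervalIntegral.integral_const_mul]
  simp; field_simp; ring

/-- The function `z ↦ ‖z‖ (1 - ‖z‖ / p)` on a circle is `t (1 - t / p)` in the coordinate `t`. -/
theorem AddCircle.norm_mul_one_sub {p t : ℝ} (hp : 0 < p) (ht : |t| ≤ p) :
    ‖(t : AddCircle p)‖ * (1 - ‖(t : AddCircle p)‖ / p) = |t| * (1 - |t| / p) := by
  have hp' : |p| = p := abs_of_pos hp
  by_cases h : |t| ≤ p / 2
  · rw [(AddCircle.norm_coe_eq_abs_iff p hp.ne').2 (by rwa [hp'])]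
  · push Not at h
    have key : ‖(t : AddCircle p)‖ = p - |t| := by
      rcases le_total 0 t with h0 | h0
      · rw [abs_of_nonneg h0] at *
        have : (t : AddCircle p) = ((t - p : ℝ) : AddCircle p) := by
          rw [AddCircle.coe_sub, AddCircle.coe_period, sub_zero]
        rw [this, (AddCircle.norm_coe_eq_abs_iff p hp.ne').2, abs_of_nonpos] <;>
          [skip; linarith; (rw [hp', abs_of_nonpos] <;> linarith)]
        ring
      · rw [abs_of_nonpos h0] at *
        have : (t : AddCircle p) = ((t + p : ℝ) : AddCircle p) := by simp
        rw [this, (AddCircle.norm_coe_eq_abs_iff p hp.ne').2, abs_of_nonneg] <;>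
          [skip; linarith; (rw [hp', abs_of_nonneg] <;> linarith)]
        ring
    rw [key]; field_simp; ring

/-- Polarization writes the Green function of an interval through `q(t) = |t| (1 - |t| / l)` alone.
By `AddCircle.norm_mul_one_sub` this `q` descends to the circle of length `l`, where both ends of
the edge become the point 0; hence the definition of `locGreen` by circle coordinates, for which
gluing and continuity are automatic. -/
theorem min_sub_mul_div {s t l : ℝ} :
    min s t - s * t / l =
      (s * (1 - s / l) + t * (1 - t / l) - |s - t| * (1 - |s - t| / l)) / 2 := by
  have h : |s - t| * |s - t| = (s - t) * (s - t) := abs_mul_abs_self _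
  have : |s - t| * (1 - |s - t| / l) = |s - t| - (s - t) * (s - t) / l := by
    rw [← h]; ring
  rw [this]
  rcases le_total s t with h | h
  · rw [min_eq_left h, abs_of_nonpos (by linarith)]; ring
  · rw [min_eq_right h, abs_of_nonneg (by linarith)]; ring

end

/-! ### Extension of a kernel from the vertices to the metrized graph -/

namespace InvGraph

section
variable {V E : Type*} {G : InvGraph V E} (ℓ : G.Lengths)

open Classical in
/-- The piecewise linear function which is `1` at `v` and `0` at the other vertices. -/
noncomputable def hat (v : V) : Space ℓ → ℝ :=
  glueFun ℓ (fun w => if v = w then 1 else 0)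
    (fun e t => (1 - t / ℓ.len e) * (if v = G.src e then 1 else 0)
      + t / ℓ.len e * (if v = G.tgt e then 1 else 0))
    (fun e => by simp) (fun e => by simp [(ℓ.len_pos e).ne'])

theorem continuous_hat (v : V) : Continuous (hat ℓ v) := by
  classical
  refine continuous_of_edges fun e => ContinuousOn.congr (f := fun t => (1 - t / ℓ.len e) *
    (if v = G.src e then 1 else 0) + t / ℓ.len e * (if v = G.tgt e then 1 else 0))
    (by fun_prop) fun t ht => glueFun_onEdge _ _ _ _ _ _ ht

theorem sum_hat_vert [Fintype V] (f : V → ℝ) (w : V) :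
    ∑ v, f v * hat ℓ v (vert ℓ w) = f w := by
  classical
  simp [hat]

theorem sum_hat_onEdge [Fintype V] (f : V → ℝ) (e : E) {t : ℝ} (ht : t ∈ Set.Icc 0 (ℓ.len e)) :
    ∑ v, f v * hat ℓ v (onEdge ℓ e t) =
      (1 - t / ℓ.len e) * f (G.src e) + t / ℓ.len e * f (G.tgt e) := by
  classical
  simp only [hat, glueFun_onEdge _ _ _ _ _ _ ht, mul_add, Finset.sum_add_distrib]
  congr 1 <;> simp [mul_comm]

open Classical in
/-- The coordinate on an edge as a point of a circle, constant on the other edges. -/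
noncomputable def circ (e : E) : Space ℓ → AddCircle (ℓ.len e) :=
  glueFun ℓ (fun _ => 0) (fun e' t => if e' = e then (t : AddCircle (ℓ.len e)) else 0)
    (fun e' => by simp) (fun e' => by
      split_ifs with h
      · subst h; exact AddCircle.coe_period _
      · rfl)

theorem continuous_circ (e : E) : Continuous (circ ℓ e) := by
  classical
  refine continuous_of_edges fun e' => ?_
  have h : Set.EqOn (fun t => circ ℓ e (onEdge ℓ e' t))
      (fun t => if e' = e then (t : AddCircle (ℓ.len e)) else 0) (Set.Icc 0 (ℓ.len e')) :=
    fun t ht => glueFun_onEdge _ _ _ _ _ _ ht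
  refine ContinuousOn.congr ?_ h
  split_ifs
  · exact (AddCircle.continuous_mk' _).continuousOn
  · exact continuousOn_const

/-- The sum of the Green functions of the edges. -/
noncomputable def locGreen [Fintype E] (x y : Space ℓ) : ℝ :=
  ∑ e, (‖circ ℓ e x‖ * (1 - ‖circ ℓ e x‖ / ℓ.len e) + ‖circ ℓ e y‖ * (1 - ‖circ ℓ e y‖ / ℓ.len e)
    - ‖circ ℓ e x - circ ℓ e y‖ * (1 - ‖circ ℓ e x - circ ℓ e y‖ / ℓ.len e)) / 2

theorem continuous_locGreen [Fintype E] :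
    Continuous fun p : Space ℓ × Space ℓ => locGreen ℓ p.1 p.2 := by
  have h1 : ∀ e, Continuous fun p : Space ℓ × Space ℓ => circ ℓ e p.1 :=
    fun e => (continuous_circ ℓ e).comp continuous_fst
  have h2 : ∀ e, Continuous fun p : Space ℓ × Space ℓ => circ ℓ e p.2 :=
    fun e => (continuous_circ ℓ e).comp continuous_snd
  unfold locGreen
  fun_prop

theorem locGreen_symm [Fintype E] (x y : Space ℓ) : locGreen ℓ x y = locGreen ℓ y x := by
  unfold locGreen
  refine Finset.sum_congr rfl fun e _ => ?_
  rw [norm_sub_rev]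
  ring

theorem locGreen_vert [Fintype E] (v : V) (y : Space ℓ) : locGreen ℓ (vert ℓ v) y = 0 := by
  unfold locGreen
  refine Finset.sum_eq_zero fun e _ => ?_
  have : circ ℓ e (vert ℓ v) = 0 := rfl
  simp [this]

theorem locGreen_onEdge_self [Fintype E] (e : E) {s t : ℝ} (hs : s ∈ Set.Icc 0 (ℓ.len e))
    (ht : t ∈ Set.Icc 0 (ℓ.len e)) :
    locGreen ℓ (onEdge ℓ e s) (onEdge ℓ e t) = min s t - s * t / ℓ.len e := by
  classical
  unfold locGreen
  rw [Finset.sum_eq_single e]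
  · have hl := ℓ.len_pos e
    have h : ∀ {s : ℝ}, s ∈ Set.Icc 0 (ℓ.len e) → circ ℓ e (onEdge ℓ e s) = (s : AddCircle _) :=
      fun hs => by rw [circ, glueFun_onEdge _ _ _ _ _ _ hs, if_pos rfl]
    have hst : |s - t| ≤ ℓ.len e := abs_sub_le_iff.2 ⟨by linarith [hs.2, ht.1], by linarith [hs.1, ht.2]⟩
    rw [h hs, h ht, ← AddCircle.coe_sub, AddCircle.norm_mul_one_sub hl hst,
      AddCircle.norm_mul_one_sub hl (by rw [abs_of_nonneg hs.1]; exact hs.2),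
      AddCircle.norm_mul_one_sub hl (by rw [abs_of_nonneg ht.1]; exact ht.2), min_sub_mul_div,
      abs_of_nonneg hs.1, abs_of_nonneg ht.1]
  · intro e' _ he'
    rw [circ, glueFun_onEdge _ _ _ _ _ _ hs, if_neg he'.symm]
    simp
  · simp

theorem locGreen_onEdge_of_ne [Fintype E] {e e' : E} (he : e ≠ e') {s t : ℝ}
    (hs : s ∈ Set.Icc 0 (ℓ.len e)) (ht : t ∈ Set.Icc 0 (ℓ.len e')) :
    locGreen ℓ (onEdge ℓ e s) (onEdge ℓ e' t) = 0 := by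
  classical
  unfold locGreen
  refine Finset.sum_eq_zero fun e'' _ => ?_
  rw [circ, glueFun_onEdge _ _ _ _ _ _ hs, glueFun_onEdge _ _ _ _ _ _ ht]
  by_cases h : e = e''
  · subst h
    simp [he.symm]
  · simp [h]

/-- The kernel on the metrized graph extending a kernel `N` on the vertices. -/
noncomputable def kern [Fintype V] [Fintype E] (N : V → V → ℝ) (x y : Space ℓ) : ℝ :=
  ∑ w, (∑ v, N v w * hat ℓ v x) * hat ℓ w y + locGreen ℓ x y

theorem continuous_kern [Fintype V] [Fintype E] (N : V → V → ℝ) :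
    Continuous fun p : Space ℓ × Space ℓ => kern ℓ N p.1 p.2 := by
  have h1 : ∀ v, Continuous fun p : Space ℓ × Space ℓ => hat ℓ v p.1 :=
    fun v => (continuous_hat ℓ v).comp continuous_fst
  have h2 : ∀ v, Continuous fun p : Space ℓ × Space ℓ => hat ℓ v p.2 :=
    fun v => (continuous_hat ℓ v).comp continuous_snd
  have := continuous_locGreen ℓ
  unfold kern
  fun_prop

theorem kern_symm [Fintype V] [Fintype E] {N : V → V → ℝ} (hN : ∀ v w, N v w = N w v)
    (x y : Space ℓ) : kern ℓ N x y = kern ℓ N y x := by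
  unfold kern
  rw [locGreen_symm]
  simp only [Finset.sum_mul]
  rw [Finset.sum_comm]
  congr 1
  refine Finset.sum_congr rfl fun v _ => Finset.sum_congr rfl fun w _ => ?_
  rw [hN]; ring

theorem kern_vert_right [Fintype V] [Fintype E] (N : V → V → ℝ) (x : Space ℓ) (w : V) :
    kern ℓ N x (vert ℓ w) = ∑ v, N v w * hat ℓ v x := by
  rw [kern, locGreen_symm, locGreen_vert, sum_hat_vert, add_zero]

theorem kern_vert_vert [Fintype V] [Fintype E] (N : V → V → ℝ) (v w : V) :
    kern ℓ N (vert ℓ v) (vert ℓ w) = N v w := by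
  rw [kern_vert_right, sum_hat_vert]

theorem kern_onEdge_right [Fintype V] [Fintype E] (N : V → V → ℝ) (x : Space ℓ) (e : E) {t : ℝ}
    (ht : t ∈ Set.Icc 0 (ℓ.len e)) :
    kern ℓ N x (onEdge ℓ e t) = (1 - t / ℓ.len e) * kern ℓ N x (vert ℓ (G.src e)) +
      t / ℓ.len e * kern ℓ N x (vert ℓ (G.tgt e)) + locGreen ℓ x (onEdge ℓ e t) := by
  rw [kern_vert_right, kern_vert_right, kern,
    sum_hat_onEdge ℓ (fun w => ∑ v, N v w * hat ℓ v x) e ht]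

theorem kern_vert_left_onEdge [Fintype V] [Fintype E] (N : V → V → ℝ) (v : V) (e : E) {t : ℝ}
    (ht : t ∈ Set.Icc 0 (ℓ.len e)) :
    kern ℓ N (vert ℓ v) (onEdge ℓ e t) = (1 - t / ℓ.len e) * N v (G.src e) +
      t / ℓ.len e * N v (G.tgt e) := by
  rw [kern_onEdge_right _ _ _ _ ht, kern_vert_vert, kern_vert_vert, locGreen_vert, add_zero]

theorem kern_onEdge_self [Fintype V] [Fintype E] (N : V → V → ℝ) (hN : ∀ v w, N v w = N w v)
    (e : E) {t : ℝ} (ht : t ∈ Set.Icc 0 (ℓ.len e)) :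
    kern ℓ N (onEdge ℓ e t) (onEdge ℓ e t) = (1 - t / ℓ.len e) * N (G.src e) (G.src e) +
      t / ℓ.len e * N (G.tgt e) (G.tgt e) + (1 - (N (G.src e) (G.src e) + N (G.tgt e) (G.tgt e)
        - 2 * N (G.src e) (G.tgt e)) / ℓ.len e) * (t * (1 - t / ℓ.len e)) := by
  have hl := (ℓ.len_pos e).ne'
  rw [kern_onEdge_right _ _ _ _ ht, locGreen_onEdge_self ℓ e ht ht, kern_symm ℓ hN,
    kern_symm ℓ hN _ (vert ℓ (G.tgt e)), kern_vert_left_onEdge _ _ _ _ ht,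
    kern_vert_left_onEdge _ _ _ _ ht, min_self, hN (G.tgt e) (G.src e)]
  field_simp
  ring

end

end InvGraph

/-! ### The distributional Laplacian and its Green kernel -/

namespace InvGraph

section
variable {V E : Type*} {G : InvGraph V E} [Fintype V] [Fintype E] (ℓ : G.Lengths)

/-- The pairing of a function `f` with the Laplacian of the function given by `u` on the edges. -/
noncomputable def lapPair (f : Space ℓ → ℝ) (u : E → ℝ → ℝ) : ℝ :=
  - (∑ e, ∫ t in (0 : ℝ)..ℓ.len e, f (onEdge ℓ e t) * deriv (deriv (u e)) t)
      - ∑ e, (f (vert ℓ (G.src e)) * deriv (u e) 0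
          - f (vert ℓ (G.tgt e)) * deriv (u e) (ℓ.len e))

/-- `φ` is given on the edges by the twice continuously differentiable functions `u e`. -/
def IsSmooth (φ : Space ℓ → ℝ) (u : E → ℝ → ℝ) : Prop :=
  (∀ e, ContDiff ℝ 2 (u e)) ∧ ∀ e, ∀ t ∈ Set.Icc 0 (ℓ.len e), φ (onEdge ℓ e t) = u e t

theorem hasLaplacian_iff {f : Space ℓ → ℝ} {ρ : SignedMeasure (Space ℓ)} :
    HasLaplacian ℓ f ρ ↔ ∀ φ u, IsSmooth ℓ φ u → ∫ᵛ x, φ x ∂<•ρ = lapPair ℓ f u :=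
  ⟨fun h φ u hu => h φ u hu.1 hu.2, fun h φ u h1 h2 => h φ u ⟨h1, h2⟩⟩

variable {ℓ}

theorem IsSmooth.continuous {φ : Space ℓ → ℝ} {u : E → ℝ → ℝ} (h : IsSmooth ℓ φ u) :
    Continuous φ :=
  continuous_of_edges fun e => (h.1 e).continuous.continuousOn.congr (h.2 e)

theorem IsSmooth.src {φ : Space ℓ → ℝ} {u : E → ℝ → ℝ} (h : IsSmooth ℓ φ u) (e : E) :
    φ (vert ℓ (G.src e)) = u e 0 := by
  rw [← onEdge_zero, h.2 e 0 ⟨le_rfl, ℓ.len_nonneg e⟩]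

theorem IsSmooth.tgt {φ : Space ℓ → ℝ} {u : E → ℝ → ℝ} (h : IsSmooth ℓ φ u) (e : E) :
    φ (vert ℓ (G.tgt e)) = u e (ℓ.len e) := by
  rw [← onEdge_len, h.2 e _ ⟨ℓ.len_nonneg e, le_rfl⟩]

theorem lapPair_eq_sum (f : Space ℓ → ℝ) (u : E → ℝ → ℝ) :
    lapPair ℓ f u = ∑ e, (- (∫ t in (0 : ℝ)..ℓ.len e, f (onEdge ℓ e t) * deriv (deriv (u e)) t)
      - (f (vert ℓ (G.src e)) * deriv (u e) 0 - f (vert ℓ (G.tgt e)) * deriv (u e) (ℓ.len e))) := by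
  simp only [lapPair, Finset.sum_sub_distrib, Finset.sum_neg_distrib]

theorem intervalIntegrable_mul_deriv {f : Space ℓ → ℝ} (hf : Continuous f) {u : ℝ → ℝ}
    (hu : ContDiff ℝ 2 u) (e : E) (a b : ℝ) :
    IntervalIntegrable (fun t => f (onEdge ℓ e t) * deriv (deriv u) t) volume a b := by
  have h3 := (hu.hasDerivAt_of_two 0).2.2
  have := continuous_onEdge ℓ e
  exact (by fun_prop : Continuous _).intervalIntegrable _ _

theorem lapPair_add {f g : Space ℓ → ℝ} (hf : Continuous f) (hg : Continuous g) {u : E → ℝ → ℝ}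
    (hu : ∀ e, ContDiff ℝ 2 (u e)) :
    lapPair ℓ (fun x => f x + g x) u = lapPair ℓ f u + lapPair ℓ g u := by
  simp only [lapPair_eq_sum, ← Finset.sum_add_distrib]
  refine Finset.sum_congr rfl fun e _ => ?_
  simp only [add_mul]
  rw [intervalIntegral.integral_add (intervalIntegrable_mul_deriv hf (hu e) e _ _)
    (intervalIntegrable_mul_deriv hg (hu e) e _ _)]
  ring

theorem lapPair_neg (f : Space ℓ → ℝ) (u : E → ℝ → ℝ) :
    lapPair ℓ (fun x => - f x) u = - lapPair ℓ f u := by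
  simp only [lapPair_eq_sum, ← Finset.sum_neg_distrib, neg_mul, intervalIntegral.integral_neg]
  refine Finset.sum_congr rfl fun e _ => ?_
  ring

theorem lapPair_sub {f g : Space ℓ → ℝ} (hf : Continuous f) (hg : Continuous g) {u : E → ℝ → ℝ}
    (hu : ∀ e, ContDiff ℝ 2 (u e)) :
    lapPair ℓ (fun x => f x - g x) u = lapPair ℓ f u - lapPair ℓ g u := by
  simp only [sub_eq_add_neg]
  rw [lapPair_add hf (show Continuous fun x => - g x from hg.neg) hu, lapPair_neg]

/-- The contribution of an edge on which `f` is a quadratic polynomial. -/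
theorem edge_lapPair_quadratic {u : ℝ → ℝ} (hu : ContDiff ℝ 2 u) {l : ℝ} (hl : 0 < l) (a b c : ℝ) :
    - (∫ t in (0 : ℝ)..l, ((1 - t / l) * a + t / l * b + c * (t * (1 - t / l))) * deriv (deriv u) t)
      - (a * deriv u 0 - b * deriv u l) =
    (b - a) * (u l - u 0) / l + c * (2 / l * (∫ t in (0 : ℝ)..l, u t) - u 0 - u l) := by
  have : (fun t => ((1 - t / l) * a + t / l * b + c * (t * (1 - t / l))) * deriv (deriv u) t) =
      fun t => (a + ((b - a) / l + c) * t + (- (c / l)) * t ^ 2) * deriv (deriv u) t := by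
    ext t; field_simp; ring
  rw [this, integral_quadratic_mul_deriv_deriv hu]
  field_simp
  ring

/-- The Laplacian of a function that is a quadratic polynomial on every edge. -/
theorem lapPair_quadratic {f : Space ℓ → ℝ} {a : V → ℝ} {c : E → ℝ} (ha : ∀ v, f (vert ℓ v) = a v)
    (hf : ∀ e, ∀ t ∈ Set.Icc 0 (ℓ.len e), f (onEdge ℓ e t) = (1 - t / ℓ.len e) * a (G.src e) +
      t / ℓ.len e * a (G.tgt e) + c e * (t * (1 - t / ℓ.len e))) {φ : Space ℓ → ℝ} {u : E → ℝ → ℝ}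
    (hu : IsSmooth ℓ φ u) :
    lapPair ℓ f u = ∑ e, ((a (G.tgt e) - a (G.src e)) *
      (φ (vert ℓ (G.tgt e)) - φ (vert ℓ (G.src e))) / ℓ.len e +
      c e * (2 / ℓ.len e * (∫ t in (0 : ℝ)..ℓ.len e, φ (onEdge ℓ e t)) -
        φ (vert ℓ (G.src e)) - φ (vert ℓ (G.tgt e)))) := by
  rw [lapPair_eq_sum]
  refine Finset.sum_congr rfl fun e _ => ?_
  have hl := ℓ.len_nonneg e
  have e1 : ∫ t in (0 : ℝ)..ℓ.len e, f (onEdge ℓ e t) * deriv (deriv (u e)) t =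
      ∫ t in (0 : ℝ)..ℓ.len e, ((1 - t / ℓ.len e) * a (G.src e) +
      t / ℓ.len e * a (G.tgt e) + c e * (t * (1 - t / ℓ.len e))) * deriv (deriv (u e)) t := by
    refine intervalIntegral.integral_congr fun t ht => ?_
    rw [Set.uIcc_of_le hl] at ht
    simp only [hf e t ht]
  have e2 : ∫ t in (0 : ℝ)..ℓ.len e, φ (onEdge ℓ e t) = ∫ t in (0 : ℝ)..ℓ.len e, u e t := by
    refine intervalIntegral.integral_congr fun t ht => ?_
    rw [Set.uIcc_of_le hl] at ht
    exact hu.2 e t ht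
  rw [e1, e2, ha, ha, edge_lapPair_quadratic (hu.1 e) (ℓ.len_pos e), hu.src, hu.tgt]

theorem lapPair_const (k : ℝ) {φ : Space ℓ → ℝ} {u : E → ℝ → ℝ} (hu : IsSmooth ℓ φ u) :
    lapPair ℓ (fun _ => k) u = 0 := by
  rw [lapPair_quadratic (a := fun _ => k) (c := fun _ => 0) (fun _ => rfl) (fun e t _ => by ring) hu]
  simp

/-- The Laplacian of the Green functions of the edges. -/
theorem lapPair_locGreen (x : Space ℓ) {φ : Space ℓ → ℝ} {u : E → ℝ → ℝ} (hu : IsSmooth ℓ φ u) :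
    lapPair ℓ (locGreen ℓ x) u = φ x - ∑ v, φ (vert ℓ v) * hat ℓ v x := by
  classical
  rw [lapPair_eq_sum]
  have h0 : ∀ v, locGreen ℓ x (vert ℓ v) = 0 := fun v => by rw [locGreen_symm, locGreen_vert]
  simp only [h0, zero_mul, sub_zero]
  rcases space_cases x with ⟨v, rfl⟩ | ⟨e, s, hs, rfl⟩
  · simp only [locGreen_vert, zero_mul, intervalIntegral.integral_zero, neg_zero,
      Finset.sum_const_zero]
    rw [sum_hat_vert ℓ (fun v => φ (vert ℓ v)), sub_self]
  · rw [sum_hat_onEdge ℓ (fun v => φ (vert ℓ v)) e hs, Finset.sum_eq_single e]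
    · have : ∫ t in (0 : ℝ)..ℓ.len e, locGreen ℓ (onEdge ℓ e s) (onEdge ℓ e t) *
          deriv (deriv (u e)) t = ∫ t in (0 : ℝ)..ℓ.len e, (min s t - s * t / ℓ.len e) *
          deriv (deriv (u e)) t := by
        refine intervalIntegral.integral_congr fun t ht => ?_
        rw [Set.uIcc_of_le (ℓ.len_nonneg e)] at ht
        simp only [locGreen_onEdge_self ℓ e hs ht]
      rw [this, integral_green_mul_deriv_deriv (hu.1 e) (ℓ.len_pos e) hs, hu.src, hu.tgt,
        hu.2 e s hs]
      ring
    · intro e' _ he'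
      refine neg_eq_zero.2 ((intervalIntegral.integral_congr (g := fun _ => (0 : ℝ))
        fun t ht => ?_).trans (by simp))
      rw [Set.uIcc_of_le (ℓ.len_nonneg e')] at ht
      simp only [locGreen_onEdge_of_ne ℓ he'.symm hs ht, zero_mul]
    · simp

/-- A Green kernel on the vertices, with potential `0` at `v₀`. -/
structure IsGreenKernel (ℓ : G.Lengths) (v₀ : V) (N : V → V → ℝ) : Prop where
  symm : ∀ v w, N v w = N w v
  base : ∀ w, N v₀ w = 0
  weak : ∀ (w : V) (ψ : V → ℝ), ∑ e, (N w (G.tgt e) - N w (G.src e)) *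
    (ψ (G.tgt e) - ψ (G.src e)) / ℓ.len e = ψ w - ψ v₀

/-- The interval Green functions produce `φ(x)` minus the linear interpolation of `φ` at `x`. The
piecewise linear part produces that interpolation minus `φ(v₀)`, because the hat functions sum to 1.
-/
theorem lapPair_kern {v₀ : V} {N : V → V → ℝ} (hN : IsGreenKernel ℓ v₀ N) (x : Space ℓ)
    {φ : Space ℓ → ℝ} {u : E → ℝ → ℝ} (hu : IsSmooth ℓ φ u) :
    lapPair ℓ (kern ℓ N x) u = φ x - φ (vert ℓ v₀) := by
  have hhat : ∀ v, Continuous (hat ℓ v) := continuous_hat ℓ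
  have hc1 : Continuous fun y => ∑ w, (∑ v, N v w * hat ℓ v x) * hat ℓ w y := by fun_prop
  have hc2 : Continuous fun y => locGreen ℓ x y :=
    Continuous.comp (g := fun p : Space ℓ × Space ℓ => locGreen ℓ p.1 p.2) (f := fun y => (x, y))
      (continuous_locGreen ℓ) (Continuous.prodMk_right x)
  have e1 : lapPair ℓ (kern ℓ N x) u = _ := lapPair_add hc1 hc2 hu.1
  have e2 := lapPair_quadratic (f := fun y => ∑ w, (∑ v, N v w * hat ℓ v x) * hat ℓ w y)
    (a := fun w => ∑ v, N v w * hat ℓ v x) (c := fun _ => 0)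
    (fun w => sum_hat_vert ℓ (fun w => ∑ v, N v w * hat ℓ v x) w) (fun e t ht => by
      rw [sum_hat_onEdge ℓ (fun w => ∑ v, N v w * hat ℓ v x) e ht]; ring) hu
  rw [e1, e2]
  change _ + lapPair ℓ (locGreen ℓ x) u = _
  rw [lapPair_locGreen x hu]
  have : ∑ e, ((∑ v, N v (G.tgt e) * hat ℓ v x - ∑ v, N v (G.src e) * hat ℓ v x) *
      (φ (vert ℓ (G.tgt e)) - φ (vert ℓ (G.src e))) / ℓ.len e) =
      ∑ v, hat ℓ v x * (φ (vert ℓ v) - φ (vert ℓ v₀)) := by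
    simp only [← fun v => hN.weak v (fun w => φ (vert ℓ w)), Finset.mul_sum,
      ← Finset.sum_sub_distrib, Finset.sum_mul, Finset.sum_div]
    rw [Finset.sum_comm]
    refine Finset.sum_congr rfl fun v _ => Finset.sum_congr rfl fun e _ => ?_
    ring
  simp only [zero_mul, add_zero]
  rw [this]
  have h1 : ∑ v, hat ℓ v x = 1 := by
    have h2 : ∑ v, (1 : ℝ) * hat ℓ v x = 1 := by
      rcases space_cases x with ⟨w, rfl⟩ | ⟨e, t, ht, rfl⟩
      · exact sum_hat_vert ℓ (fun _ => 1) w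
      · rw [sum_hat_onEdge ℓ (fun _ => 1) e ht]; ring
    simpa using h2
  simp only [mul_sub, Finset.sum_sub_distrib, ← Finset.sum_mul, h1]
  rw [Finset.sum_congr rfl fun v _ => mul_comm (hat ℓ v x) (φ (vert ℓ v))]
  ring

end

end InvGraph

/-! ### Piecewise quadratic functions and uniqueness up to constants -/

theorem ContDiff.two_of_hasDerivAt {U u w : ℝ → ℝ} (hU : ∀ t, HasDerivAt U (u t) t)
    (hu : ∀ t, HasDerivAt u (w t) t) (hw : Continuous w) : ContDiff ℝ 2 U := by
  have e1 : deriv U = u := funext fun t => (hU t).deriv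
  have e2 : deriv u = w := funext fun t => (hu t).deriv
  have h1 : ContDiff ℝ 1 u :=
    contDiff_one_iff_deriv.2 ⟨fun t => (hu t).differentiableAt, by rwa [e2]⟩
  rw [← one_add_one_eq_two, contDiff_succ_iff_deriv]
  exact ⟨fun t => (hU t).differentiableAt, by simp, by rwa [e1]⟩

namespace InvGraph

section
variable {V E : Type*} {G : InvGraph V E} [Fintype V] [Fintype E] (ℓ : G.Lengths)

/-- The quadratic polynomial on an edge with values given by `h` at the ends and second
derivative `- 2 c / ℓ`. -/
noncomputable def quadEdge (h : V → ℝ) (c : E → ℝ) (e : E) (t : ℝ) : ℝ :=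
  (1 - t / ℓ.len e) * h (G.src e) + t / ℓ.len e * h (G.tgt e) + c e * (t * (1 - t / ℓ.len e))

/-- The function that is given by `quadEdge` on every edge. -/
noncomputable def quadFun (h : V → ℝ) (c : E → ℝ) : Space ℓ → ℝ :=
  glueFun ℓ h (quadEdge ℓ h c) (fun e => by simp [quadEdge])
    (fun e => by simp [quadEdge, (ℓ.len_pos e).ne'])

theorem quadFun_vert (h : V → ℝ) (c : E → ℝ) (v : V) : quadFun ℓ h c (vert ℓ v) = h v := rfl

theorem quadFun_onEdge (h : V → ℝ) (c : E → ℝ) (e : E) {t : ℝ} (ht : t ∈ Set.Icc 0 (ℓ.len e)) :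
    quadFun ℓ h c (onEdge ℓ e t) = quadEdge ℓ h c e t := glueFun_onEdge _ _ _ _ _ _ ht

theorem isSmooth_quadFun (h : V → ℝ) (c : E → ℝ) : IsSmooth ℓ (quadFun ℓ h c) (quadEdge ℓ h c) :=
  ⟨fun e => by unfold quadEdge; fun_prop, fun e _ ht => quadFun_onEdge ℓ h c e ht⟩

theorem hasDerivAt_quadEdge (h : V → ℝ) (c : E → ℝ) (e : E) (t : ℝ) :
    HasDerivAt (quadEdge ℓ h c e)
      ((h (G.tgt e) - h (G.src e)) / ℓ.len e + c e * (1 - 2 * t / ℓ.len e)) t := by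
  have h1 : HasDerivAt (fun t : ℝ => t / ℓ.len e) (1 / ℓ.len e) t := (hasDerivAt_id t).div_const _
  have h2 : HasDerivAt (fun t : ℝ => 1 - t / ℓ.len e) (- (1 / ℓ.len e)) t := h1.const_sub 1
  refine (((h2.mul_const _).add (h1.mul_const _)).add
    (((hasDerivAt_id t).mul h2).const_mul (c e))).congr_deriv ?_
  simp; ring

theorem deriv_deriv_quadEdge (h : V → ℝ) (c : E → ℝ) (e : E) (t : ℝ) :
    deriv (deriv (quadEdge ℓ h c e)) t = - (2 * c e / ℓ.len e) := by
  rw [funext fun t => (hasDerivAt_quadEdge ℓ h c e t).deriv]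
  have h1 : HasDerivAt (fun t : ℝ => 2 * t / ℓ.len e) (2 * 1 / ℓ.len e) t :=
    ((hasDerivAt_id t).const_mul 2).div_const _
  have := ((h1.const_sub 1).const_mul (c e)).const_add ((h (G.tgt e) - h (G.src e)) / ℓ.len e)
  rw [this.deriv]; ring

/-- Compared with `lapPair_quadratic` the two arguments have changed places. This symmetry of the
Dirichlet form is what makes the Laplacian of a piecewise quadratic function an explicit measure,
namely `δ_{v₀}` minus `quadMeasure`. -/
theorem lapPair_quadEdge (f : Space ℓ → ℝ) (h : V → ℝ) (c : E → ℝ) :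
    lapPair ℓ f (quadEdge ℓ h c) = ∑ e, ((f (vert ℓ (G.tgt e)) - f (vert ℓ (G.src e))) *
      (h (G.tgt e) - h (G.src e)) / ℓ.len e +
      c e * (2 / ℓ.len e * (∫ t in (0 : ℝ)..ℓ.len e, f (onEdge ℓ e t)) -
        f (vert ℓ (G.src e)) - f (vert ℓ (G.tgt e)))) := by
  rw [lapPair_eq_sum]
  refine Finset.sum_congr rfl fun e _ => ?_
  have := (ℓ.len_pos e).ne'
  simp only [deriv_deriv_quadEdge, (hasDerivAt_quadEdge ℓ h c e _).deriv,
    intervalIntegral.integral_mul_const]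
  field_simp
  ring

variable {ℓ} in
-- A Weyl lemma. Testing against the piecewise linear extension of `N v` gives equality at the
-- vertices. On an edge, testing against a double primitive of `f - f(v₀)` gives that the integral
-- of its square is 0.
theorem eq_of_forall_lapPair_eq_zero {v₀ : V} {N : V → V → ℝ} (hN : IsGreenKernel ℓ v₀ N)
    {f : Space ℓ → ℝ} (hf : Continuous f) (h : ∀ φ u, IsSmooth ℓ φ u → lapPair ℓ f u = 0)
    (y : Space ℓ) : f y = f (vert ℓ v₀) := by
  classical
  have hv : ∀ v, f (vert ℓ v) = f (vert ℓ v₀) := by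
    intro v
    have h1 := h _ _ (isSmooth_quadFun ℓ (N v) fun _ => 0)
    rw [lapPair_quadEdge] at h1
    have h2 := hN.weak v fun w => f (vert ℓ w)
    simp only [zero_mul, add_zero] at h1
    rw [Finset.sum_congr rfl fun e _ => by rw [mul_comm (N v (G.tgt e) - N v (G.src e))], h1] at h2
    linarith
  rcases space_cases y with ⟨v, rfl⟩ | ⟨e, t, ht, rfl⟩
  · exact hv v
  set k := f (vert ℓ v₀) with hk
  set w : ℝ → ℝ := fun t => f (onEdge ℓ e t) - k with hw
  have hwc : Continuous w := (hf.comp (continuous_onEdge ℓ e)).sub continuous_const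
  set W : ℝ → ℝ := fun t => ∫ s in (0 : ℝ)..t, w s with hW
  have hW' : ∀ t, HasDerivAt W (w t) t := fun t =>
    hwc.integral_hasStrictDerivAt 0 t |>.hasDerivAt
  have hWc : Continuous W := continuous_iff_continuousAt.2 fun t => (hW' t).continuousAt
  set U : ℝ → ℝ := fun t => ∫ s in (0 : ℝ)..t, W s with hU
  have hU' : ∀ t, HasDerivAt U (W t) t := fun t =>
    hWc.integral_hasStrictDerivAt 0 t |>.hasDerivAt
  have hl := ℓ.len_pos e
  -- The linear correction leaves `u'' = w` and makes `u` vanish at both ends, so that it extends by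
  -- 0 to the other edges.
  set u : ℝ → ℝ := fun t => U t - t * (U (ℓ.len e) / ℓ.len e) with hu
  have hu' : ∀ t, HasDerivAt u (W t - U (ℓ.len e) / ℓ.len e) t := fun t =>
    ((hU' t).sub ((hasDerivAt_id t).mul_const (U (ℓ.len e) / ℓ.len e))).congr_deriv (by simp)
  have hu'' : ∀ t, HasDerivAt (fun t => W t - U (ℓ.len e) / ℓ.len e) (w t) t := fun t =>
    (hW' t).sub_const _
  have hu2 : ContDiff ℝ 2 u := ContDiff.two_of_hasDerivAt hu' hu'' hwc
  have hu0 : u 0 = 0 := by simp [hu, hU]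
  have hul : u (ℓ.len e) = 0 := by simp only [hu]; field_simp; ring
  have hd1 : deriv u = fun t => W t - U (ℓ.len e) / ℓ.len e := funext fun t => (hu' t).deriv
  have hd2 : deriv (deriv u) = w := by rw [hd1]; exact funext fun t => (hu'' t).deriv
  have key := h (glueFun ℓ (fun _ => 0) (fun e' => if e' = e then u else 0)
    (fun e' => by split_ifs <;> simp [hu0])
    (fun e' => by split_ifs with h <;> [(subst h; exact hul); rfl]))
    (fun e' => if e' = e then u else 0) ⟨fun e' => by
      change ContDiff ℝ 2 (if e' = e then u else 0)
      split_ifs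
      · exact hu2
      · exact contDiff_const, fun e' t ht => glueFun_onEdge _ _ _ _ _ _ ht⟩
  rw [lapPair_eq_sum, Finset.sum_eq_single e] at key
  · simp only [if_pos] at key
    rw [hv, hv, hd2, hd1] at key
    have h3 : ∫ t in (0 : ℝ)..ℓ.len e, f (onEdge ℓ e t) * w t =
        (∫ t in (0 : ℝ)..ℓ.len e, w t * w t) + k * W (ℓ.len e) := by
      rw [hW, ← intervalIntegral.integral_const_mul, ← intervalIntegral.integral_add
        ((by fun_prop : Continuous _).intervalIntegrable _ _)
        ((by fun_prop : Continuous _).intervalIntegrable _ _)]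
      refine intervalIntegral.integral_congr fun t _ => ?_
      simp only [hw]; ring
    have h4 : W 0 = 0 := by simp [hW]
    rw [h3] at key
    simp only [h4] at key
    have h5 : ∫ t in (0 : ℝ)..ℓ.len e, w t * w t = 0 := by linarith
    by_contra hne
    have := intervalIntegral.integral_pos (f := fun t => w t * w t) hl (by fun_prop)
      (fun t _ => mul_self_nonneg _) ⟨t, ht, mul_self_pos.2 (sub_ne_zero.2 hne)⟩
    linarith
  · intro e' _ he'
    have h0 : deriv (0 : ℝ → ℝ) = 0 := by ext; simp
    simp [he', h0]
  · simp

/-- The measure `δ - Δ h`, where `δ` is the point mass at `v₀` and `h` is given by `quadFun`. -/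
noncomputable def quadMeasure (v₀ : V) (h : V → ℝ) (c : E → ℝ) : SignedMeasure (Space ℓ) :=
  (Measure.dirac (vert ℓ v₀)).toSignedMeasure -
    ∑ e, (((h (G.tgt e) - h (G.src e)) / ℓ.len e) •
      ((Measure.dirac (vert ℓ (G.tgt e))).toSignedMeasure
        - (Measure.dirac (vert ℓ (G.src e))).toSignedMeasure) +
      c e • ((2 / ℓ.len e) • (edgeMeasure ℓ e).toSignedMeasure
        - (Measure.dirac (vert ℓ (G.src e))).toSignedMeasure
        - (Measure.dirac (vert ℓ (G.tgt e))).toSignedMeasure))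

variable {ℓ} in
theorem integral_quadMeasure (v₀ : V) (h : V → ℝ) (c : E → ℝ) {f : Space ℓ → ℝ}
    (hf : Continuous f) :
    ∫ᵛ x, f x ∂<•(quadMeasure ℓ v₀ h c) = f (vert ℓ v₀) - lapPair ℓ f (quadEdge ℓ h c) := by
  have hi := fun μ => integrable_of_continuous (ℓ := ℓ) μ hf
  rw [lapPair_quadEdge, quadMeasure, VectorMeasure.integral_sub_vectorMeasure (hi _) (hi _),
    VectorMeasure.integral_finsetSum_vectorMeasure fun _ _ => hi _,
    integral_dirac_toSignedMeasure hf]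
  congr 1
  refine Finset.sum_congr rfl fun e _ => ?_
  rw [VectorMeasure.integral_add_vectorMeasure (hi _) (hi _),
    VectorMeasure.integral_smul_vectorMeasure, VectorMeasure.integral_smul_vectorMeasure,
    VectorMeasure.integral_sub_vectorMeasure (hi _) (hi _),
    VectorMeasure.integral_sub_vectorMeasure (hi _) (hi _),
    VectorMeasure.integral_sub_vectorMeasure (hi _) (hi _),
    VectorMeasure.integral_smul_vectorMeasure, integral_edgeMeasure hf,
    integral_dirac_toSignedMeasure hf, integral_dirac_toSignedMeasure hf]
  simp only [smul_eq_mul]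
  ring

end

end InvGraph

/-! ### The admissible Green function and the admissible constant -/

namespace InvGraph

section
variable {V E : Type*} {G : InvGraph V E} [Fintype V] [Fintype E] (ℓ : G.Lengths)

theorem integral_const_signedMeasure (μ : SignedMeasure (Space ℓ)) (k : ℝ) :
    ∫ᵛ _, k ∂<•μ = k * μ Set.univ := by
  have : IsFiniteMeasure μ.variation := by
    rw [← SignedMeasure.totalVariation_eq_variation]; infer_instance
  rw [VectorMeasure.integral_const]
  simp [mul_comm]

theorem quadMeasure_univ (v₀ : V) (h : V → ℝ) (c : E → ℝ) :
    quadMeasure ℓ v₀ h c Set.univ = 1 := by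
  have h1 := integral_quadMeasure (ℓ := ℓ) v₀ h c (f := fun _ => 1) continuous_const
  rw [lapPair_const 1 (isSmooth_quadFun ℓ h c), integral_const_signedMeasure] at h1
  linarith

/-- The admissible measure is `δ - Δ h` where `h` takes these values at the vertices. -/
noncomputable def admPot (N : V → V → ℝ) (D : V → ℝ) (v : V) : ℝ :=
  - ((∑ w, D w * N w v + N v v) / (∑ w, D w + 2))

/-- The admissible measure is `δ - Δ h` where `h` has these quadratic coefficients. -/
noncomputable def admCoeff (N : V → V → ℝ) (D : V → ℝ) (e : E) : ℝ :=
  - ((1 - (N (G.src e) (G.src e) + N (G.tgt e) (G.tgt e) - 2 * N (G.src e) (G.tgt e)) / ℓ.len e)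
    / (∑ w, D w + 2))

/-- The Dirichlet energy of the potential `h`. -/
noncomputable def admEnergy (N : V → V → ℝ) (D : V → ℝ) : ℝ :=
  ∑ e, ((admPot N D (G.tgt e) - admPot N D (G.src e)) ^ 2 / ℓ.len e
    + admCoeff ℓ N D e ^ 2 * ℓ.len e / 3)

/-- The potential `h`, as a function on the metrized graph. -/
noncomputable def admFun (N : V → V → ℝ) (D : V → ℝ) : Space ℓ → ℝ :=
  quadFun ℓ (admPot N D) (admCoeff ℓ N D)

/-- On an edge `h'` is the mean slope plus `c (1 - 2t/ℓ)`. These are orthogonal, and the square of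
the second integrates to `c² ℓ / 3`. -/
theorem lapPair_admFun (N : V → V → ℝ) (D : V → ℝ) :
    lapPair ℓ (admFun ℓ N D) (quadEdge ℓ (admPot N D) (admCoeff ℓ N D)) = admEnergy ℓ N D := by
  rw [lapPair_quadEdge, admEnergy]
  refine Finset.sum_congr rfl fun e _ => ?_
  have hl := ℓ.len_pos e
  have : ∫ t in (0 : ℝ)..ℓ.len e, admFun ℓ N D (onEdge ℓ e t) =
      ℓ.len e * (admPot N D (G.src e) + admPot N D (G.tgt e)) / 2 +
        admCoeff ℓ N D e * (ℓ.len e ^ 2 / 6) := by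
    rw [← integral_affine _ _ _ hl, ← integral_bump hl, ← intervalIntegral.integral_const_mul,
      ← intervalIntegral.integral_add ((by fun_prop : Continuous _).intervalIntegrable _ _)
        ((by fun_prop : Continuous _).intervalIntegrable _ _)]
    refine intervalIntegral.integral_congr fun t ht => ?_
    rw [Set.uIcc_of_le hl.le] at ht
    exact quadFun_onEdge ℓ _ _ e ht
  rw [this]
  simp only [admFun, quadFun_vert]
  field_simp
  ring

/-- The admissible Green function. -/
noncomputable def admGreen (N : V → V → ℝ) (D : V → ℝ) (x y : Space ℓ) : ℝ :=
  kern ℓ N x y + (admFun ℓ N D x + admFun ℓ N D y + admEnergy ℓ N D)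

/-- The value of `g(D, y) + g(y, y)` for the admissible Green function. -/
noncomputable def admConst (N : V → V → ℝ) (D : V → ℝ) : ℝ :=
  ∑ v, D v * admPot N D v + (∑ v, D v + 1) * admEnergy ℓ N D

variable {ℓ}

theorem continuous_admFun (N : V → V → ℝ) (D : V → ℝ) : Continuous (admFun ℓ N D) :=
  (isSmooth_quadFun ℓ _ _).continuous

theorem continuous_kern_right (N : V → V → ℝ) (x : Space ℓ) : Continuous (kern ℓ N x) :=
  Continuous.comp (g := fun p : Space ℓ × Space ℓ => kern ℓ N p.1 p.2) (f := fun y => (x, y))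
    (continuous_kern ℓ N) (Continuous.prodMk_right x)

/-- The Laplacian of `admGreen` in one variable is `δ_x - δ_{v₀} + Δh = δ_x - μ`. Integrating
against `μ = δ_{v₀} - Δh`, with `h(v₀) = 0` and the kernel vanishing at `v₀`, leaves the additive
constant minus `∫ h dΔh`; so this constant has to be the energy. The vertex values and quadratic
coefficients of `h` are chosen so that `(deg D + 2) h(y)` cancels the kernel part of `g(D,y) +
g(y,y)`. -/
theorem isAdmissible_admGreen {v₀ : V} {N : V → V → ℝ} (hN : IsGreenKernel ℓ v₀ N) (D : V → ℝ)
    (hD : ∑ v, D v + 2 ≠ 0) :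
    IsAdmissible ℓ D (quadMeasure ℓ v₀ (admPot N D) (admCoeff ℓ N D)) (admGreen ℓ N D)
      (admConst ℓ N D) where
  total := quadMeasure_univ ℓ _ _ _
  symm x y := by rw [admGreen, admGreen, kern_symm ℓ hN.symm]; ring
  cont := by
    have h1 : Continuous fun p : Space ℓ × Space ℓ => admFun ℓ N D p.1 :=
      (continuous_admFun N D).comp continuous_fst
    have h2 : Continuous fun p : Space ℓ × Space ℓ => admFun ℓ N D p.2 :=
      (continuous_admFun N D).comp continuous_snd
    exact (continuous_kern ℓ N).add ((h1.add h2).add continuous_const)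
  laplacian x := by
    rw [hasLaplacian_iff]
    intro φ u hu
    have hφ := hu.continuous
    have hi := fun μ => integrable_of_continuous (ℓ := ℓ) μ hφ
    rw [VectorMeasure.integral_sub_vectorMeasure (hi _) (hi _),
      integral_dirac_toSignedMeasure hφ, integral_quadMeasure _ _ _ hφ]
    have e1 : lapPair ℓ (admGreen ℓ N D x) u = lapPair ℓ (kern ℓ N x) u +
        lapPair ℓ (fun y => admFun ℓ N D x + admFun ℓ N D y + admEnergy ℓ N D) u :=
      lapPair_add (continuous_kern_right N x)
        ((continuous_const.add (continuous_admFun N D)).add continuous_const) hu.1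
    have e2 : lapPair ℓ (fun y => admFun ℓ N D x + admFun ℓ N D y + admEnergy ℓ N D) u =
        lapPair ℓ (admFun ℓ N D) u := by
      have h1 := lapPair_add (ℓ := ℓ) (f := fun _ => admFun ℓ N D x + admEnergy ℓ N D)
        continuous_const (continuous_admFun N D) hu.1
      rw [lapPair_const _ hu, zero_add] at h1
      rw [← h1]
      congr 1
      ext y; ring
    rw [e1, e2, lapPair_kern hN x hu, lapPair_quadEdge,
      lapPair_quadratic (f := admFun ℓ N D) (a := admPot N D) (c := admCoeff ℓ N D) (fun _ => rfl)
        (fun e t ht => quadFun_onEdge ℓ _ _ e ht) hu]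
    have : ∀ e, (φ (vert ℓ (G.tgt e)) - φ (vert ℓ (G.src e))) *
        (admPot N D (G.tgt e) - admPot N D (G.src e)) / ℓ.len e =
        (admPot N D (G.tgt e) - admPot N D (G.src e)) *
        (φ (vert ℓ (G.tgt e)) - φ (vert ℓ (G.src e))) / ℓ.len e := fun e => by ring
    simp only [this]
    ring
  integral x := by
    have hk := continuous_kern_right (ℓ := ℓ) N x
    have hf := continuous_admFun (ℓ := ℓ) N D
    have h0 : admFun ℓ N D (vert ℓ v₀) = 0 := by
      have h1 : ∀ w, N w v₀ = 0 := fun w => by rw [hN.symm, hN.base]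
      simp [admFun, quadFun_vert, admPot, h1]
    have hc : Continuous (admGreen ℓ N D x) :=
      hk.add ((continuous_const.add hf).add continuous_const)
    change ∫ᵛ y, admGreen ℓ N D x y ∂<•_ = 0
    rw [integral_quadMeasure _ _ _ hc]
    have hq := isSmooth_quadFun ℓ (admPot N D) (admCoeff ℓ N D)
    have e1 : lapPair ℓ (admGreen ℓ N D x) (quadEdge ℓ (admPot N D) (admCoeff ℓ N D)) =
        lapPair ℓ (kern ℓ N x) (quadEdge ℓ (admPot N D) (admCoeff ℓ N D)) +
        lapPair ℓ (fun y => admFun ℓ N D x + admFun ℓ N D y + admEnergy ℓ N D)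
          (quadEdge ℓ (admPot N D) (admCoeff ℓ N D)) :=
      lapPair_add hk ((continuous_const.add hf).add continuous_const) hq.1
    have e2 : lapPair ℓ (fun y => admFun ℓ N D x + admFun ℓ N D y + admEnergy ℓ N D)
          (quadEdge ℓ (admPot N D) (admCoeff ℓ N D)) = admEnergy ℓ N D := by
      have h1 := lapPair_add (ℓ := ℓ) (f := fun _ => admFun ℓ N D x + admEnergy ℓ N D)
        continuous_const hf hq.1
      rw [lapPair_const _ hq, zero_add, lapPair_admFun] at h1
      refine Eq.trans ?_ h1
      congr 1
      ext y; ring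
    rw [e1, e2, lapPair_kern hN x hq]
    change kern ℓ N x (vert ℓ v₀) + (admFun ℓ N D x + admFun ℓ N D (vert ℓ v₀) + _) -
      (admFun ℓ N D x - admFun ℓ N D (vert ℓ v₀) + _) = 0
    have h2 : kern ℓ N x (vert ℓ v₀) = 0 := by
      rw [kern_vert_right]
      exact Finset.sum_eq_zero fun v _ => by rw [hN.symm, hN.base, zero_mul]
    rw [h0, h2]; ring
  const y := by
    have key : ∑ v, D v * kern ℓ N (vert ℓ v) y + kern ℓ N y y
        + (∑ v, D v + 2) * admFun ℓ N D y = 0 := by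
      rcases space_cases y with ⟨w, rfl⟩ | ⟨e, t, ht, rfl⟩
      · simp only [kern_vert_vert, admFun, quadFun_vert, admPot]
        field_simp
        ring
      · have h1 : ∑ v, D v * kern ℓ N (vert ℓ v) (onEdge ℓ e t) =
            (1 - t / ℓ.len e) * (∑ v, D v * N v (G.src e)) +
              t / ℓ.len e * (∑ v, D v * N v (G.tgt e)) := by
          rw [Finset.mul_sum, Finset.mul_sum, ← Finset.sum_add_distrib]
          refine Finset.sum_congr rfl fun v _ => ?_
          rw [kern_vert_left_onEdge ℓ N v e ht]
          ring
        have hl := (ℓ.len_pos e).ne'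
        rw [h1, kern_onEdge_self ℓ N hN.symm e ht, admFun, quadFun_onEdge ℓ _ _ e ht]
        simp only [quadEdge, admPot, admCoeff]
        field_simp
        ring
    simp only [admGreen, mul_add, Finset.sum_add_distrib, ← Finset.sum_mul]
    have h2 : ∑ v, D v * admFun ℓ N D (vert ℓ v) = ∑ v, D v * admPot N D v := rfl
    rw [h2, admConst]
    linear_combination key

/-- The difference `δ` of two admissible Green functions has a Laplacian `μ₀ - μ` independent of
`x`, so `δ(x,y) = δ(p,y) + δ(x,p) - δ(p,p)`. In the condition on `g(D,y) + g(y,y)` the divisor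
contributes `δ(p,y)` with factor `deg D` and the diagonal with factor 2; as `deg D + 2 ≠ 0`, `δ` is
a constant. Then both measures integrate `h` to the same value, and the normalization makes the
constant 0. -/
theorem IsAdmissible.eq_admGreen {v₀ : V} {N : V → V → ℝ} (hN : IsGreenKernel ℓ v₀ N) {D : V → ℝ}
    (hD : ∑ v, D v + 2 ≠ 0) {μ : SignedMeasure (Space ℓ)} {g : Space ℓ → Space ℓ → ℝ} {c : ℝ}
    (h : IsAdmissible ℓ D μ g c) : g = admGreen ℓ N D := by
  have h0 := isAdmissible_admGreen hN D hD
  set g₀ := admGreen ℓ N D with hg₀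
  set μ₀ := quadMeasure ℓ v₀ (admPot N D) (admCoeff ℓ N D) with hμ₀
  set p := vert ℓ v₀ with hp
  have hcg : ∀ x, Continuous (g x) := fun x =>
    Continuous.comp (g := fun p : Space ℓ × Space ℓ => g p.1 p.2) (f := fun y => (x, y))
      h.cont (Continuous.prodMk_right x)
  have hcg₀ : ∀ x, Continuous (g₀ x) := fun x =>
    Continuous.comp (g := fun p : Space ℓ × Space ℓ => g₀ p.1 p.2) (f := fun y => (x, y))
      h0.cont (Continuous.prodMk_right x)
  have hd : ∀ x, Continuous fun y => g x y - g₀ x y := fun x => (hcg x).sub (hcg₀ x)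
  have hlap : ∀ x φ u, IsSmooth ℓ φ u → lapPair ℓ (fun y => g x y - g₀ x y) u =
      ∫ᵛ y, φ y ∂<•μ₀ - ∫ᵛ y, φ y ∂<•μ := by
    intro x φ u hu
    have hi := fun μ => integrable_of_continuous (ℓ := ℓ) μ hu.continuous
    rw [lapPair_sub (hcg x) (hcg₀ x) hu.1, ← (hasLaplacian_iff ℓ).1 (h.laplacian x) φ u hu,
      ← (hasLaplacian_iff ℓ).1 (h0.laplacian x) φ u hu,
      VectorMeasure.integral_sub_vectorMeasure (hi _) (hi _),
      VectorMeasure.integral_sub_vectorMeasure (hi _) (hi _)]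
    ring
  have hconst : ∀ x y, g x y - g₀ x y = (g p y - g₀ p y) + (g x p - g₀ x p) - (g p p - g₀ p p) := by
    intro x y
    have := eq_of_forall_lapPair_eq_zero hN
      (f := fun y => (g x y - g₀ x y) - (g p y - g₀ p y))
      ((hd x).sub (hd p)) (fun φ u hu => by
        rw [lapPair_sub (hd x) (hd p) hu.1, hlap x φ u hu, hlap p φ u hu, sub_self]) y
    linarith
  have hdiag : ∀ y, g p y - g₀ p y = g p p - g₀ p p := by
    have hs : ∀ x, g x p - g₀ x p = g p x - g₀ p x := fun x => by rw [h.symm, h0.symm]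
    have key : ∀ y, (∑ v, D v + 2) * (g p y - g₀ p y) = c - admConst ℓ N D -
        ∑ v, D v * (g (vert ℓ v) p - g₀ (vert ℓ v) p) + (∑ v, D v + 1) * (g p p - g₀ p p) := by
      intro y
      have h1 := h.const y
      have h2 := h0.const y
      have h3 : ∑ v, D v * g (vert ℓ v) y = ∑ v, D v * g₀ (vert ℓ v) y +
          ∑ v, D v * ((g p y - g₀ p y) + (g (vert ℓ v) p - g₀ (vert ℓ v) p)
            - (g p p - g₀ p p)) := by
        rw [← Finset.sum_add_distrib]
        refine Finset.sum_congr rfl fun v _ => ?_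
        rw [← hconst]; ring
      have h4 := hconst y y
      rw [hs] at h4
      simp only [mul_add, mul_sub, Finset.sum_add_distrib, Finset.sum_sub_distrib,
        ← Finset.sum_mul] at h3 ⊢
      linarith
    intro y
    exact mul_left_cancel₀ hD ((key y).trans (key p).symm)
  have hall : ∀ x y, g x y = g₀ x y + (g p p - g₀ p p) := by
    intro x y
    have h1 := hconst x y
    rw [hdiag y, h.symm x p, h0.symm x p, hdiag x] at h1
    linarith
  set κ := g p p - g₀ p p
  have hq := isSmooth_quadFun ℓ (admPot N D) (admCoeff ℓ N D)
  have hμ : ∫ᵛ y, admFun ℓ N D y ∂<•μ = ∫ᵛ y, admFun ℓ N D y ∂<•μ₀ := by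
    have h1 := hlap p _ _ hq
    have h2 : (fun y => g p y - g₀ p y) = fun _ => κ := funext hdiag
    rw [h2, lapPair_const _ hq] at h1
    exact (sub_eq_zero.1 h1.symm).symm
  have hgp : ∀ y, g₀ p y = admFun ℓ N D y + (admFun ℓ N D p + admEnergy ℓ N D) := by
    intro y
    have : kern ℓ N p y = 0 := by
      rw [kern_symm ℓ hN.symm, kern_vert_right]
      exact Finset.sum_eq_zero fun v _ => by rw [hN.symm, hN.base, zero_mul]
    rw [hg₀, admGreen, this]; ring
  have hκ : κ = 0 := by
    have hi := fun μ => integrable_of_continuous (ℓ := ℓ) μ (continuous_admFun N D)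
    have hi' := fun μ (k : ℝ) => integrable_of_continuous (ℓ := ℓ) μ
      (continuous_const (y := k))
    have h1 := h.integral p
    have h2 := h0.integral p
    simp only [hall p, hgp, add_assoc] at h1
    simp only [hgp] at h2
    rw [VectorMeasure.integral_fun_add (hi _) (hi' _ _), integral_const_signedMeasure,
      h.total] at h1
    rw [VectorMeasure.integral_fun_add (hi _) (hi' _ _), integral_const_signedMeasure,
      h0.total] at h2
    linarith
  ext x y
  rw [hall, hκ, add_zero]

/-- The admissible constant in terms of a Green kernel on the vertices. -/
theorem isAdmissibleConstant_iff {v₀ : V} {N : V → V → ℝ} (hN : IsGreenKernel ℓ v₀ N) {D : V → ℝ}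
    (hD : ∑ v, D v + 2 ≠ 0) (ε : ℝ) :
    IsAdmissibleConstant ℓ D ε ↔ ε = (∑ v, D v) * (∑ v, D v + 2) * admEnergy ℓ N D
      - ∑ v, ∑ w, D v * D w * N v w := by
  have h0 := isAdmissible_admGreen hN D hD
  have hval : 2 * (∑ v, D v) * admConst ℓ N D
      - ∑ v, ∑ w, D v * D w * admGreen ℓ N D (vert ℓ v) (vert ℓ w) =
      (∑ v, D v) * (∑ v, D v + 2) * admEnergy ℓ N D - ∑ v, ∑ w, D v * D w * N v w := by
    have h1 : ∑ v, ∑ w, D v * D w * admGreen ℓ N D (vert ℓ v) (vert ℓ w) =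
        ∑ v, ∑ w, D v * D w * N v w + 2 * (∑ v, D v) * (∑ v, D v * admPot N D v) +
          (∑ v, D v) * (∑ v, D v) * admEnergy ℓ N D := by
      have h2 : ∀ v w, D v * D w * admGreen ℓ N D (vert ℓ v) (vert ℓ w) =
          D v * D w * N v w + (D v * admPot N D v) * D w + D v * (D w * admPot N D w)
            + D v * D w * admEnergy ℓ N D := by
        intro v w
        simp only [admGreen, kern_vert_vert, admFun, quadFun_vert]
        ring
      simp only [h2, Finset.sum_add_distrib, ← Finset.sum_mul, ← Finset.mul_sum]
      ring
    rw [h1, admConst]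
    ring
  constructor
  · rintro ⟨μ, g, c, h, rfl⟩
    have hg := h.eq_admGreen hN hD
    subst hg
    have hc : c = admConst ℓ N D := (h.const (vert ℓ v₀)).symm.trans (h0.const (vert ℓ v₀))
    rw [hc, hval]
  · rintro rfl
    exact ⟨_, _, _, h0, hval.symm⟩

end

end InvGraph

/-! ### Trees: cuts, coboundaries and Euler characteristics -/

namespace MultiGraph

section
variable {W F : Type*} {T : MultiGraph W F}

theorem joined_edge {S : Set F} {e : F} (he : e ∈ S) : T.joined S (T.src e) (T.tgt e) :=
  Relation.EqvGen.rel _ _ ⟨e, he, rfl, rfl⟩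

theorem joined_refl (S : Set F) (u : W) : T.joined S u u := (T.joined S).refl u

theorem joined_symm {S : Set F} {u v : W} (h : T.joined S u v) : T.joined S v u :=
  (T.joined S).symm h

theorem joined_trans {S : Set F} {u v w : W} (h : T.joined S u v) (h' : T.joined S v w) :
    T.joined S u w := (T.joined S).trans h h'

theorem joined_le {S : Set F} {r : Setoid W} (hr : ∀ e ∈ S, r (T.src e) (T.tgt e)) {u v : W}
    (h : T.joined S u v) : r u v := by
  induction h with
  | rel x y h =>
    obtain ⟨e, he, rfl, rfl⟩ := h
    exact hr e he
  | refl x => exact r.refl x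
  | symm x y _ ih => exact r.symm ih
  | trans x y z _ _ ih₁ ih₂ => exact r.trans ih₁ ih₂

theorem joined_mono {S S' : Set F} (hS : S ⊆ S') {u v : W} (h : T.joined S u v) :
    T.joined S' u v :=
  joined_le (fun _ he => joined_edge (hS he)) h

theorem eq_of_joined {α : Type*} {S : Set F} {f : W → α} (hf : ∀ e ∈ S, f (T.src e) = f (T.tgt e))
    {u v : W} (h : T.joined S u v) : f u = f v :=
  joined_le (r := Setoid.ker f) hf h

theorem Connected.joined_compl (hT : T.Connected) (e : F) (x : W) :
    T.joined {e}ᶜ (T.src e) x ∨ T.joined {e}ᶜ (T.tgt e) x := by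
  have h : (T.joined {e}ᶜ (T.src e) x ∨ T.joined {e}ᶜ (T.tgt e) x) =
      (T.joined {e}ᶜ (T.src e) (T.src e) ∨ T.joined {e}ᶜ (T.tgt e) (T.src e)) := by
    refine eq_of_joined (f := fun x => T.joined {e}ᶜ (T.src e) x ∨ T.joined {e}ᶜ (T.tgt e) x)
      (fun e' _ => ?_) (hT.2 x (T.src e))
    by_cases h : e' = e
    · subst h
      simp
    · have := joined_edge (T := T) (S := {e}ᶜ) (e := e') h
      exact propext (or_congr ⟨fun h => joined_trans h this, fun h => joined_trans h (joined_symm this)⟩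
        ⟨fun h => joined_trans h this, fun h => joined_trans h (joined_symm this)⟩)
  rw [h]
  exact Or.inl (joined_refl _ _)

open Classical in
/-- The indicator function of the part containing the target of `e` after removing `e`. -/
noncomputable def sideInd (T : MultiGraph W F) (e : F) (x : W) : ℤ :=
  if T.joined {e}ᶜ (T.tgt e) x then 1 else 0

theorem sideInd_tgt (T : MultiGraph W F) (e : F) : T.sideInd e (T.tgt e) = 1 :=
  if_pos (joined_refl _ _)

theorem IsAcyclic.sideInd_src (hT : T.IsAcyclic) (e : F) : T.sideInd e (T.src e) = 0 :=
  if_neg fun h => hT e (joined_symm h)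

theorem sideInd_eq_of_ne {e e' : F} (h : e' ≠ e) :
    T.sideInd e (T.src e') = T.sideInd e (T.tgt e') := by
  have := joined_edge (T := T) (S := {e}ᶜ) (e := e') h
  unfold sideInd
  congr 1
  exact propext ⟨fun h => joined_trans h this, fun h => joined_trans h (joined_symm this)⟩

theorem sideInd_eq_zero_or_one (T : MultiGraph W F) (e : F) (x : W) :
    T.sideInd e x = 0 ∨ T.sideInd e x = 1 := by
  unfold sideInd; split_ifs <;> simp

theorem sideInd_eq_one_iff {e : F} {x : W} : T.sideInd e x = 1 ↔ T.joined {e}ᶜ (T.tgt e) x := by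
  unfold sideInd; split_ifs <;> simp_all

theorem sideInd_eq_zero_iff (hT : T.Connected) (hA : T.IsAcyclic) {e : F} {x : W} :
    T.sideInd e x = 0 ↔ T.joined {e}ᶜ (T.src e) x := by
  constructor
  · intro h
    rcases hT.joined_compl e x with h' | h'
    · exact h'
    · rw [sideInd_eq_one_iff.2 h'] at h; simp at h
  · intro h
    rw [← hA.sideInd_src e]
    exact eq_of_joined (f := T.sideInd e) (fun e' he' => sideInd_eq_of_ne he') (joined_symm h)

theorem IsAcyclic.src_ne_tgt (hT : T.IsAcyclic) (e : F) : T.src e ≠ T.tgt e := fun h =>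
  hT e (h ▸ joined_refl _ _)

open Classical in
-- Removing `e` separates its ends and keeps those of every other edge together. So the functions
-- `sideInd e` are dual to the edges under the coboundary map.
theorem IsAcyclic.sideInd_sub (hT : T.IsAcyclic) (e e' : F) :
    T.sideInd e (T.tgt e') - T.sideInd e (T.src e') = if e' = e then 1 else 0 := by
  split_ifs with h
  · subst h
    rw [sideInd_tgt, hT.sideInd_src, sub_zero]
  · rw [sideInd_eq_of_ne h, sub_self]

/-- On an acyclic graph every function on the edges is a coboundary. -/
theorem IsAcyclic.exists_coboundary {R : Type*} [CommRing R] [Fintype F] (hT : T.IsAcyclic)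
    (δ : F → R) : ∃ f : W → R, ∀ e, f (T.tgt e) - f (T.src e) = δ e := by
  classical
  refine ⟨fun x => ∑ e, δ e * (T.sideInd e x : R), fun e' => ?_⟩
  rw [← Finset.sum_sub_distrib, Finset.sum_eq_single e']
  · rw [← mul_sub, ← Int.cast_sub, hT.sideInd_sub, if_pos rfl]; simp
  · intro e _ he
    rw [← mul_sub, ← Int.cast_sub, hT.sideInd_sub, if_neg he.symm]; simp
  · simp

/-- Summation of the increments of `ψ` along the path from `y` to `x`: the difference of side
indicators is the signed indicator of the edges on that path. -/
theorem eq_add_sum_coboundary [Fintype F] (hT : T.Connected) (hA : T.IsAcyclic) (ψ : W → ℝ)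
    (x y : W) : ψ x - ψ y =
      ∑ e, (ψ (T.tgt e) - ψ (T.src e)) * ((T.sideInd e x : ℝ) - T.sideInd e y) := by
  classical
  have h := eq_of_joined
    (f := fun x => ψ x - ∑ e, (ψ (T.tgt e) - ψ (T.src e)) * (T.sideInd e x : ℝ))
    (fun e' _ => by
      have h1 : ∑ e, (ψ (T.tgt e) - ψ (T.src e)) * (T.sideInd e (T.tgt e') : ℝ) -
          ∑ e, (ψ (T.tgt e) - ψ (T.src e)) * (T.sideInd e (T.src e') : ℝ) =
          ψ (T.tgt e') - ψ (T.src e') := by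
        rw [← Finset.sum_sub_distrib, Finset.sum_eq_single e']
        · rw [← mul_sub, ← Int.cast_sub, hA.sideInd_sub, if_pos rfl]; simp
        · intro e _ he
          rw [← mul_sub, ← Int.cast_sub, hA.sideInd_sub, if_neg he.symm]; simp
        · simp
      linarith) (hT.2 x y)
  simp only [mul_sub, Finset.sum_sub_distrib]
  linarith

open Classical in
/-- The edges with both ends in `C`. -/
noncomputable def inner [Fintype F] (T : MultiGraph W F) (C : Finset W) : Finset F :=
  {e | T.src e ∈ C ∧ T.tgt e ∈ C}

open Classical in
/-- The edges with exactly one end in `C`. -/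
noncomputable def bdry [Fintype F] (T : MultiGraph W F) (C : Finset W) : Finset F :=
  {e | T.src e ∈ C ∧ T.tgt e ∉ C ∨ T.src e ∉ C ∧ T.tgt e ∈ C}

/-- The coboundary map on the functions on a set of vertices. -/
noncomputable def cobMap [Fintype F] (T : MultiGraph W F) (C : Finset W) :
    (C → ℝ) →ₗ[ℝ] (T.inner C → ℝ) where
  toFun f e := f ⟨T.tgt e, by have := e.2; simp only [inner, Finset.mem_filter] at this; exact this.2.2⟩
    - f ⟨T.src e, by have := e.2; simp only [inner, Finset.mem_filter] at this; exact this.2.1⟩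
  map_add' f g := by ext e; simp; ring
  map_smul' c f := by ext e; simp; ring

/-- Rank-nullity for the coboundary map on `C`, which is surjective because the graph has no
circuits. The kernel consists of the locally constant functions. -/
theorem IsAcyclic.card_inner_add_finrank [Fintype F] (hT : T.IsAcyclic) (C : Finset W) :
    (T.inner C).card + Module.finrank ℝ (LinearMap.ker (T.cobMap C)) = C.card := by
  classical
  have h1 := LinearMap.finrank_range_add_finrank_ker (T.cobMap C)
  have h2 : LinearMap.range (T.cobMap C) = ⊤ := by
    rw [LinearMap.range_eq_top]
    intro δ
    obtain ⟨f, hf⟩ := hT.exists_coboundary (R := ℝ)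
      (fun e => if h : e ∈ T.inner C then δ ⟨e, h⟩ else 0)
    refine ⟨fun x => f x, ?_⟩
    ext e
    have := hf e
    rw [dif_pos e.2] at this
    exact this
  rw [h2, finrank_top, Module.finrank_fintype_fun_eq_card, Module.finrank_fintype_fun_eq_card,
    Fintype.card_coe, Fintype.card_coe] at h1
  exact h1

theorem IsAcyclic.card_inner_add_one_le [Fintype F] (hT : T.IsAcyclic) {C : Finset W}
    (hC : C.Nonempty) : (T.inner C).card + 1 ≤ C.card := by
  rw [← hT.card_inner_add_finrank C]
  have : Nontrivial (LinearMap.ker (T.cobMap C)) := by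
    obtain ⟨x, hx⟩ := hC
    refine ⟨⟨0, ⟨fun _ => 1, ?_⟩, fun h => ?_⟩⟩
    · ext e; simp [cobMap]
    · have := congrFun (congrArg Subtype.val h) ⟨x, hx⟩
      simp at this
  have := Module.finrank_pos (R := ℝ) (M := LinearMap.ker (T.cobMap C))
  lia

theorem IsAcyclic.card_inner_add_one [Fintype F] (hT : T.IsAcyclic) {C : Finset W}
    (hC : C.Nonempty) (hj : ∀ x ∈ C, ∀ y ∈ C, T.joined {e | T.src e ∈ C ∧ T.tgt e ∈ C} x y) :
    (T.inner C).card + 1 = C.card := by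
  classical
  refine le_antisymm (hT.card_inner_add_one_le hC) ?_
  rw [← hT.card_inner_add_finrank C]
  obtain ⟨x, hx⟩ := hC
  have hker : (fun _ => 1 : C → ℝ) ∈ LinearMap.ker (T.cobMap C) := by ext e; simp [cobMap]
  have : Module.finrank ℝ (LinearMap.ker (T.cobMap C)) ≤ 1 := by
    refine finrank_le_one ⟨fun _ => 1, hker⟩ fun ⟨w, hw⟩ => ⟨w ⟨x, hx⟩, ?_⟩
    ext y
    simp only [SetLike.mk_smul_mk, Pi.smul_apply, smul_eq_mul, mul_one]
    have h1 := eq_of_joined (f := fun z => if h : z ∈ C then w ⟨z, h⟩ else 0) (fun e he => ?_)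
      (hj x hx y y.2)
    · simpa [hx] using h1
    · rw [dif_pos he.1, dif_pos he.2]
      have := congrFun hw ⟨e, by simp only [inner, Finset.mem_filter]; exact ⟨Finset.mem_univ _, he⟩⟩
      exact (sub_eq_zero.1 this).symm
  lia

theorem degree_eq_sum [Fintype F] [DecidableEq W] (hT : ∀ e, T.src e ≠ T.tgt e) (x : W) :
    (T.degree x : ℤ) = ∑ e, ((if T.src e = x then 1 else 0) + (if T.tgt e = x then 1 else 0)) := by
  classical
  have h1 : {e : F | x ∈ T.ends e} = ((Finset.univ.filter fun e => T.src e = x ∨ T.tgt e = x : Finset F) : Set F) := by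
    ext e
    simp [ends, eq_comm]
  rw [degree, h1, Set.ncard_coe_finset, Finset.card_filter, Nat.cast_sum]
  refine Finset.sum_congr rfl fun e _ => ?_
  have := hT e
  by_cases h1 : T.src e = x <;> by_cases h2 : T.tgt e = x <;> simp_all

theorem sum_degree [Fintype F] (hT : ∀ e, T.src e ≠ T.tgt e) (C : Finset W) :
    ∑ x ∈ C, (T.degree x : ℤ) = 2 * (T.inner C).card + (T.bdry C).card := by
  classical
  simp only [degree_eq_sum hT]
  rw [Finset.sum_comm, inner, bdry, Finset.card_filter, Finset.card_filter, Nat.cast_sum,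
    Nat.cast_sum, Finset.mul_sum, ← Finset.sum_add_distrib]
  refine Finset.sum_congr rfl fun e _ => ?_
  rw [Finset.sum_add_distrib, Finset.sum_ite_eq, Finset.sum_ite_eq]
  by_cases h1 : T.src e ∈ C <;> by_cases h2 : T.tgt e ∈ C <;> simp [h1, h2]

/-- The valencies in `C` add up to at least `3 |C|`, and at most `2 (|C| - 1)` of this sum comes
from edges inside `C`. -/
theorem IsAcyclic.card_add_two_le_card_bdry [Fintype F] (hT : T.IsAcyclic) {C : Finset W}
    (hC : C.Nonempty) (h3 : ∀ x ∈ C, 3 ≤ T.degree x) : C.card + 2 ≤ (T.bdry C).card := by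
  have h1 := sum_degree hT.src_ne_tgt C
  have h2 := hT.card_inner_add_one_le hC
  have h4 : ∑ x ∈ C, (3 : ℤ) ≤ ∑ x ∈ C, (T.degree x : ℤ) :=
    Finset.sum_le_sum fun x hx => by exact_mod_cast h3 x hx
  simp only [Finset.sum_const, nsmul_eq_mul] at h4
  lia

/-- A connected `C` has exactly `|C| - 1` inner edges, each counted twice in the sum of valencies.
This is the origin of the coefficients `ν - 2` of `M_G`. -/
theorem IsAcyclic.sum_degree_sub_two [Fintype F] (hT : T.IsAcyclic) {C : Finset W}
    (hC : C.Nonempty) (hj : ∀ x ∈ C, ∀ y ∈ C, T.joined {e | T.src e ∈ C ∧ T.tgt e ∈ C} x y) :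
    ∑ x ∈ C, ((T.degree x : ℤ) - 2) = (T.bdry C).card - 2 := by
  have h1 := sum_degree hT.src_ne_tgt C
  have h2 := hT.card_inner_add_one hC hj
  rw [Finset.sum_sub_distrib, h1]
  simp only [Finset.sum_const, nsmul_eq_mul]
  lia

/-- In an acyclic graph two vertices that are joined by disjoint sets of edges coincide. -/
theorem IsAcyclic.eq_of_joined_of_disjoint [Fintype F] (hT : T.IsAcyclic) {A B : Set F}
    (hAB : Disjoint A B) {u v : W} (hA : T.joined A u v) (hB : T.joined B u v) : u = v := by
  classical
  -- The function `g` has the increments of the indicator of `u` along `A` and is constant along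
  -- `B`. Both conditions together are incompatible with `u ≠ v`.
  obtain ⟨g, hg⟩ := hT.exists_coboundary (R := ℝ) (fun e => if e ∈ A then
    (if T.tgt e = u then 1 else 0) - (if T.src e = u then 1 else 0) else 0)
  have h1 : g u - (if u = u then 1 else 0) = g v - (if v = u then 1 else 0) :=
    eq_of_joined (f := fun x => g x - if x = u then 1 else 0) (fun e he => by
      have := hg e
      rw [if_pos he] at this
      linarith) hA
  have h2 : g u = g v := eq_of_joined (fun e he => by
    have := hg e
    rw [if_neg (Set.disjoint_right.1 hAB he)] at this
    linarith) hB
  by_contra hne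
  rw [if_pos rfl, if_neg (Ne.symm hne)] at h1
  linarith

end

end MultiGraph

/-! ### The Cauchy-Binet formula -/

section CauchyBinet
variable {X F : Type*} [Fintype X] [DecidableEq X] [Fintype F] [DecidableEq F]

/-- The Gram matrix of the rows of `B` for the scalar product with weights `c`. -/
def weightedGram {R : Type*} [CommRing R] (B : X → F → R) (c : F → R) : Matrix X X R :=
  Matrix.of fun i j => ∑ e, c e * B i e * B j e

theorem det_weightedGram_eq_sum (B : X → F → ℝ) (c : F → ℝ) :
    (weightedGram B c).det = ∑ p : X → F, (∏ i, c (p i)) *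
      ((∏ i, B i (p i)) * (Matrix.of fun i j => B j (p i)).det) := by
  have h1 : weightedGram B c = Matrix.of fun i => ∑ e, (c e * B i e) • (fun j => B j e) := by
    ext i j
    simp [weightedGram, Finset.sum_apply]
  have h2 := (Matrix.detRowAlternating (R := ℝ) (n := X)).toMultilinearMap.map_sum
    (fun i e => (c e * B i e) • (fun j => B j e))
  rw [h1]
  refine h2.trans (Finset.sum_congr rfl fun p _ => ?_)
  rw [MultilinearMap.map_smul_univ, Finset.prod_mul_distrib, smul_eq_mul, mul_assoc]
  rfl

/-- A form of the Cauchy-Binet formula. -/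
theorem det_weightedGram (B : X → F → ℝ) (c : F → ℝ) :
    (weightedGram B c).det = ∑ S ∈ (Finset.univ : Finset F).powersetCard (Fintype.card X),
      (∏ e ∈ S, c e) * (weightedGram B fun e => if e ∈ S then 1 else 0).det := by
  classical
  -- After multilinear expansion in the rows, choices that are not injective give repeated rows, and
  -- the others are grouped by their image `S`. The inner sum does not involve `c`, so evaluating at
  -- the indicator weights of `S` identifies it with a determinant.
  have key : ∀ c : F → ℝ, (weightedGram B c).det =
      ∑ S ∈ (Finset.univ : Finset F).powersetCard (Fintype.card X), (∏ e ∈ S, c e) *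
        ∑ p : X → F with p.Injective ∧ Finset.univ.image p = S,
          (∏ i, B i (p i)) * (Matrix.of fun i j => B j (p i)).det := by
    intro c
    rw [det_weightedGram_eq_sum,
      ← Finset.sum_filter_add_sum_filter_not _ (fun p : X → F => p.Injective)]
    have h0 : ∑ p : X → F with ¬ p.Injective, (∏ i, c (p i)) *
        ((∏ i, B i (p i)) * (Matrix.of fun i j => B j (p i)).det) = 0 := by
      refine Finset.sum_eq_zero fun p hp => ?_
      simp only [Finset.mem_filter, Function.Injective, not_forall] at hp
      obtain ⟨-, i, j, hij, hne⟩ := hp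
      rw [Matrix.det_zero_of_row_eq hne (by ext k; simp [hij]), mul_zero, mul_zero]
    rw [h0, add_zero, ← Finset.sum_fiberwise_of_maps_to
      (t := (Finset.univ : Finset F).powersetCard (Fintype.card X))
      (g := fun p : X → F => Finset.univ.image p)]
    · refine Finset.sum_congr rfl fun S _ => ?_
      rw [Finset.mul_sum, Finset.filter_filter]
      refine Finset.sum_congr rfl fun p hp => ?_
      simp only [Finset.mem_filter] at hp
      rw [← hp.2.2, Finset.prod_image fun i _ j _ h => hp.2.1 h]
    · intro p hp
      simp only [Finset.mem_filter] at hp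
      rw [Finset.mem_powersetCard]
      exact ⟨Finset.subset_univ _, by rw [Finset.card_image_of_injective _ hp.2]; rfl⟩
  rw [key c]
  refine Finset.sum_congr rfl fun S hS => ?_
  rw [key (fun e => if e ∈ S then 1 else 0), Finset.sum_eq_single S]
  · rw [Finset.prod_eq_one (fun e he => if_pos he), one_mul]
  · intro S' hS' hne
    have : ∃ e ∈ S', e ∉ S := by
      by_contra! h
      rw [Finset.mem_powersetCard] at hS hS'
      exact hne (Finset.eq_of_subset_of_card_le h (by rw [hS.2, hS'.2]))
    obtain ⟨e, he, he'⟩ := this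
    rw [Finset.prod_eq_zero he (if_neg he'), zero_mul]
  · exact fun h => absurd hS h

end CauchyBinet

/-! ### The weighted matrix-tree theorem with Dirichlet conditions -/

namespace MultiGraph

section
variable {W F : Type*} (T : MultiGraph W F) (K : Set W)

open Classical in
/-- The incidence matrix, with rows indexed by the vertices outside `K`. -/
noncomputable def inc (R : Type*) [Ring R] (x : {x // x ∉ K}) (e : F) : R :=
  (if T.tgt e = x then 1 else 0) - (if T.src e = x then 1 else 0)

/-- Every vertex is joined to `K` by edges in `S`. -/
def Rooted (S : Set F) : Prop := ∀ x, ∃ k ∈ K, T.joined S x k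

variable {T K}

theorem sum_inc_mul {R : Type*} [CommRing R] [Fintype {x // x ∉ K}] {f : W → R}
    (hf : ∀ x ∈ K, f x = 0) (e : F) :
    ∑ x : {x // x ∉ K}, T.inc K R x e * f x = f (T.tgt e) - f (T.src e) := by
  classical
  have h : ∀ y, ∑ x : {x // x ∉ K}, (if y = x.1 then 1 else 0) * f x = f y := by
    intro y
    by_cases hy : y ∈ K
    · rw [hf y hy]
      refine Finset.sum_eq_zero fun x _ => ?_
      have : y ≠ x.1 := fun h => x.2 (h ▸ hy)
      rw [if_neg this, zero_mul]
    · rw [Finset.sum_eq_single ⟨y, hy⟩]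
      · simp
      · intro x _ hx
        have : y ≠ x.1 := fun h => hx (Subtype.ext h.symm)
        rw [if_neg this, zero_mul]
      · simp
  simp only [inc, sub_mul, Finset.sum_sub_distrib, h]

theorem Rooted.apply_eq_zero {R : Type*} [CommRing R] {S : Set F} (hS : T.Rooted K S) {f : W → R}
    (hf : ∀ x ∈ K, f x = 0) (h : ∀ e ∈ S, f (T.tgt e) - f (T.src e) = 0) (x : W) : f x = 0 := by
  obtain ⟨k, hk, hj⟩ := hS x
  rw [eq_of_joined (fun e he => (sub_eq_zero.1 (h e he)).symm) hj, hf k hk]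

open Classical in
/-- The extension by zero of a function on the complement of `K`. -/
noncomputable def extZero (f : {x // x ∉ K} → ℝ) (x : W) : ℝ :=
  if h : x ∈ K then 0 else f ⟨x, h⟩

theorem extZero_mem (f : {x // x ∉ K} → ℝ) (x : W) (hx : x ∈ K) : extZero f x = 0 := dif_pos hx

theorem extZero_coe (f : {x // x ∉ K} → ℝ) (x : {x // x ∉ K}) : extZero f x.1 = f x := dif_neg x.2

theorem extZero_add (f g : {x // x ∉ K} → ℝ) (x : W) :
    extZero (f + g) x = extZero f x + extZero g x := by
  unfold extZero; split_ifs <;> simp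

theorem extZero_smul (a : ℝ) (f : {x // x ∉ K} → ℝ) (x : W) :
    extZero (a • f) x = a * extZero f x := by
  unfold extZero; split_ifs <;> simp

/-- A function that vanishes on `K` is determined by its increments along the edges of `S`. -/
theorem Rooted.card_le [Fintype {x // x ∉ K}] {S : Finset F} (hS : T.Rooted K (S : Set F)) :
    Fintype.card {x // x ∉ K} ≤ S.card := by
  let L : ({x // x ∉ K} → ℝ) →ₗ[ℝ] (S → ℝ) :=
    { toFun := fun f e => extZero f (T.tgt e) - extZero f (T.src e)
      map_add' := fun f g => by
        ext e; simp only [extZero_add, Pi.add_apply]; ring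
      map_smul' := fun a f => by
        ext e; simp only [extZero_smul, Pi.smul_apply, smul_eq_mul, RingHom.id_apply]; ring }
  have hL : Function.Injective L := by
    rw [← LinearMap.ker_eq_bot, LinearMap.ker_eq_bot']
    intro f hf
    ext x
    rw [← extZero_coe f x]
    exact hS.apply_eq_zero (extZero_mem f) (fun e he => congrFun hf ⟨e, he⟩) x
  have := LinearMap.finrank_le_finrank_of_injective hL
  rwa [Module.finrank_fintype_fun_eq_card, Module.finrank_fintype_fun_eq_card,
    Fintype.card_coe] at this

/-- With as few edges as possible, the incidence matrix `C` restricted to `S` is square and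
integral. It is inverted up to signs by the matrix `U` of indicators of the vertices cut off from
`K` on removing an edge. Hence `det C = ±1` and the Gram determinant is its square. -/
theorem det_weightedGram_of_rooted [Fintype F] [DecidableEq F] [Fintype {x // x ∉ K}]
    [DecidableEq {x // x ∉ K}] {S : Finset F} (hS : T.Rooted K (S : Set F))
    (hcard : S.card = Fintype.card {x // x ∉ K}) :
    (weightedGram (T.inc K ℝ) fun e => if e ∈ S then 1 else 0).det = 1 := by
  classical
  have σ : {x // x ∉ K} ≃ S := Fintype.equivOfCardEq (by rw [Fintype.card_coe, hcard])
  set C : Matrix {x // x ∉ K} {x // x ∉ K} ℤ := Matrix.of fun x i => T.inc K ℤ x (σ i) with hC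
  have h1 : weightedGram (T.inc K ℝ) (fun e => if e ∈ S then 1 else 0) =
      (C * C.transpose).map (Int.castRingHom ℝ) := by
    ext x y
    simp only [weightedGram, Matrix.of_apply, Matrix.mul_apply, Matrix.map_apply,
      Matrix.transpose_apply, map_sum, map_mul, hC, ite_mul, one_mul, zero_mul]
    rw [← Finset.sum_filter, Finset.filter_mem_eq_inter, Finset.univ_inter, ← Finset.sum_coe_sort,
      ← σ.sum_comp]
    refine Finset.sum_congr rfl fun i _ => ?_
    simp [inc]
  have h2 : (C * C.transpose).det = 1 := by
    set reach : F → W → Prop := fun e x => ∃ k ∈ K, T.joined ((S : Set F) \ {e}) x k with hreach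
    have hK : ∀ e, ∀ x ∈ K, reach e x := fun e x hx => ⟨x, hx, joined_refl _ _⟩
    have hedge : ∀ e, ∀ e' ∈ S, e' ≠ e → (reach e (T.src e') ↔ reach e (T.tgt e')) := by
      intro e e' he' hne
      have hj := joined_edge (T := T) (S := (S : Set F) \ {e}) (e := e') ⟨he', hne⟩
      exact ⟨fun ⟨k, hk, h⟩ => ⟨k, hk, joined_trans (joined_symm hj) h⟩,
        fun ⟨k, hk, h⟩ => ⟨k, hk, joined_trans hj h⟩⟩
    -- Otherwise `S` without `e` would still be rooted, contrary to `Rooted.card_le`. So removing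
    -- `e` cuts off exactly one of its ends.
    have hxor : ∀ e ∈ S, ¬ (reach e (T.src e) ↔ reach e (T.tgt e)) := by
      intro e he hiff
      have hall : ∀ x, reach e x := by
        intro x
        obtain ⟨k, hk, hj⟩ := hS x
        have : reach e x = reach e k := eq_of_joined (fun e' he' => by
          by_cases h : e' = e
          · subst h; exact propext hiff
          · exact propext (hedge e e' he' h)) hj
        rw [this]
        exact hK e k hk
      have hroot : T.Rooted K ((S.erase e : Finset F) : Set F) := by
        intro x
        obtain ⟨k, hk, hj⟩ := hall x
        exact ⟨k, hk, by rwa [Finset.coe_erase]⟩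
      have := hroot.card_le
      rw [Finset.card_erase_of_mem he, hcard] at this
      have hpos : 0 < S.card := Finset.card_pos.2 ⟨e, he⟩
      lia
    set U : Matrix {x // x ∉ K} {x // x ∉ K} ℤ :=
      Matrix.of fun x i => if reach (σ i) x then 0 else 1 with hU
    have h3 : C.transpose * U = Matrix.diagonal fun i => (if reach (σ i) (T.tgt (σ i)) then 0 else 1)
        - (if reach (σ i) (T.src (σ i)) then 0 else 1) := by
      ext i j
      rw [Matrix.mul_apply]
      simp only [Matrix.transpose_apply, hC, hU, Matrix.of_apply]
      rw [sum_inc_mul (f := fun x => if reach (σ j) x then (0 : ℤ) else 1)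
        (fun x hx => if_pos (hK _ x hx)), Matrix.diagonal_apply]
      by_cases h : i = j
      · subst h; rw [if_pos rfl]
      · rw [if_neg h]
        have hne : (σ i : F) ≠ σ j := fun h' => h (σ.injective (Subtype.ext h'))
        have := hedge (σ j) (σ i) (σ i).2 hne
        simp only [this, sub_self]
    have h4 : IsUnit (C.transpose * U).det := by
      rw [h3, Matrix.det_diagonal, IsUnit.prod_iff]
      intro i _
      have := hxor (σ i) (σ i).2
      by_cases h5 : reach (σ i) (T.tgt (σ i)) <;> by_cases h6 : reach (σ i) (T.src (σ i))
      · exact (this (iff_of_true h6 h5)).elim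
      · rw [if_pos h5, if_neg h6]; decide
      · rw [if_neg h5, if_pos h6]; decide
      · exact (this (iff_of_false h6 h5)).elim
    rw [Matrix.det_mul, Matrix.det_transpose] at h4
    have h5 := isUnit_of_mul_isUnit_left h4
    rw [Matrix.det_mul, Matrix.det_transpose]
    exact Int.isUnit_mul_self h5
  rw [h1, ← RingHom.mapMatrix_apply, ← RingHom.map_det, h2, map_one]

theorem det_weightedGram_of_not_rooted [Fintype F] [DecidableEq F] [Fintype {x // x ∉ K}]
    [DecidableEq {x // x ∉ K}] {S : Finset F} (hS : ¬ T.Rooted K (S : Set F)) :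
    (weightedGram (T.inc K ℝ) fun e => if e ∈ S then 1 else 0).det = 0 := by
  classical
  simp only [Rooted, not_forall, not_exists, not_and] at hS
  obtain ⟨x₀, hx₀⟩ := hS
  -- The indicator of a component that avoids `K` lies in the kernel of the Gram matrix.
  set f : W → ℝ := fun x => if T.joined S x x₀ then 1 else 0 with hf
  have hfK : ∀ x ∈ K, f x = 0 := fun x hx => if_neg fun h => hx₀ x hx (joined_symm h)
  rw [← Matrix.exists_mulVec_eq_zero_iff]
  refine ⟨fun x => f x, fun h => ?_, ?_⟩
  · have hx : x₀ ∉ K := fun h => hx₀ x₀ h (joined_refl _ _)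
    have := congrFun h ⟨x₀, hx⟩
    simp [hf] at this
  · ext x
    simp only [Matrix.mulVec, dotProduct, weightedGram, Matrix.of_apply, Finset.sum_mul,
      Pi.zero_apply]
    rw [Finset.sum_comm]
    refine Finset.sum_eq_zero fun e _ => ?_
    simp only [mul_assoc, ← Finset.mul_sum]
    rw [sum_inc_mul hfK]
    by_cases he : e ∈ S
    · have hj := joined_edge (T := T) (S := (S : Set F)) he
      have : (T.joined S (T.tgt e) x₀) ↔ (T.joined S (T.src e) x₀) :=
        ⟨fun h => joined_trans hj h, fun h => joined_trans (joined_symm hj) h⟩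
      simp [hf, this]
    · simp [he]

open Classical in
/-- The weighted matrix-tree theorem: the determinant of the Laplacian with Dirichlet conditions
on `K` is the sum over the spanning forests rooted at `K`. -/
theorem det_weightedGram_inc [Fintype F] [Fintype {x // x ∉ K}] (c : F → ℝ) :
    (weightedGram (T.inc K ℝ) c).det =
      ∑ S ∈ (Finset.univ : Finset F).powersetCard (Fintype.card {x // x ∉ K}),
        if T.Rooted K (S : Set F) then ∏ e ∈ S, c e else 0 := by
  rw [det_weightedGram]
  refine Finset.sum_congr rfl fun S hS => ?_
  split_ifs with h
  · rw [det_weightedGram_of_rooted h (Finset.mem_powersetCard.1 hS).2, mul_one]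
  · rw [det_weightedGram_of_not_rooted h, mul_zero]

end

end MultiGraph

/-! ### The Dirichlet Green function, on trees in particular -/

theorem Finset.sum_powersetCard_option {F M : Type*} [Fintype F] [DecidableEq F] [AddCommMonoid M]
    (h : Finset (Option F) → M) (n : ℕ) :
    ∑ S ∈ (Finset.univ : Finset (Option F)).powersetCard (n + 1), h S =
      ∑ S ∈ (Finset.univ : Finset F).powersetCard (n + 1), h (S.map Function.Embedding.some) +
      ∑ S ∈ (Finset.univ : Finset F).powersetCard n,
        h (insert none (S.map Function.Embedding.some)) := by
  have h1 : (Finset.univ : Finset (Option F)) =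
      insert none ((Finset.univ : Finset F).map Function.Embedding.some) := by
    ext o; cases o <;> simp
  have hn : none ∉ (Finset.univ : Finset F).map Function.Embedding.some := by simp
  rw [h1, Finset.powersetCard_succ_insert hn, Finset.sum_union]
  · congr 1
    · rw [Finset.powersetCard_map, Finset.sum_map]; rfl
    · rw [Finset.powersetCard_map, Finset.sum_image, Finset.sum_map]
      · rfl
      · intro S hS S' hS' heq
        have h2 : ∀ S ∈ ((Finset.univ : Finset F).powersetCard n).map
            (Finset.mapEmbedding Function.Embedding.some).toEmbedding, none ∉ S := by
          intro S hS
          rw [← Finset.powersetCard_map] at hS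
          exact fun h => hn ((Finset.mem_powersetCard.1 hS).1 h)
        rw [← Finset.erase_insert (h2 S hS), ← Finset.erase_insert (h2 S' hS'), heq]
  · rw [Finset.disjoint_left]
    intro S hS hS'
    obtain ⟨S'', -, rfl⟩ := Finset.mem_image.1 hS'
    exact hn ((Finset.mem_powersetCard.1 hS).1 (Finset.mem_insert_self _ _))

namespace MultiGraph

section
variable {W F : Type*} {T : MultiGraph W F} {K : Set W} [Fintype W] [Fintype F] {c : F → ℝ}

open Classical in
/-- The Laplacian with weights `c` and Dirichlet conditions on `K`. -/
noncomputable def dirLap (T : MultiGraph W F) (K : Set W) (c : F → ℝ) :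
    Matrix {x // x ∉ K} {x // x ∉ K} ℝ := weightedGram (T.inc K ℝ) c

open Classical in
/-- The Green function with Dirichlet conditions on `K`. -/
noncomputable def green (T : MultiGraph W F) (K : Set W) (c : F → ℝ) (x y : W) : ℝ :=
  if h : x ∈ K then 0 else extZero ((T.dirLap K c)⁻¹ ⟨x, h⟩) y

open Classical in
theorem sum_mul_dirLap_mulVec {f g : W → ℝ} (hf : ∀ x ∈ K, f x = 0) (hg : ∀ x ∈ K, g x = 0) :
    ∑ x : {x // x ∉ K}, f x * ((T.dirLap K c).mulVec (fun x => g x)) x =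
      ∑ e, c e * (f (T.tgt e) - f (T.src e)) * (g (T.tgt e) - g (T.src e)) := by
  have : ∀ e, c e * (f (T.tgt e) - f (T.src e)) * (g (T.tgt e) - g (T.src e)) =
      ∑ x : {x // x ∉ K}, ∑ y : {x // x ∉ K},
        c e * (T.inc K ℝ x e * f x) * (T.inc K ℝ y e * g y) := by
    intro e
    rw [← sum_inc_mul hf, ← sum_inc_mul hg, mul_assoc, Finset.sum_mul_sum, Finset.mul_sum]
    refine Finset.sum_congr rfl fun x _ => ?_
    rw [Finset.mul_sum]
    exact Finset.sum_congr rfl fun y _ => by ring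
  simp only [this]
  rw [Finset.sum_comm]
  refine Finset.sum_congr rfl fun x _ => ?_
  rw [Finset.sum_comm, Matrix.mulVec, dotProduct, Finset.mul_sum]
  refine Finset.sum_congr rfl fun y _ => ?_
  simp only [dirLap, weightedGram, Matrix.of_apply]
  rw [Finset.sum_mul, Finset.mul_sum]
  exact Finset.sum_congr rfl fun e _ => by ring

open Classical in
theorem det_dirLap_ne_zero (hT : T.Rooted K Set.univ) (hc : ∀ e, 0 < c e) :
    (T.dirLap K c).det ≠ 0 := by
  intro h
  obtain ⟨v, hv, h0⟩ := Matrix.exists_mulVec_eq_zero_iff.2 h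
  have h1 := sum_mul_dirLap_mulVec (T := T) (c := c) (extZero_mem v) (extZero_mem v)
  simp only [extZero_coe, h0, Pi.zero_apply, mul_zero, Finset.sum_const_zero] at h1
  have h2 := (Finset.sum_eq_zero_iff_of_nonneg (fun e _ => by
    rw [mul_assoc]; exact mul_nonneg (hc e).le (mul_self_nonneg _))).1 h1.symm
  refine hv (funext fun x => ?_)
  rw [← extZero_coe v x]
  refine hT.apply_eq_zero (extZero_mem v) (fun e _ => ?_) x
  have := h2 e (Finset.mem_univ e)
  rw [mul_assoc] at this
  exact mul_self_eq_zero.1 ((mul_eq_zero.1 this).resolve_left (hc e).ne')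

theorem green_left_mem {x : W} (hx : x ∈ K) (y : W) : T.green K c x y = 0 := dif_pos hx

theorem green_right_mem (x : W) {y : W} (hy : y ∈ K) : T.green K c x y = 0 := by
  unfold green; split_ifs
  · rfl
  · exact extZero_mem _ y hy

theorem green_symm (x y : W) : T.green K c x y = T.green K c y x := by
  classical
  by_cases hx : x ∈ K
  · rw [green_left_mem hx, green_right_mem y hx]
  by_cases hy : y ∈ K
  · rw [green_left_mem hy, green_right_mem x hy]
  have h : (T.dirLap K c).transpose = T.dirLap K c := by
    ext i j
    simp only [dirLap, weightedGram, Matrix.of_apply, Matrix.transpose_apply]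
    exact Finset.sum_congr rfl fun e _ => by ring
  have h' := Matrix.transpose_nonsing_inv (T.dirLap K c)
  rw [h] at h'
  rw [green, green, dif_neg hx, dif_neg hy, extZero, extZero, dif_neg hx, dif_neg hy]
  exact (congrFun (congrFun h' ⟨x, hx⟩) ⟨y, hy⟩).symm

/-- The defining property of the Green function, in weak form. -/
theorem green_weak (hT : T.Rooted K Set.univ) (hc : ∀ e, 0 < c e) (w : W) {ψ : W → ℝ}
    (hψ : ∀ x ∈ K, ψ x = 0) : ∑ e, c e * (ψ (T.tgt e) - ψ (T.src e)) *
      (T.green K c w (T.tgt e) - T.green K c w (T.src e)) = ψ w := by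
  classical
  by_cases hw : w ∈ K
  · simp [green_left_mem hw, hψ w hw]
  rw [← sum_mul_dirLap_mulVec hψ (fun x hx => green_right_mem w hx)]
  have : (T.dirLap K c).mulVec (fun x => T.green K c w x) =
      fun x => (1 : Matrix {x // x ∉ K} {x // x ∉ K} ℝ) x ⟨w, hw⟩ := by
    rw [← Matrix.mul_nonsing_inv _ (det_dirLap_ne_zero hT hc).isUnit]
    ext x
    rw [Matrix.mul_apply]
    refine Finset.sum_congr rfl fun y _ => ?_
    simp only
    rw [green_symm, green, dif_neg y.2, extZero, dif_neg hw]
  rw [this]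
  simp [Matrix.one_apply]

/-- On a tree the determinant of the Green function on the two ends of an edge factorizes. -/
theorem IsAcyclic.green_mul_green_sub (hA : T.IsAcyclic) (hT : T.Rooted K Set.univ)
    (hc : ∀ e, 0 < c e) (e : F) :
    c e * (T.green K c (T.src e) (T.src e) * T.green K c (T.tgt e) (T.tgt e)
      - T.green K c (T.src e) (T.tgt e) ^ 2) = T.green K c (T.src e) (T.tgt e) := by
  classical
  by_cases hb : T.tgt e ∈ K
  · simp [green_right_mem _ hb]
  set a := T.src e with ha
  set b := T.tgt e with hb'
  -- This combination of the Green functions with poles `a` and `b` vanishes at `b`; its value at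
  -- `a` is the determinant in question.
  set u : W → ℝ := fun x => T.green K c b b * T.green K c a x - T.green K c a b * T.green K c b x
    with hu
  have huK : ∀ x ∈ K, u x = 0 := fun x hx => by simp [hu, green_right_mem _ hx]
  have hub : u b = 0 := by simp only [hu]; ring
  have hweak : ∀ ψ : W → ℝ, (∀ x ∈ K, ψ x = 0) →
      ∑ e, c e * (ψ (T.tgt e) - ψ (T.src e)) * (u (T.tgt e) - u (T.src e)) =
        T.green K c b b * ψ a - T.green K c a b * ψ b := by
    intro ψ hψ
    rw [← green_weak hT hc a hψ, ← green_weak hT hc b hψ, Finset.mul_sum, Finset.mul_sum,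
      ← Finset.sum_sub_distrib]
    exact Finset.sum_congr rfl fun e _ => by simp only [hu]; ring
  set χ : W → ℝ := fun x => T.sideInd e x with hχ
  have hχa : χ a = 0 := by simp [hχ, ha, hA.sideInd_src]
  have hχe : ∀ e', e' ≠ e → χ (T.src e') = χ (T.tgt e') := fun e' he' => by
    simp only [hχ, sideInd_eq_of_ne he']
  have hχ01 : ∀ x, χ x * χ x = χ x := fun x => by
    rcases T.sideInd_eq_zero_or_one e x with h | h <;> simp [hχ, h]
  -- On the side of `b`, `u` has zero boundary values at `b` and on `K` and no source left. Testing
  -- against its restriction to that side shows that its energy there is 0.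
  have hψ : ∀ x, χ x * u x = 0 := by
    have h1 := hweak (fun x => χ x * u x) fun x hx => by rw [huK x hx, mul_zero]
    rw [hχa, hub] at h1
    have h2 : ∀ e', c e' * (χ (T.tgt e') * u (T.tgt e') - χ (T.src e') * u (T.src e')) *
        (u (T.tgt e') - u (T.src e')) =
        c e' * (χ (T.tgt e') * u (T.tgt e') - χ (T.src e') * u (T.src e')) ^ 2 := by
      intro e'
      by_cases he' : e' = e
      · subst he'
        rw [← ha, ← hb', hχa, hub]; ring
      · rw [hχe e' he']
        linear_combination (- c e' * (u (T.tgt e') - u (T.src e')) ^ 2) * hχ01 (T.tgt e')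
    simp only [h2, zero_mul, mul_zero, sub_zero] at h1
    have h3 := (Finset.sum_eq_zero_iff_of_nonneg (fun e _ =>
      mul_nonneg (hc e).le (sq_nonneg _))).1 h1
    refine hT.apply_eq_zero (fun x hx => by rw [huK x hx, mul_zero]) fun e _ => ?_
    have := h3 e (Finset.mem_univ e)
    exact pow_eq_zero_iff two_ne_zero |>.1 ((mul_eq_zero.1 this).resolve_left (hc e).ne')
  have hab : a ≠ b := hA.src_ne_tgt e
  -- Flow balance at `b`: as `u` vanishes beyond `b`, only the edge `e` contributes, and the source
  -- term is `-G(a,b)`.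
  have h1 := hweak (fun x => if x = b then 1 else 0) fun x hx =>
    if_neg fun h : x = b => hb (h ▸ hx)
  rw [if_neg hab, if_pos rfl, Finset.sum_eq_single e] at h1
  · rw [← ha, ← hb', if_pos rfl, if_neg hab, hub] at h1
    simp only [hu] at h1
    rw [green_symm b a] at h1
    linear_combination -h1
  · intro e' _ he'
    have h0 : ∀ x, χ x = 1 → u x = 0 := fun x hx => by simpa [hx] using hψ x
    have hχb : χ b = 1 := by simp [hχ, hb', sideInd_tgt]
    by_cases h3 : T.tgt e' = b ∨ T.src e' = b
    · have h4 : χ (T.tgt e') = 1 ∧ χ (T.src e') = 1 := by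
        rcases h3 with h3 | h3
        · exact ⟨by rw [h3, hχb], by rw [hχe e' he', h3, hχb]⟩
        · exact ⟨by rw [← hχe e' he', h3, hχb], by rw [h3, hχb]⟩
      rw [h0 _ h4.1, h0 _ h4.2]; ring
    · push Not at h3
      rw [if_neg h3.1, if_neg h3.2]; ring
  · simp

/-- Test the equation of `G(x,·)` against the indicator of `x`, multiply by `G(x,x)`, sum over `x`
and collect the terms edge by edge. -/
theorem sum_green_diag (hT : T.Rooted K Set.univ) (hc : ∀ e, 0 < c e) :
    ∑ x, T.green K c x x = ∑ e, c e *
      (T.green K c (T.tgt e) (T.tgt e) *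
          (T.green K c (T.tgt e) (T.tgt e) - T.green K c (T.src e) (T.tgt e)) +
        T.green K c (T.src e) (T.src e) *
          (T.green K c (T.src e) (T.src e) - T.green K c (T.src e) (T.tgt e))) := by
  classical
  have h1 : ∀ x, T.green K c x x = ∑ e, T.green K c x x * (c e *
      ((if T.tgt e = x then 1 else 0) - (if T.src e = x then 1 else 0)) *
      (T.green K c x (T.tgt e) - T.green K c x (T.src e))) := by
    intro x
    by_cases hx : x ∈ K
    · simp [green_left_mem hx]
    · rw [← Finset.mul_sum, green_weak hT hc x (ψ := fun y => if y = x then 1 else 0)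
        (fun y hy => if_neg fun h : y = x => hx (h ▸ hy)), if_pos rfl, mul_one]
  rw [Finset.sum_congr rfl fun x _ => h1 x, Finset.sum_comm]
  refine Finset.sum_congr rfl fun e _ => ?_
  simp only [mul_sub, sub_mul, Finset.sum_sub_distrib, mul_ite, ite_mul, mul_one, mul_zero,
    zero_mul, Finset.sum_ite_eq, Finset.mem_univ, if_true]
  rw [green_symm (T.tgt e) (T.src e)]
  ring

theorem sum_degree_mul (hT : ∀ e, T.src e ≠ T.tgt e) (f : W → ℝ) :
    ∑ x, (T.degree x : ℝ) * f x = ∑ e, (f (T.src e) + f (T.tgt e)) := by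
  classical
  have h1 : ∀ x, (T.degree x : ℝ) = ∑ e, ((if T.src e = x then 1 else 0) +
      (if T.tgt e = x then 1 else 0)) := by
    intro x
    have := congrArg (Int.cast : ℤ → ℝ) (degree_eq_sum hT x)
    push_cast at this
    exact this
  simp only [h1, Finset.sum_mul]
  rw [Finset.sum_comm]
  refine Finset.sum_congr rfl fun e _ => ?_
  simp [add_mul, Finset.sum_add_distrib]

/-- The sum of the values of the Green function on the diagonal, weighted by the valencies. -/
theorem IsAcyclic.sum_degree_sub_two_mul_green (hA : T.IsAcyclic) (hT : T.Rooted K Set.univ)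
    (hc : ∀ e, 0 < c e) :
    2 * ∑ x, ((T.degree x : ℝ) - 2) * T.green K c x x = - ∑ e,
      (c e * (3 * (T.green K c (T.tgt e) (T.tgt e) - T.green K c (T.src e) (T.src e)) ^ 2 +
        (T.green K c (T.src e) (T.src e) + T.green K c (T.tgt e) (T.tgt e)
          - 2 * T.green K c (T.src e) (T.tgt e)) ^ 2) -
        2 * (T.green K c (T.src e) (T.src e) + T.green K c (T.tgt e) (T.tgt e)
          - 2 * T.green K c (T.src e) (T.tgt e))) := by
  simp only [sub_mul, Finset.sum_sub_distrib (f := fun x => (T.degree x : ℝ) * T.green K c x x)]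
  rw [sum_degree_mul hA.src_ne_tgt, ← Finset.mul_sum, sum_green_diag hT hc, Finset.mul_sum,
    ← Finset.sum_sub_distrib, Finset.mul_sum, ← Finset.sum_neg_distrib]
  refine Finset.sum_congr rfl fun e _ => ?_
  -- For each edge the two sides differ by a multiple of the tree relation `c (G(a,a) G(b,b) -
  -- G(a,b)²) = G(a,b)`; acyclicity is essential here.
  linear_combination (-4) * hA.green_mul_green_sub hT hc e

/-- The graph with an additional edge from `x` to `k`. -/
def addEdge (T : MultiGraph W F) (x k : W) : MultiGraph W (Option F) where
  src o := o.elim x T.src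
  tgt o := o.elim k T.tgt

theorem rooted_addEdge_map {k x : W} {S : Finset F} :
    (T.addEdge x k).Rooted K ((S.map Function.Embedding.some : Finset (Option F)) : Set (Option F)) ↔
      T.Rooted K (S : Set F) := by
  have h : ∀ u v, (T.addEdge x k).joined
      ((S.map Function.Embedding.some : Finset (Option F)) : Set (Option F)) u v ↔
      T.joined (S : Set F) u v := by
    refine fun u v => ⟨joined_le fun o ho => ?_, joined_le fun e he => ?_⟩
    · simp only [Finset.coe_map, Set.mem_image, Finset.mem_coe] at ho
      obtain ⟨e, he, rfl⟩ := ho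
      exact joined_edge (T := T) he
    · exact joined_edge (T := T.addEdge x k) (e := some e) (by simpa using he)
  simp only [Rooted, h]

theorem rooted_addEdge_insert [DecidableEq F] {k x : W} (hk : k ∈ K) {S : Finset F} :
    (T.addEdge x k).Rooted K
      ((insert none (S.map Function.Embedding.some) : Finset (Option F)) : Set (Option F)) ↔
      T.Rooted (insert x K) (S : Set F) := by
  set S' : Set (Option F) :=
    ((insert none (S.map Function.Embedding.some) : Finset (Option F)) : Set (Option F)) with hS'
  have hnone : none ∈ S' := by simp [hS']
  have hxk : (T.addEdge x k).joined S' x k := joined_edge (T := T.addEdge x k) hnone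
  constructor
  · intro h v
    obtain ⟨k', hk', hj⟩ := h v
    have h1 : (∃ k ∈ insert x K, T.joined S v k) = (∃ k ∈ insert x K, T.joined S k' k) := by
      refine eq_of_joined (f := fun v => ∃ k ∈ insert x K, T.joined S v k) (fun o ho => ?_) hj
      rcases o with _ | e
      · exact propext (iff_of_true ⟨x, Set.mem_insert _ _, joined_refl _ _⟩
          ⟨k, Set.mem_insert_of_mem _ hk, joined_refl _ _⟩)
      · have he : e ∈ S := by simpa [hS'] using ho
        have := joined_edge (T := T) (S := (S : Set F)) he
        exact propext ⟨fun ⟨k, hk, h⟩ => ⟨k, hk, joined_trans (joined_symm this) h⟩,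
          fun ⟨k, hk, h⟩ => ⟨k, hk, joined_trans this h⟩⟩
    rw [h1]
    exact ⟨k', Set.mem_insert_of_mem _ hk', joined_refl _ _⟩
  · intro h v
    obtain ⟨k', hk', hj⟩ := h v
    have hj' : (T.addEdge x k).joined S' v k' := joined_le (fun e he =>
      joined_edge (T := T.addEdge x k) (S := S') (e := some e) (by simpa [hS'] using he)) hj
    rcases hk' with rfl | hk'
    · exact ⟨k, hk, joined_trans hj' hxk⟩
    · exact ⟨k', hk', hj'⟩

open Classical in
-- A new edge of conductance 1 from `x` to `K` is a rank-one perturbation of the Laplacian and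
-- multiplies its determinant by `1 + G(x,x)`. In the matrix-tree expansion the forests without the
-- new edge give the old determinant, and those with it are the forests for which `x` is a further
-- root.
theorem det_dirLap_mul_green (hT : T.Rooted K Set.univ) (hc : ∀ e, 0 < c e) {k x : W} (hk : k ∈ K)
    (hx : x ∉ K) : (T.dirLap K c).det * T.green K c x x =
      ∑ S ∈ (Finset.univ : Finset F).powersetCard (Fintype.card {x // x ∉ K} - 1),
        if T.Rooted (insert x K) (S : Set F) then ∏ e ∈ S, c e else 0 := by
  set q := Fintype.card {x // x ∉ K} with hq
  have hq1 : q = (q - 1) + 1 := by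
    have : 0 < q := Fintype.card_pos_iff.2 ⟨⟨x, hx⟩⟩
    lia
  set δ : {x // x ∉ K} → ℝ := Pi.single ⟨x, hx⟩ 1 with hδ
  have h1 : weightedGram ((T.addEdge x k).inc K ℝ) (fun o => o.elim 1 c) =
      T.dirLap K c + Matrix.replicateCol Unit δ * Matrix.replicateRow Unit δ := by
    ext i j
    have h0 : ∀ i : {x // x ∉ K}, (T.addEdge x k).inc K ℝ i none = - δ i := by
      intro i
      have h2 : k ≠ i.1 := fun h => i.2 (h ▸ hk)
      have h3 : (x = i.1) ↔ i = ⟨x, hx⟩ := by rw [Subtype.ext_iff, eq_comm]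
      simp [inc, addEdge, h2, Pi.single_apply, h3, hδ]
    have h4 : ∀ (i : {x // x ∉ K}) e, (T.addEdge x k).inc K ℝ i (some e) = T.inc K ℝ i e :=
      fun i e => rfl
    simp only [weightedGram, Matrix.of_apply, Fintype.sum_option, h0, h4, Option.elim,
      Matrix.add_apply, dirLap, Matrix.mul_apply, Finset.univ_unique, Finset.sum_singleton,
      Matrix.replicateCol_apply, Matrix.replicateRow_apply]
    rw [add_comm]
    congr 1
    ring
  have h2 := det_weightedGram_inc (T := T.addEdge x k) (K := K) (fun o => o.elim 1 c)
  have h3 := det_weightedGram_inc (T := T) (K := K) c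
  have h4 : (1 + Matrix.replicateRow Unit δ * (T.dirLap K c)⁻¹ * Matrix.replicateCol Unit δ).det =
      1 + T.green K c x x := by
    rw [Matrix.det_unique]
    simp only [Matrix.add_apply, Matrix.one_apply_eq, Matrix.mul_apply, Matrix.replicateRow_apply,
      Matrix.replicateCol_apply, hδ, Pi.single_apply, ite_mul, one_mul, zero_mul, mul_ite, mul_one,
      mul_zero, Finset.sum_ite_eq', Finset.mem_univ, if_true, green, dif_neg hx, extZero]
  rw [h1, Matrix.det_add_replicateCol_mul_replicateRow (det_dirLap_ne_zero hT hc).isUnit, h4,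
    ← hq, hq1, Finset.sum_powersetCard_option, ← hq1] at h2
  have h5 : ∀ S : Finset F, ∏ o ∈ S.map Function.Embedding.some, (o.elim 1 c : ℝ) =
      ∏ e ∈ S, c e := fun S => by rw [Finset.prod_map]; rfl
  have h6 : ∀ S : Finset F, ∏ o ∈ insert none (S.map Function.Embedding.some),
      (o.elim 1 c : ℝ) = ∏ e ∈ S, c e := fun S => by
    rw [Finset.prod_insert (by simp), h5]; simp
  simp only [rooted_addEdge_map, rooted_addEdge_insert hk, h5, h6] at h2
  rw [← h3] at h2
  change (T.dirLap K c).det * _ = (T.dirLap K c).det + _ at h2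
  linear_combination h2

end

end MultiGraph

/-! ### Hyperelliptic graphs and their quotient trees -/

namespace InvGraph

section
variable {V E : Type*} {G : InvGraph V E}

instance [Finite V] : Finite G.VertClass := inferInstanceAs (Finite (Quotient G.vertSetoid))

noncomputable instance [Finite V] : Fintype G.VertClass := Fintype.ofFinite _

theorem vcls_eq_iff {u v : V} : G.vcls u = G.vcls v ↔ u = v ∨ u = G.iV v :=
  ⟨fun h => Quotient.exact h, fun h => Quotient.sound h⟩

theorem cls_eq_iff {e f : E} : G.cls e = G.cls f ↔ e = f ∨ e = G.iE f :=
  ⟨fun h => Quotient.exact h, fun h => Quotient.sound h⟩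

theorem vcls_iV (v : V) : G.vcls (G.iV v) = G.vcls v := vcls_eq_iff.2 (Or.inr rfl)

theorem vcls_surjective : Function.Surjective G.vcls := Quotient.exists_rep

theorem cls_surjective : Function.Surjective G.cls := Quotient.exists_rep

theorem quotientGraph_src (e : E) : G.quotientGraph.src (G.cls e) = G.vcls (G.src e) := rfl

theorem quotientGraph_tgt (e : E) : G.quotientGraph.tgt (G.cls e) = G.vcls (G.tgt e) := rfl

theorem isFixed_iV {v : V} : G.IsFixed (G.iV v) ↔ G.IsFixed v := by
  unfold IsFixed
  rw [G.iV_iV]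
  exact eq_comm

/-- The classes of fixed vertices. -/
def fixedClasses (G : InvGraph V E) : Set G.VertClass := G.nonFixedClassesᶜ

theorem vcls_mem_nonFixedClasses {v : V} : G.vcls v ∈ G.nonFixedClasses ↔ ¬ G.IsFixed v := by
  constructor
  · rintro ⟨w, hw, h⟩
    rcases vcls_eq_iff.1 h with rfl | rfl
    · exact hw
    · rwa [isFixed_iV] at hw
  · exact fun h => ⟨v, h, rfl⟩

theorem vcls_mem_fixedClasses {v : V} : G.vcls v ∈ G.fixedClasses ↔ G.IsFixed v := by
  rw [fixedClasses, Set.mem_compl_iff, vcls_mem_nonFixedClasses, not_not]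

theorem joined_quotientGraph {S : Set G.EdgeClass} {u v : V} (h : G.joined (G.edgesOver S) u v) :
    G.quotientGraph.joined S (G.vcls u) (G.vcls v) :=
  MultiGraph.joined_le (r := (G.quotientGraph.joined S).comap G.vcls)
    (fun e he => MultiGraph.joined_edge (T := G.quotientGraph) (e := G.cls e) he) h

/-- Lifting of chains: each edge class at the class of a vertex has a representative starting from
that vertex, so a lift from `u` ends somewhere over the class of `v`. -/
theorem joined_of_joined_quotientGraph {S : Set G.EdgeClass} {u v : V}
    (h : G.quotientGraph.joined S (G.vcls u) (G.vcls v)) :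
    G.joined (G.edgesOver S) u v ∨ G.joined (G.edgesOver S) u (G.iV v) := by
  have hι : ∀ {u v}, G.joined (G.edgesOver S) u (G.iV v) → G.joined (G.edgesOver S) (G.iV u) v :=
    fun {u v} h => by simpa [G.iV_iV] using G.joined_iV S _ _ h
  let r : Setoid G.VertClass :=
    { r := fun x y => ∀ u v, G.vcls u = x → G.vcls v = y →
        G.joined (G.edgesOver S) u v ∨ G.joined (G.edgesOver S) u (G.iV v)
      iseqv := by
        refine ⟨fun x u v hu hv => ?_, fun {x y} h u v hu hv => ?_, fun {x y z} h h' u w hu hw => ?_⟩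
        · rcases vcls_eq_iff.1 (hu.trans hv.symm) with rfl | rfl
          · exact Or.inl (MultiGraph.joined_refl _ _)
          · exact Or.inr (MultiGraph.joined_refl _ _)
        · rcases h v u hv hu with h | h
          · exact Or.inl (MultiGraph.joined_symm h)
          · exact Or.inr (MultiGraph.joined_symm (hι h))
        · obtain ⟨v, rfl⟩ := vcls_surjective y
          rcases h u v hu rfl with h1 | h1 <;> rcases h' v w rfl hw with h2 | h2
          · exact Or.inl (MultiGraph.joined_trans h1 h2)
          · exact Or.inr (MultiGraph.joined_trans h1 h2)
          · exact Or.inr (MultiGraph.joined_trans h1 (G.joined_iV S _ _ h2))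
          · exact Or.inl (MultiGraph.joined_trans h1 (hι h2)) }
  refine MultiGraph.joined_le (r := r) (fun x hx u v hu hv => ?_) h u v rfl rfl
  obtain ⟨e, rfl⟩ := cls_surjective x
  have he := MultiGraph.joined_edge (T := G.toMultiGraph) (S := G.edgesOver S) (e := e) hx
  have he' := G.joined_iV S _ _ he
  rcases vcls_eq_iff.1 hu with rfl | rfl <;> rcases vcls_eq_iff.1 hv with rfl | rfl
  · exact Or.inl he
  · exact Or.inr (by rwa [G.iV_iV])
  · exact Or.inr he'
  · exact Or.inl he'

theorem joined_of_joined_fixed {S : Set G.EdgeClass} {u p : V} (hp : G.IsFixed p)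
    (h : G.quotientGraph.joined S (G.vcls u) (G.vcls p)) : G.joined (G.edgesOver S) u p := by
  rcases joined_of_joined_quotientGraph h with h | h
  · exact h
  · rwa [show G.iV p = p from hp] at h

theorem quotientGraph_connected (h : G.Connected) : G.quotientGraph.Connected := by
  refine ⟨h.1.map G.vcls, fun x y => ?_⟩
  obtain ⟨u, rfl⟩ := vcls_surjective x
  obtain ⟨v, rfl⟩ := vcls_surjective y
  refine joined_quotientGraph (S := Set.univ) ?_
  have h1 : G.edgesOver Set.univ = Set.univ := by
    ext
    simp [edgesOver]
  rw [h1]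
  exact h.2 u v

theorem sum_edges_eq [Fintype E] (h : ∀ e, G.iE e ≠ e) (f : E → ℝ) :
    ∑ e, f e = ∑ x : G.EdgeClass, (f (Quotient.out x) + f (G.iE (Quotient.out x))) := by
  classical
  rw [← Finset.sum_fiberwise_of_maps_to (t := Finset.univ) (g := G.cls) (fun _ _ => Finset.mem_univ _)]
  refine Finset.sum_congr rfl fun x _ => ?_
  have hx : G.cls (Quotient.out x) = x := Quotient.out_eq x
  rw [← Finset.sum_pair (h _).symm]
  refine Finset.sum_congr ?_ fun _ _ => rfl
  ext e
  simp only [Finset.mem_filter, Finset.mem_univ, true_and, Finset.mem_insert,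
    Finset.mem_singleton]
  rw [← cls_eq_iff, hx]

theorem sum_edges_cls [Fintype E] (h : ∀ e, G.iE e ≠ e) (f : G.EdgeClass → ℝ) :
    ∑ e, f (G.cls e) = 2 * ∑ x : G.EdgeClass, f x := by
  rw [sum_edges_eq h, Finset.mul_sum]
  refine Finset.sum_congr rfl fun x _ => ?_
  rw [cls_iE, show G.cls (Quotient.out x) = x from Quotient.out_eq x]
  ring

namespace IsHyperelliptic
variable (hG : G.IsHyperelliptic)
include hG

theorem quotient_connected : G.quotientGraph.Connected := quotientGraph_connected hG.connected

theorem vcls_src_ne (e : E) : G.vcls (G.src e) ≠ G.vcls (G.tgt e) := hG.tree.src_ne_tgt (G.cls e)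

theorem src_ne_iV_tgt (e : E) : G.src e ≠ G.iV (G.tgt e) := fun h =>
  hG.vcls_src_ne e (vcls_eq_iff.2 (Or.inr h))

theorem tgt_ne_iV_src (e : E) : G.tgt e ≠ G.iV (G.src e) := fun h =>
  hG.vcls_src_ne e (vcls_eq_iff.2 (Or.inr h)).symm

open Classical in
-- The two ends of `e` lie in different classes because the quotient is a tree. So an end shared
-- with `ι(e)` can only be shared with its own image.
theorem jointing_eq (e : E) : G.jointing e =
    (if G.IsFixed (G.src e) then 1 else 0) + (if G.IsFixed (G.tgt e) then 1 else 0) := by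
  have h1 := hG.src_ne_iV_tgt e
  have h2 := hG.tgt_ne_iV_src e
  have h3 := hG.interval e
  have h4 : G.ends e ∩ G.ends (G.iE e) =
      {x | x = G.src e ∧ G.IsFixed (G.src e)} ∪ {x | x = G.tgt e ∧ G.IsFixed (G.tgt e)} := by
    ext x
    simp only [MultiGraph.ends, G.src_iE, G.tgt_iE, Set.mem_inter_iff, Set.mem_insert_iff,
      Set.mem_singleton_iff, Set.mem_union, Set.mem_ofPred_eq, IsFixed]
    constructor
    · rintro ⟨rfl | rfl, h | h⟩
      · exact Or.inl ⟨rfl, h.symm⟩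
      · exact absurd h h1
      · exact absurd h h2
      · exact Or.inr ⟨rfl, h.symm⟩
    · rintro (⟨rfl, h⟩ | ⟨rfl, h⟩)
      · exact ⟨Or.inl rfl, Or.inl h.symm⟩
      · exact ⟨Or.inr rfl, Or.inr h.symm⟩
  rw [jointing, h4]
  by_cases ha : G.IsFixed (G.src e) <;> by_cases hb : G.IsFixed (G.tgt e)
  · simp only [ha, hb, and_true, if_true]
    rw [Set.ofPred_eq_eq_singleton, Set.ofPred_eq_eq_singleton, Set.singleton_union,
      Set.ncard_pair h3]
  · simp [ha, hb]
  · simp [ha, hb]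
  · simp [ha, hb]

theorem not_mem_ends_iE {v : V} (hv : ¬ G.IsFixed v) {e : E} (h : v ∈ G.ends e) :
    v ∉ G.ends (G.iE e) := by
  have h1 := hG.src_ne_iV_tgt e
  have h2 := hG.tgt_ne_iV_src e
  simp only [MultiGraph.ends, G.src_iE, G.tgt_iE, Set.mem_insert_iff, Set.mem_singleton_iff] at h ⊢
  rintro (h' | h') <;> rcases h with rfl | rfl
  · exact hv h'.symm
  · exact h2 h'
  · exact h1 h'
  · exact hv h'.symm

theorem nu_eq_degree [Finite E] {v : V} (hv : ¬ G.IsFixed v) : G.nu v = G.degree v := by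
  classical
  rw [nu, MultiGraph.degree, ← Set.ncard_union_eq]
  · congr 1
    ext e
    simp only [Set.mem_union, Set.mem_ofPred_eq]
    constructor
    · rintro (h | h) <;> exact h.1
    · intro h
      rw [hG.jointing_eq]
      simp only [MultiGraph.ends, Set.mem_insert_iff, Set.mem_singleton_iff] at h ⊢
      rcases h with rfl | rfl
      · by_cases hb : G.IsFixed (G.tgt e) <;> simp [hv, hb]
      · by_cases hb : G.IsFixed (G.src e) <;> simp [hv, hb]
  · rw [Set.disjoint_left]
    rintro e ⟨-, h⟩ ⟨-, h'⟩
    lia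

theorem mem_ends_cls {v : V} {e : E} (h : v ∈ G.ends e) :
    G.vcls v ∈ G.quotientGraph.ends (G.cls e) := by
  rcases h with rfl | rfl
  · exact Or.inl rfl
  · exact Or.inr rfl

omit hG in
theorem exists_mem_ends {v : V} {x : G.EdgeClass} (h : G.vcls v ∈ G.quotientGraph.ends x) :
    ∃ e, G.cls e = x ∧ v ∈ G.ends e := by
  obtain ⟨e, rfl⟩ := cls_surjective x
  rcases h with h | h <;> rcases vcls_eq_iff.1 h with rfl | rfl
  · exact ⟨e, rfl, Or.inl rfl⟩
  · exact ⟨G.iE e, G.cls_iE e, Or.inl (G.src_iE e).symm⟩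
  · exact ⟨e, rfl, Or.inr rfl⟩
  · exact ⟨G.iE e, G.cls_iE e, Or.inr (G.tgt_iE e).symm⟩

theorem degree_vcls [Finite E] {v : V} (hv : ¬ G.IsFixed v) :
    G.quotientGraph.degree (G.vcls v) = G.degree v := by
  rw [MultiGraph.degree, MultiGraph.degree, ← Set.InjOn.ncard_image (f := G.cls)]
  · congr 1
    ext x
    constructor
    · intro h
      obtain ⟨e, rfl, he⟩ := exists_mem_ends h
      exact ⟨e, he, rfl⟩
    · rintro ⟨e, he, rfl⟩
      exact hG.mem_ends_cls he
  · intro e he f hf hef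
    rcases cls_eq_iff.1 hef with rfl | rfl
    · rfl
    · exact absurd he (hG.not_mem_ends_iE hv hf)

theorem three_le_degree [Finite E] {x : G.VertClass} (hx : x ∉ G.fixedClasses) :
    3 ≤ G.quotientGraph.degree x := by
  obtain ⟨v, rfl⟩ := vcls_surjective x
  rw [vcls_mem_fixedClasses] at hx
  rw [hG.degree_vcls hx]
  exact hG.three_le v hx

/-- The vertices on one side of an edge class of the quotient tree include a fixed vertex. -/
theorem exists_fixed_of_bdry [Finite V] [Finite E] {C : Finset G.VertClass} (hC : C.Nonempty)
    (h : (G.quotientGraph.bdry C).card ≤ 2) : ∃ p, G.IsFixed p ∧ G.vcls p ∈ C := by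
  -- Without fixed vertices all valencies in `C` would be at least 3, and at least `|C| + 2 ≥ 3`
  -- edges would leave `C`.
  by_contra! hcon
  have := hG.tree.card_add_two_le_card_bdry hC fun x hx => hG.three_le_degree (x := x) fun hx' => by
    obtain ⟨v, rfl⟩ := vcls_surjective x
    exact hcon v (vcls_mem_fixedClasses.1 hx') hx
  have := hC.card_pos
  lia

theorem exists_fixed [Finite V] [Finite E] : ∃ p, G.IsFixed p := by
  classical
  obtain ⟨x⟩ := hG.quotient_connected.1
  obtain ⟨p, hp, -⟩ := hG.exists_fixed_of_bdry (C := Finset.univ) ⟨x, Finset.mem_univ _⟩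
    (by simp [MultiGraph.bdry])
  exact ⟨p, hp⟩

theorem exists_fixed_joined [Finite V] [Finite E] (x : G.EdgeClass) {y : G.VertClass} :
    ∃ p, G.IsFixed p ∧ G.quotientGraph.joined {x}ᶜ y (G.vcls p) := by
  classical
  obtain ⟨p, hp, hj⟩ := hG.exists_fixed_of_bdry
    (C := Finset.univ.filter fun z => G.quotientGraph.joined {x}ᶜ y z)
    ⟨y, by simp⟩ (by
      refine le_trans (Finset.card_le_card (t := {x}) fun e he => ?_) (by simp)
      by_contra hne
      have hj := MultiGraph.joined_edge (T := G.quotientGraph) (S := {x}ᶜ) (e := e)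
        (by simpa using hne)
      simp only [MultiGraph.bdry, Finset.mem_filter, Finset.mem_univ, true_and] at he
      rcases he with ⟨h1, h2⟩ | ⟨h1, h2⟩
      · exact h2 (MultiGraph.joined_trans h1 hj)
      · exact h1 (MultiGraph.joined_trans h2 (MultiGraph.joined_symm hj)))
  exact ⟨p, hp, by simpa using hj⟩

theorem rooted_univ [Finite V] [Finite E] : G.quotientGraph.Rooted G.fixedClasses Set.univ := by
  obtain ⟨p, hp⟩ := hG.exists_fixed
  exact fun x => ⟨G.vcls p, vcls_mem_fixedClasses.2 hp, hG.quotient_connected.2 _ _⟩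

/-- The two sheets of the covering outside the fixed vertices. -/
theorem exists_sheet [Finite E] : ∃ s : V → ZMod 2, (∀ v, ¬ G.IsFixed v → s (G.iV v) = s v + 1) ∧
    ∀ e, ¬ G.IsFixed (G.src e) → ¬ G.IsFixed (G.tgt e) → s (G.src e) = s (G.tgt e) := by
  classical
  have h2 : (1 : ZMod 2) + 1 = 0 := by decide
  have hadd : ∀ a : ZMod 2, a + a = 0 := by decide
  set τ : V → ZMod 2 := fun v => if Quotient.out (G.vcls v) = v then 0 else 1 with hτ
  have hτι : ∀ v, ¬ G.IsFixed v → τ (G.iV v) = τ v + 1 := by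
    intro v hv
    have h3 : Quotient.out (G.vcls v) = v ∨ Quotient.out (G.vcls v) = G.iV v :=
      vcls_eq_iff.1 (Quotient.out_eq (G.vcls v))
    have h4 : G.iV v ≠ v := hv
    simp only [hτ, vcls_iV]
    rcases h3 with h3 | h3
    · rw [h3, if_pos rfl, if_neg h4.symm, zero_add]
    · rw [h3, if_pos rfl, if_neg h4, h2]
  have hlift : ∀ e f : E, G.cls e = G.cls f → ¬ G.IsFixed (G.src f) → ¬ G.IsFixed (G.tgt f) →
      τ (G.tgt e) + τ (G.src e) = τ (G.tgt f) + τ (G.src f) := by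
    intro e f hef h3 h4
    rcases cls_eq_iff.1 hef with rfl | rfl
    · rfl
    · rw [G.src_iE, G.tgt_iE, hτι _ h3, hτι _ h4]
      linear_combination h2
  -- The labelling `τ` by arbitrary representatives may jump along edges. On a tree these jumps, a
  -- cochain with values in `ZMod 2`, are a coboundary and can be corrected by a function of the
  -- class.
  obtain ⟨f, hf⟩ := hG.tree.exists_coboundary (R := ZMod 2) (fun x =>
    τ (G.tgt (Quotient.out x)) + τ (G.src (Quotient.out x)))
  refine ⟨fun v => τ v + f (G.vcls v), fun v hv => ?_, fun e ha hb => ?_⟩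
  · change τ (G.iV v) + f (G.vcls (G.iV v)) = τ v + f (G.vcls v) + 1
    rw [hτι v hv, vcls_iV]
    ring
  · have h3 := hf (G.cls e)
    rw [hlift (Quotient.out (G.cls e)) e (Quotient.out_eq _) ha hb, quotientGraph_src,
      quotientGraph_tgt] at h3
    change τ (G.src e) + f (G.vcls (G.src e)) = τ (G.tgt e) + f (G.vcls (G.tgt e))
    linear_combination -h3 - hadd (τ (G.tgt e))

end IsHyperelliptic

end

end InvGraph

/-! ### Edges linked outside the root set -/

namespace MultiGraph

section
variable {W F : Type*} {T : MultiGraph W F} {K : Set W}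

/-- Two edges are linked if they are connected by a chain of edges in which consecutive edges share
a vertex outside `K`. -/
def linked (T : MultiGraph W F) (K : Set W) : Setoid F :=
  Relation.EqvGen.setoid fun a b => ∃ u, u ∉ K ∧ u ∈ T.ends a ∧ u ∈ T.ends b

theorem linked_of_mem_ends {a b : F} {u : W} (hu : u ∉ K) (ha : u ∈ T.ends a) (hb : u ∈ T.ends b) :
    T.linked K a b := Relation.EqvGen.rel _ _ ⟨u, hu, ha, hb⟩

theorem linked_le {r : Setoid F}
    (hr : ∀ a b u, u ∉ K → u ∈ T.ends a → u ∈ T.ends b → r a b) {a b : F}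
    (h : T.linked K a b) : r a b := by
  induction h with
  | rel x y h =>
    obtain ⟨u, hu, ha, hb⟩ := h
    exact hr x y u hu ha hb
  | refl x => exact r.refl x
  | symm x y _ ih => exact r.symm ih
  | trans x y z _ _ ih₁ ih₂ => exact r.trans ih₁ ih₂

theorem src_mem_ends (e : F) : T.src e ∈ T.ends e := Or.inl rfl

theorem tgt_mem_ends (e : F) : T.tgt e ∈ T.ends e := Or.inr rfl

theorem joined_of_mem_ends {S : Set F} {e : F} (he : e ∈ S) {x y : W} (hx : x ∈ T.ends e)
    (hy : y ∈ T.ends e) : T.joined S x y := by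
  have := joined_edge (T := T) he
  rcases hx with rfl | rfl <;> rcases hy with rfl | rfl
  · exact joined_refl _ _
  · exact this
  · exact joined_symm this
  · exact joined_refl _ _

/-- If the vertices in `N` of every edge linked to `a` are joined by edges in `S`, then so are all
vertices in `N` of the edges linked to `a`. -/
theorem joined_of_linked {N : Set W} {S : Set F} {a b : F} (hK : ∀ u, u ∉ K → u ∈ N)
    (h₁ : ∀ g, T.linked K a g → ∃ x ∈ T.ends g, x ∈ N)
    (h₂ : ∀ g, T.linked K a g → ∀ x ∈ T.ends g, x ∈ N → ∀ y ∈ T.ends g, y ∈ N → T.joined S x y)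
    (hab : T.linked K a b) {x y : W} (hx : x ∈ T.ends a) (hxN : x ∈ N) (hy : y ∈ T.ends b)
    (hyN : y ∈ N) : T.joined S x y := by
  let r : Setoid F :=
    { r := fun g g' => (T.linked K a g ↔ T.linked K a g') ∧ (T.linked K a g →
        ∀ x ∈ T.ends g, x ∈ N → ∀ y ∈ T.ends g', y ∈ N → T.joined S x y)
      iseqv := by
        refine ⟨fun g => ⟨Iff.rfl, h₂ g⟩, fun {g g'} h => ⟨h.1.symm, fun hg x hx hxN y hy hyN => ?_⟩,
          fun {g g' g''} h h' => ⟨h.1.trans h'.1, fun hg x hx hxN y hy hyN => ?_⟩⟩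
        · exact joined_symm (h.2 (h.1.2 hg) y hy hyN x hx hxN)
        · obtain ⟨z, hz, hzN⟩ := h₁ g' (h.1.1 hg)
          exact joined_trans (h.2 hg x hx hxN z hz hzN) (h'.2 (h.1.1 hg) z hz hzN y hy hyN) }
  have h : r a b := linked_le (fun g g' u hu hg hg' => by
    have hl : T.linked K g g' := linked_of_mem_ends hu hg hg'
    refine ⟨⟨fun h => (T.linked K).trans h hl, fun h => (T.linked K).trans h ((T.linked K).symm hl)⟩,
      fun h x hx hxN y hy hyN => ?_⟩
    exact joined_trans (h₂ g h x hx hxN u hg (hK u hu))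
      (h₂ g' ((T.linked K).trans h hl) u hg' (hK u hu) y hy hyN)) hab
  exact h.2 ((T.linked K).refl a) x hx hxN y hy hyN

/-- Edges that are not linked are separated by a vertex in `K`. -/
theorem exists_separating (hC : T.Connected) {a f : F} (hf : ¬ T.linked K a f) :
    ∃ k ∈ K, (∃ g, T.linked K a g ∧ k ∈ T.ends g) ∧
      T.joined {g | ¬ T.linked K a g} k (T.src f) := by
  have h : ∀ y, ∃ k, (∃ g, T.linked K a g ∧ k ∈ T.ends g) ∧
      T.joined {g | ¬ T.linked K a g} k y := by
    intro y
    have h := eq_of_joined (f := fun y => ∃ k, (∃ g, T.linked K a g ∧ k ∈ T.ends g) ∧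
      T.joined {g | ¬ T.linked K a g} k y) (fun e _ => by
        by_cases he : T.linked K a e
        · exact propext ⟨fun _ => ⟨T.tgt e, ⟨e, he, tgt_mem_ends e⟩, joined_refl _ _⟩,
            fun _ => ⟨T.src e, ⟨e, he, src_mem_ends e⟩, joined_refl _ _⟩⟩
        · have hj := joined_edge (T := T) (S := {g | ¬ T.linked K a g}) he
          exact propext ⟨fun ⟨k, hk, h⟩ => ⟨k, hk, joined_trans h hj⟩,
            fun ⟨k, hk, h⟩ => ⟨k, hk, joined_trans h (joined_symm hj)⟩⟩) (hC.2 (T.src a) y)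
    rw [← h]
    exact ⟨T.src a, ⟨a, (T.linked K).refl a, src_mem_ends a⟩, joined_refl _ _⟩
  obtain ⟨k, ⟨g, hg, hkg⟩, hj⟩ := h (T.src f)
  refine ⟨k, ?_, ⟨g, hg, hkg⟩, hj⟩
  -- If `k` were outside `K`, all edges at `k` would be linked to `a`, and no chain of unlinked
  -- edges could leave `k`.
  by_contra hk
  have hstar : ∀ e, k ∈ T.ends e → T.linked K a e := fun e he =>
    (T.linked K).trans hg (linked_of_mem_ends hk hkg he)
  have h1 := eq_of_joined (f := fun y => y = k) (fun e he => propext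
    ⟨fun h => absurd (hstar e (Or.inl h.symm)) he, fun h => absurd (hstar e (Or.inr h.symm)) he⟩) hj
  have h2 : T.src f = k := by
    rw [← h1]
  exact hf (hstar f (Or.inl h2.symm))

/-- The linked edges form a connected subgraph containing `k` and `u`. A second connection through
unlinked edges would close a circuit. -/
theorem IsAcyclic.not_joined_of_linked [Fintype F] (hA : T.IsAcyclic) {a g g' : F} {k u : W}
    (hg : T.linked K a g) (hk : k ∈ T.ends g) (hg' : T.linked K a g') (hu : u ∈ T.ends g')
    (hku : u ≠ k) : ¬ T.joined {g | ¬ T.linked K a g} k u := by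
  intro hj
  refine hku (hA.eq_of_joined_of_disjoint (A := {g | T.linked K a g})
    (B := {g | ¬ T.linked K a g}) ?_ ?_ hj).symm
  · exact Set.disjoint_left.2 fun x hx hx' => hx' hx
  · refine joined_trans (v := T.src a) (joined_symm ?_) ?_
    · exact joined_of_linked (N := Set.univ) (fun _ _ => trivial)
        (fun g _ => ⟨_, src_mem_ends g, trivial⟩)
        (fun g hg x hx _ y hy _ => joined_of_mem_ends (S := {g | T.linked K a g}) hg hx hy) hg
        (src_mem_ends a) trivial hk trivial
    · exact joined_of_linked (N := Set.univ) (fun _ _ => trivial)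
        (fun g _ => ⟨_, src_mem_ends g, trivial⟩)
        (fun g hg x hx _ y hy _ => joined_of_mem_ends (S := {g | T.linked K a g}) hg hx hy) hg'
        (src_mem_ends a) trivial hu trivial

variable (T K) in
open Classical in
/-- The set of edges linked to `x`. -/
noncomputable def linkClass [Fintype F] (x : F) : Finset F := {f | T.linked K x f}

variable (T K) in
open Classical in
/-- The vertices outside `K` of the edges in `P`. -/
noncomputable def freeEnds [Fintype W] (P : Finset F) : Finset W :=
  {y | y ∉ K ∧ ∃ g ∈ P, y ∈ T.ends g}

theorem mem_linkClass [Fintype F] {x f : F} : f ∈ T.linkClass K x ↔ T.linked K x f := by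
  simp [linkClass]

theorem linkClass_eq_iff [Fintype F] {x y : F} :
    T.linkClass K x = T.linkClass K y ↔ T.linked K y x := by
  constructor
  · intro h
    rw [← mem_linkClass, ← h, mem_linkClass]
  · intro h
    ext f
    rw [mem_linkClass, mem_linkClass]
    exact ⟨fun h' => (T.linked K).trans h h', fun h' => (T.linked K).trans ((T.linked K).symm h) h'⟩

theorem linkClass_of_ends_subset [Fintype F] {x g : F} (hg : T.linked K x g) (hs : T.src g ∈ K)
    (ht : T.tgt g ∈ K) : T.linkClass K x = {g} := by
  rw [linkClass_eq_iff.2 ((T.linked K).symm hg)]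
  ext f
  rw [mem_linkClass, Finset.mem_singleton]
  constructor
  · intro h
    have h' := linked_le (r := Setoid.ker fun f => f = g) (fun a b u hu ha hb => ?_) h
    · have h3 : (g = g) = (f = g) := h'
      rw [← h3]
    · have key : ∀ c, u ∈ T.ends c → c ≠ g := by
        rintro c hc rfl
        rcases hc with rfl | rfl
        · exact hu hs
        · exact hu ht
      exact propext ⟨fun h => absurd h (key a ha), fun h => absurd h (key b hb)⟩
  · rintro rfl
    exact (T.linked K).refl f

open Classical in
/-- The edges linked to `x` with exactly one end in `K`: if no edge linked to `x` has both ends in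
`K`, they are counted by an Euler characteristic. -/
theorem IsAcyclic.card_linkClass [Fintype W] [Fintype F] (hA : T.IsAcyclic)
    (h3 : ∀ y, y ∉ K → 3 ≤ T.degree y) {x : F}
    (hx : ∀ g, T.linked K x g → ¬ (T.src g ∈ K ∧ T.tgt g ∈ K)) :
    ((T.linkClass K x).filter fun g => (T.src g ∈ K ↔ T.tgt g ∉ K)).card - 1 +
      (T.freeEnds K (T.linkClass K x)).card = (T.linkClass K x).card := by
  set P := T.linkClass K x with hP
  set C := T.freeEnds K P with hC
  have memC : ∀ {y}, y ∈ C ↔ y ∉ K ∧ ∃ g ∈ P, y ∈ T.ends g := by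
    intro y; simp [hC, freeEnds]
  have hup : ∀ {y g}, y ∈ C → y ∈ T.ends g → g ∈ P := by
    intro y g hy hg
    obtain ⟨hyK, g', hg', hy'⟩ := memC.1 hy
    rw [hP, mem_linkClass] at hg' ⊢
    exact (T.linked K).trans hg' (linked_of_mem_ends hyK hy' hg)
  have hsrc : ∀ g ∈ P, (T.src g ∈ C ↔ T.src g ∉ K) := fun g hg =>
    ⟨fun h => (memC.1 h).1, fun h => memC.2 ⟨h, g, hg, src_mem_ends g⟩⟩
  have htgt : ∀ g ∈ P, (T.tgt g ∈ C ↔ T.tgt g ∉ K) := fun g hg =>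
    ⟨fun h => (memC.1 h).1, fun h => memC.2 ⟨h, g, hg, tgt_mem_ends g⟩⟩
  have hxP : x ∈ P := mem_linkClass.2 ((T.linked K).refl x)
  -- Edges of `P` with one end in `K` leave `C`, those with none are inner edges of `C`, and the
  -- Euler characteristic of the connected set `C` relates the counts.
  have hb : P.filter (fun g => (T.src g ∈ K ↔ T.tgt g ∉ K)) = T.bdry C := by
    ext g
    simp only [Finset.mem_filter, bdry, Finset.mem_univ, true_and]
    by_cases hg : g ∈ P
    · rw [hsrc g hg, htgt g hg]
      tauto
    · have h1 : T.src g ∉ C := fun h => hg (hup h (src_mem_ends g))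
      have h2 : T.tgt g ∉ C := fun h => hg (hup h (tgt_mem_ends g))
      tauto
  have hin : P.filter (fun g => ¬ (T.src g ∈ K ↔ T.tgt g ∉ K)) = T.inner C := by
    ext g
    simp only [Finset.mem_filter, inner, Finset.mem_univ, true_and]
    by_cases hg : g ∈ P
    · have := hx g (mem_linkClass.1 hg)
      rw [hsrc g hg, htgt g hg]
      tauto
    · have h1 : T.src g ∉ C := fun h => hg (hup h (src_mem_ends g))
      tauto
  have hne : C.Nonempty := by
    have h := hx x ((T.linked K).refl x)
    by_cases h1 : T.src x ∈ K
    · exact ⟨T.tgt x, (htgt x hxP).2 fun h2 => h ⟨h1, h2⟩⟩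
    · exact ⟨T.src x, (hsrc x hxP).2 h1⟩
  have hj : ∀ y ∈ C, ∀ z ∈ C, T.joined {e | T.src e ∈ C ∧ T.tgt e ∈ C} y z := by
    intro y hy z hz
    obtain ⟨hyK, a, ha, hya⟩ := memC.1 hy
    obtain ⟨hzK, b, hb, hzb⟩ := memC.1 hz
    rw [hP, mem_linkClass] at ha hb
    have hPa : ∀ {g}, T.linked K a g → g ∈ P := fun h =>
      mem_linkClass.2 ((T.linked K).trans ha h)
    refine joined_of_linked (K := K) (N := Kᶜ) (fun _ h => h) (fun g hg => ?_)
      (fun g hg u hu huK v hv hvK => ?_) ((T.linked K).trans ((T.linked K).symm ha) hb) hya hyK hzb hzK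
    · have h := hx g (mem_linkClass.1 (hPa hg))
      by_cases h1 : T.src g ∈ K
      · exact ⟨T.tgt g, tgt_mem_ends g, fun h2 => h ⟨h1, h2⟩⟩
      · exact ⟨T.src g, src_mem_ends g, h1⟩
    · by_cases huv : u = v
      · rw [huv]
      · refine joined_of_mem_ends (e := g) ?_ hu hv
        change T.src g ∈ C ∧ T.tgt g ∈ C
        rw [hsrc g (hPa hg), htgt g (hPa hg)]
        rcases hu with rfl | rfl <;> rcases hv with rfl | rfl
        · exact absurd rfl huv
        · exact ⟨huK, hvK⟩
        · exact ⟨hvK, huK⟩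
        · exact absurd rfl huv
  have h4 := hA.card_inner_add_one hne hj
  -- The bound on valencies only serves to make the boundary nonempty, so that the truncated
  -- subtraction of 1 is a true one.
  have h5 := hA.card_add_two_le_card_bdry hne fun y hy => h3 y (memC.1 hy).1
  have h6 := Finset.card_filter_add_card_filter_not (s := P) (fun g => (T.src g ∈ K ↔ T.tgt g ∉ K))
  rw [hin, hb] at h6
  rw [hb]
  lia

end

end MultiGraph

/-! ### Blocks and the size -/

namespace MultiGraph
variable {V E : Type*} {G : MultiGraph V E}

theorem SameBlock.refl (e : E) : G.SameBlock e e := fun _ => Relation.ReflTransGen.refl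

theorem SameBlock.trans {e f g : E} (h : G.SameBlock e f) (h' : G.SameBlock f g) :
    G.SameBlock e g := fun v => (h v).trans (h' v)

theorem SameBlock.symm {e f : E} (h : G.SameBlock e f) : G.SameBlock f e := fun v =>
  have : Std.Symm fun a b : E => ∃ u : V, u ≠ v ∧ u ∈ G.ends a ∧ u ∈ G.ends b :=
    ⟨fun _ _ ⟨u, hu, ha, hb⟩ => ⟨u, hu, hb, ha⟩⟩
  Relation.ReflTransGen.stdSymm.symm _ _ (h v)

end MultiGraph

namespace InvGraph

section
variable {V E : Type*} {G : InvGraph V E}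

theorem iV_mem_ends {v : V} {e : E} (h : v ∈ G.ends e) : G.iV v ∈ G.ends (G.iE e) := by
  rcases h with rfl | rfl
  · exact Or.inl (G.src_iE e).symm
  · exact Or.inr (G.tgt_iE e).symm

namespace IsHyperelliptic

/-- The side of the class of `e` at `a` contains a fixed vertex `p`. Walk from `a` to `p` within
this side and return along the image under `ι`, arriving at `ι(e)`; the walk never meets `v`, whose
class is on the other side. -/
theorem sameBlock_iE_at [Finite V] [Finite E] (hG : G.IsHyperelliptic) {e : E} {a v : V}
    (ha : a ∈ G.ends e) (hv : ¬ G.quotientGraph.joined {G.cls e}ᶜ (G.vcls a) (G.vcls v)) :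
    Relation.ReflTransGen (fun a b : E => ∃ u : V, u ≠ v ∧ u ∈ G.ends a ∧ u ∈ G.ends b)
      e (G.iE e) := by
  set R := Relation.ReflTransGen (fun a b : E => ∃ u : V, u ≠ v ∧ u ∈ G.ends a ∧ u ∈ G.ends b) e
  set J := fun x => G.quotientGraph.joined {G.cls e}ᶜ (G.vcls a) (G.vcls x)
  have hJv : ∀ {x}, J x → x ≠ v := fun hx h => hv (h ▸ hx)
  have key : ∀ {x}, G.joined (G.edgesOver {G.cls e}ᶜ) a x → ∀ f, x ∈ G.ends f → R f := by
    intro x hx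
    have h := MultiGraph.eq_of_joined (f := fun x => J x ∧ ∀ f, x ∈ G.ends f → R f)
      (fun g hg => by
        have hj := MultiGraph.joined_edge (T := G.quotientGraph) (S := {G.cls e}ᶜ) (e := G.cls g) hg
        refine propext ⟨fun ⟨h1, h2⟩ => ?_, fun ⟨h1, h2⟩ => ?_⟩
        · have h3 : J (G.tgt g) := MultiGraph.joined_trans h1 hj
          exact ⟨h3, fun f hf => (h2 g (Or.inl rfl)).tail ⟨_, hJv h3, Or.inr rfl, hf⟩⟩
        · have h3 : J (G.src g) := MultiGraph.joined_trans h1 (MultiGraph.joined_symm hj)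
          exact ⟨h3, fun f hf => (h2 g (Or.inr rfl)).tail ⟨_, hJv h3, Or.inl rfl, hf⟩⟩) hx
    have h4 : J a := MultiGraph.joined_refl _ _
    exact (h.mp ⟨h4, fun f hf => Relation.ReflTransGen.single ⟨a, hJv h4, ha, hf⟩⟩).2
  obtain ⟨p, hp, hj⟩ := hG.exists_fixed_joined (G.cls e) (y := G.vcls a)
  have h1 := joined_of_joined_fixed hp hj
  have h2 := G.joined_iV _ _ _ h1
  rw [show G.iV p = p from hp] at h2
  exact key (MultiGraph.joined_trans h1 (MultiGraph.joined_symm h2)) _ (iV_mem_ends ha)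

theorem sameBlock_iE [Finite V] [Finite E] (hG : G.IsHyperelliptic) (e : E) :
    G.SameBlock e (G.iE e) := by
  intro v
  by_cases h : G.quotientGraph.joined {G.cls e}ᶜ (G.vcls (G.src e)) (G.vcls v)
  · refine hG.sameBlock_iE_at (a := G.tgt e) (Or.inr rfl) fun h' => ?_
    exact hG.tree (G.cls e) (MultiGraph.joined_trans h (MultiGraph.joined_symm h'))
  · exact hG.sameBlock_iE_at (Or.inl rfl) h

/-- A non-fixed vertex does not separate its edges: when `u` itself is removed, pass from `e` to
`ι(e)`, through `ι(u) ≠ u` to `ι(f)`, and back to `f`. -/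
theorem sameBlock_of_mem_ends [Finite V] [Finite E] (hG : G.IsHyperelliptic) {e f : E} {u : V}
    (hu : ¬ G.IsFixed u) (he : u ∈ G.ends e) (hf : u ∈ G.ends f) : G.SameBlock e f := by
  intro v
  by_cases h : u = v
  · subst h
    exact ((hG.sameBlock_iE e u).tail ⟨G.iV u, hu, iV_mem_ends he, iV_mem_ends hf⟩).trans
      ((hG.sameBlock_iE f).symm u)
  · exact Relation.ReflTransGen.single ⟨u, h, he, hf⟩

/-- Only fixed vertices can cut `G`. Unlinked classes are separated by a fixed class, over which
lies a single vertex; conversely, edges sharing a non-fixed vertex, and the edges of one class, lie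
in one block. -/
theorem sameBlock_iff [Finite V] [Finite E] (hG : G.IsHyperelliptic) {e f : E} :
    G.SameBlock e f ↔ G.quotientGraph.linked G.fixedClasses (G.cls e) (G.cls f) := by
  constructor
  · intro h
    by_contra hf
    obtain ⟨k, hk, ⟨g, hg, hkg⟩, hj⟩ :=
      MultiGraph.exists_separating hG.quotient_connected hf
    obtain ⟨p, rfl⟩ := vcls_surjective k
    rw [vcls_mem_fixedClasses] at hk
    set L := G.quotientGraph.linked G.fixedClasses (G.cls e)
    have hinv : ∀ g, Relation.ReflTransGen
        (fun a b : E => ∃ u : V, u ≠ p ∧ u ∈ G.ends a ∧ u ∈ G.ends b) g f →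
        ¬ G.quotientGraph.linked G.fixedClasses (G.cls e) (G.cls g) ∧
          G.quotientGraph.joined {g | ¬ G.quotientGraph.linked G.fixedClasses (G.cls e) g}
            (G.vcls p) (G.quotientGraph.src (G.cls g)) := by
      intro a ha
      induction ha using Relation.ReflTransGen.head_induction_on with
      | refl => exact ⟨hf, hj⟩
      | @head a b hab _ ih =>
        obtain ⟨u, hu, hua, hub⟩ := hab
        have hju := MultiGraph.joined_trans ih.2 (MultiGraph.joined_of_mem_ends
          (S := {g | ¬ G.quotientGraph.linked G.fixedClasses (G.cls e) g}) (e := G.cls b) ih.1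
          (MultiGraph.src_mem_ends _) (mem_ends_cls hG hub))
        have hup : G.vcls u ≠ G.vcls p := by
          intro h
          rcases vcls_eq_iff.1 h with rfl | rfl
          · exact hu rfl
          · exact hu hk
        have haP : ¬ G.quotientGraph.linked G.fixedClasses (G.cls e) (G.cls a) := fun haP =>
          hG.tree.not_joined_of_linked hg hkg haP (mem_ends_cls hG hua) hup hju
        exact ⟨haP, MultiGraph.joined_trans hju (MultiGraph.joined_of_mem_ends
          (S := {g | ¬ G.quotientGraph.linked G.fixedClasses (G.cls e) g}) (e := G.cls a) haP
          (mem_ends_cls hG hua) (MultiGraph.src_mem_ends _))⟩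
    exact (hinv e (h p)).1 ((G.quotientGraph.linked G.fixedClasses).refl _)
  · intro h
    let r : Setoid G.EdgeClass :=
      { r := fun x y => ∀ e f, G.cls e = x → G.cls f = y → G.SameBlock e f
        iseqv := by
          refine ⟨fun x e f he hf => ?_, fun {x y} h e f he hf => (h f e hf he).symm,
            fun {x y z} h h' e g he hg => ?_⟩
          · rcases cls_eq_iff.1 (he.trans hf.symm) with rfl | rfl
            · exact MultiGraph.SameBlock.refl _
            · exact (hG.sameBlock_iE f).symm
          · obtain ⟨f, rfl⟩ := cls_surjective y
            exact (h e f he rfl).trans (h' f g rfl hg) }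
    refine MultiGraph.linked_le (r := r) (fun x y z hz hx hy e f he hf => ?_) h e f rfl rfl
    obtain ⟨u, rfl⟩ := vcls_surjective z
    rw [vcls_mem_fixedClasses] at hz
    obtain ⟨e', he', hue⟩ := exists_mem_ends hx
    obtain ⟨f', hf', huf⟩ := exists_mem_ends hy
    have h1 := hG.sameBlock_of_mem_ends hz hue huf
    have key : ∀ {a b}, G.cls a = G.cls b → G.SameBlock a b := by
      intro a b hab
      rcases cls_eq_iff.1 hab with rfl | rfl
      · exact MultiGraph.SameBlock.refl _
      · exact (hG.sameBlock_iE b).symm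
    exact (key (he.trans he'.symm)).trans (h1.trans (key (hf'.trans hf.symm)))

theorem setOf_sameBlock [Finite V] [Finite E] (hG : G.IsHyperelliptic) (e : E) :
    {f | G.SameBlock e f} =
      G.cls ⁻¹' (G.quotientGraph.linkClass G.fixedClasses (G.cls e) : Set G.EdgeClass) := by
  ext f
  rw [Set.mem_preimage, SetLike.mem_coe, MultiGraph.mem_linkClass]
  exact hG.sameBlock_iff

theorem ncard_preimage_cls [Finite E] (hG : G.IsHyperelliptic) (x : G.EdgeClass) :
    (G.cls ⁻¹' {x}).ncard = 2 := by
  obtain ⟨e, rfl⟩ := cls_surjective x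
  have : G.cls ⁻¹' {G.cls e} = {e, G.iE e} := by
    ext f
    simp only [Set.mem_preimage, Set.mem_singleton_iff, Set.mem_insert_iff]
    exact cls_eq_iff
  rw [this, Set.ncard_pair (hG.edge_ne e).symm]

theorem jointing_eq_two_iff (hG : G.IsHyperelliptic) (e : E) : G.jointing e = 2 ↔
    G.IsFixed (G.src e) ∧ G.IsFixed (G.tgt e) := by
  classical
  rw [hG.jointing_eq]
  by_cases ha : G.IsFixed (G.src e) <;> by_cases hb : G.IsFixed (G.tgt e) <;> simp [ha, hb]

theorem jointing_eq_one_iff (hG : G.IsHyperelliptic) (e : E) : G.jointing e = 1 ↔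
    (G.IsFixed (G.src e) ↔ ¬ G.IsFixed (G.tgt e)) := by
  classical
  rw [hG.jointing_eq]
  by_cases ha : G.IsFixed (G.src e) <;> by_cases hb : G.IsFixed (G.tgt e) <;> simp [ha, hb]

/-- The block of an edge with two fixed ends is simple. -/
theorem isSimpleBlock_of_isFixed [Finite V] [Finite E] (hG : G.IsHyperelliptic) {e g : E}
    (hg : G.SameBlock e g) (hs : G.IsFixed (G.src g)) (ht : G.IsFixed (G.tgt g)) :
    G.quotientGraph.linkClass G.fixedClasses (G.cls e) = {G.cls g} ∧
      G.IsSimpleBlock {f | G.SameBlock e f} := by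
  have h1 : G.quotientGraph.linkClass G.fixedClasses (G.cls e) = {G.cls g} :=
    MultiGraph.linkClass_of_ends_subset (hG.sameBlock_iff.1 hg)
      (vcls_mem_fixedClasses.2 hs) (vcls_mem_fixedClasses.2 ht)
  have h2 : {f | G.SameBlock e f} = G.cls ⁻¹' {G.cls g} := by
    rw [hG.setOf_sameBlock, h1, Finset.coe_singleton]
  refine ⟨h1, ?_⟩
  rw [h2]
  refine ⟨hG.ncard_preimage_cls _, fun f hf => ?_⟩
  rw [hG.jointing_eq_two_iff]
  rcases cls_eq_iff.1 hf with rfl | rfl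
  · exact ⟨hs, ht⟩
  · rw [G.src_iE, G.tgt_iE, isFixed_iV, isFixed_iV]
    exact ⟨hs, ht⟩

/-- A simple block has one edge class and no non-fixed vertex. In any other block no edge has two
fixed ends, and `card_linkClass` applies, the one-jointed classes being those with exactly one fixed
end. -/
theorem blockSize_add [Finite V] [Finite E] (hG : G.IsHyperelliptic) (e : E) :
    G.blockSize {f | G.SameBlock e f} + (G.quotientGraph.freeEnds G.fixedClasses
      (G.quotientGraph.linkClass G.fixedClasses (G.cls e))).card =
      (G.quotientGraph.linkClass G.fixedClasses (G.cls e)).card := by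
  classical
  by_cases h : ∃ g, G.SameBlock e g ∧ G.IsFixed (G.src g) ∧ G.IsFixed (G.tgt g)
  · obtain ⟨g, hg, hs, ht⟩ := h
    obtain ⟨h1, h2⟩ := hG.isSimpleBlock_of_isFixed hg hs ht
    rw [blockSize, if_pos h2, h1, Finset.card_singleton]
    simp only [Nat.add_eq_left, Finset.card_eq_zero]
    refine Finset.eq_empty_of_forall_notMem fun y hy => ?_
    simp only [MultiGraph.freeEnds, Finset.mem_filter, Finset.mem_singleton, exists_eq_left] at hy
    rcases hy.2.2 with h | h
    · exact hy.2.1 (h ▸ vcls_mem_fixedClasses.2 hs)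
    · exact hy.2.1 (h ▸ vcls_mem_fixedClasses.2 ht)
  · push Not at h
    have hns : ¬ G.IsSimpleBlock {f | G.SameBlock e f} := fun hs => by
      have h1 := (hG.jointing_eq_two_iff e).1 (hs.2 e (MultiGraph.SameBlock.refl e))
      exact h e (MultiGraph.SameBlock.refl e) h1.1 h1.2
    rw [blockSize, if_neg hns, ← hG.tree.card_linkClass (fun y hy => hG.three_le_degree hy)]
    · congr 2
      rw [← Set.ncard_coe_finset]
      congr 1
      ext x
      obtain ⟨g, rfl⟩ := cls_surjective x
      have h0 : G.cls g ∈ (((G.quotientGraph.linkClass G.fixedClasses (G.cls e)).filter fun x =>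
          (G.quotientGraph.src x ∈ G.fixedClasses ↔ G.quotientGraph.tgt x ∉ G.fixedClasses) :
          Finset G.EdgeClass) : Set G.EdgeClass) ↔ G.SameBlock e g ∧ G.jointing g = 1 := by
        rw [Finset.mem_coe, Finset.mem_filter, MultiGraph.mem_linkClass, ← hG.sameBlock_iff,
          hG.jointing_eq_one_iff, quotientGraph_src, quotientGraph_tgt, vcls_mem_fixedClasses,
          vcls_mem_fixedClasses]
      rw [h0]
      constructor
      · rintro ⟨f, ⟨h1, h2⟩, h3⟩
        rcases cls_eq_iff.1 h3 with rfl | rfl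
        · exact ⟨h1, h2⟩
        · refine ⟨MultiGraph.SameBlock.trans h1 (hG.sameBlock_iE g).symm, ?_⟩
          rw [hG.jointing_eq_one_iff, G.src_iE, G.tgt_iE, isFixed_iV, isFixed_iV] at h2
          rwa [hG.jointing_eq_one_iff]
      · rintro ⟨h1, h2⟩
        exact ⟨g, ⟨h1, h2⟩, rfl⟩
    · intro x hx
      obtain ⟨g, rfl⟩ := cls_surjective x
      rw [quotientGraph_src, quotientGraph_tgt, vcls_mem_fixedClasses, vcls_mem_fixedClasses]
      exact fun h' => h g (hG.sameBlock_iff.2 hx) h'.1 h'.2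

/-- All edges at a non-fixed class are linked, and there is at least one, so each non-fixed class
belongs to exactly one block and the identities `blockSize_add` can be summed. Thus `sz(G)` is
complementary to the number of edges of a spanning forest rooted at the fixed classes. -/
theorem size_add [Finite V] [Finite E] [Fintype {x // x ∉ G.fixedClasses}] (hG : G.IsHyperelliptic) :
    G.size + Fintype.card {x // x ∉ G.fixedClasses} = Fintype.card G.EdgeClass := by
  classical
  set φ := fun x => G.quotientGraph.linkClass G.fixedClasses x with hφ
  have h1 : G.size = ∑ P ∈ Finset.univ.image φ, G.blockSize (G.cls ⁻¹' (P : Set G.EdgeClass)) := by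
    rw [size, ← Finset.sum_image (s := Finset.univ.image φ)
      (g := fun P : Finset G.EdgeClass => G.cls ⁻¹' (P : Set G.EdgeClass)) (f := G.blockSize)]
    · refine Finset.sum_congr ?_ fun _ _ => rfl
      ext B
      simp only [Set.Finite.mem_toFinset, MultiGraph.blocks, Set.mem_range, Finset.mem_image,
        Finset.mem_univ, true_and, exists_exists_eq_and, hG.setOf_sameBlock]
      exact ⟨fun ⟨e, he⟩ => ⟨G.cls e, he⟩, fun ⟨x, hx⟩ => by
        obtain ⟨e, rfl⟩ := cls_surjective x
        exact ⟨e, hx⟩⟩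
    · intro P _ Q _ hPQ
      exact Finset.coe_injective (cls_surjective.preimage_injective hPQ)
  have h2 : Fintype.card G.EdgeClass = ∑ P ∈ Finset.univ.image φ, P.card := by
    rw [← Finset.card_univ, Finset.card_eq_sum_card_image φ]
    refine Finset.sum_congr rfl fun P hP => ?_
    obtain ⟨x, -, rfl⟩ := Finset.mem_image.1 hP
    congr 1
    ext y
    simp only [Finset.mem_filter, Finset.mem_univ, true_and, hφ, MultiGraph.linkClass_eq_iff,
      MultiGraph.mem_linkClass]
  have h3 : Fintype.card {x // x ∉ G.fixedClasses} = ∑ P ∈ Finset.univ.image φ, (G.quotientGraph.freeEnds G.fixedClasses P).card := by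
    have hκ : ∀ y, y ∉ G.fixedClasses → ∃ e, y ∈ G.quotientGraph.ends e := fun y hy => by
      have h3 := hG.three_le_degree hy
      have : {e | y ∈ G.quotientGraph.ends e}.Nonempty := by
        rw [← Set.ncard_pos]
        exact lt_of_lt_of_le (by norm_num) h3
      exact this
    choose κ hκ using hκ
    rw [Fintype.card_subtype, Finset.card_eq_sum_card_fiberwise
      (f := fun y => if h : y ∉ G.fixedClasses then φ (κ y h) else ∅) (t := Finset.univ.image φ)
      (fun y hy => by
        have hy' : y ∉ G.fixedClasses := by simpa using hy
        simp [hy'])]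
    refine Finset.sum_congr rfl fun P hP => ?_
    obtain ⟨x, -, rfl⟩ := Finset.mem_image.1 hP
    congr 1
    ext y
    simp only [Finset.mem_filter, Finset.mem_univ, true_and, MultiGraph.freeEnds]
    refine and_congr_right fun hy => ?_
    rw [dif_pos hy]
    simp only [hφ, MultiGraph.linkClass_eq_iff, MultiGraph.mem_linkClass]
    refine ⟨fun h => ⟨κ y hy, h, hκ y hy⟩, fun ⟨g, hg, hyg⟩ => ?_⟩
    exact (G.quotientGraph.linked G.fixedClasses).trans hg (MultiGraph.linked_of_mem_ends hy hyg (hκ y hy))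
  rw [h1, h2, h3, ← Finset.sum_add_distrib]
  refine Finset.sum_congr rfl fun P hP => ?_
  obtain ⟨x, -, rfl⟩ := Finset.mem_image.1 hP
  obtain ⟨e, rfl⟩ := cls_surjective x
  have := hG.blockSize_add e
  rw [hG.setOf_sameBlock] at this
  exact this

end IsHyperelliptic

end

end InvGraph

/-! ### Contractions and the sets occurring in `L_G` -/

namespace InvGraph

section
variable {V E : Type*} {G : InvGraph V E}

theorem toContr_eq_iff {S : Set G.EdgeClass} {u v : V} :
    G.toContr S u = G.toContr S v ↔ G.joined (G.edgesOver S) u v := Quotient.eq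

theorem toContr_surjective {S : Set G.EdgeClass} : Function.Surjective (G.toContr S) :=
  Quotient.exists_rep

theorem contract_iV_toContr {S : Set G.EdgeClass} (v : V) :
    (G.contract S).iV (G.toContr S v) = G.toContr S (G.iV v) := rfl

theorem joined_of_vcls_toContr_eq {S : Set G.EdgeClass} {u v : V}
    (h : (G.contract S).vcls (G.toContr S u) = (G.contract S).vcls (G.toContr S v)) :
    G.quotientGraph.joined S (G.vcls u) (G.vcls v) := by
  rcases vcls_eq_iff.1 h with h | h
  · exact joined_quotientGraph (toContr_eq_iff.1 h)
  · rw [contract_iV_toContr, toContr_eq_iff] at h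
    rw [← vcls_iV v]
    exact joined_quotientGraph h

theorem vcls_toContr_eq_iff {S : Set G.EdgeClass} {u v : V} :
    (G.contract S).vcls (G.toContr S u) = (G.contract S).vcls (G.toContr S v) ↔
      G.quotientGraph.joined S (G.vcls u) (G.vcls v) := by
  refine ⟨joined_of_vcls_toContr_eq, fun h => vcls_eq_iff.2 ?_⟩
  rw [contract_iV_toContr, toContr_eq_iff, toContr_eq_iff]
  exact joined_of_joined_quotientGraph h

theorem contract_cls_eq_iff {S : Set G.EdgeClass} {e f : G.ContrEdge S} :
    (G.contract S).cls e = (G.contract S).cls f ↔ G.cls e.1 = G.cls f.1 := by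
  rw [cls_eq_iff, cls_eq_iff]
  exact or_congr Subtype.ext_iff Subtype.ext_iff

theorem contract_connected (h : G.Connected) (S : Set G.EdgeClass) : (G.contract S).Connected := by
  refine ⟨h.1.map (G.toContr S), fun x y => ?_⟩
  obtain ⟨u, rfl⟩ := toContr_surjective x
  obtain ⟨v, rfl⟩ := toContr_surjective y
  refine MultiGraph.joined_le
    (r := ((G.contract S).joined Set.univ).comap (G.toContr S)) (fun e _ => ?_) (h.2 u v)
  by_cases he : G.cls e ∈ S
  · have : G.toContr S (G.src e) = G.toContr S (G.tgt e) :=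
      toContr_eq_iff.2 (MultiGraph.joined_edge (T := G.toMultiGraph) (S := G.edgesOver S) he)
    change (G.contract S).joined Set.univ _ _
    rw [this]
  · exact MultiGraph.joined_edge (T := (G.contract S).toMultiGraph) (e := ⟨e, he⟩) trivial

theorem contract_quotientGraph_isAcyclic (h : G.quotientGraph.IsAcyclic) (S : Set G.EdgeClass) :
    (G.contract S).quotientGraph.IsAcyclic := by
  intro c hc
  obtain ⟨e, rfl⟩ := cls_surjective c
  have hS : S ⊆ {G.cls e.1}ᶜ := by
    rintro x hx rfl
    exact e.2 hx
  let f : (G.contract S).VertClass → Prop := fun x => ∃ v, (G.contract S).vcls (G.toContr S v) = x ∧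
    G.quotientGraph.joined {G.cls e.1}ᶜ (G.quotientGraph.src (G.cls e.1)) (G.vcls v)
  have hf : ∀ v, f ((G.contract S).vcls (G.toContr S v)) ↔
      G.quotientGraph.joined {G.cls e.1}ᶜ (G.quotientGraph.src (G.cls e.1)) (G.vcls v) := fun v =>
    ⟨fun ⟨u, hu, hj⟩ => MultiGraph.joined_trans hj
      (MultiGraph.joined_mono hS (joined_of_vcls_toContr_eq hu)), fun h => ⟨v, rfl, h⟩⟩
  have hmem : f ((G.contract S).vcls (G.toContr S (G.src e.1))) =
      f ((G.contract S).vcls (G.toContr S (G.tgt e.1))) :=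
    MultiGraph.eq_of_joined (f := f) (fun c' hc' => by
      obtain ⟨g, rfl⟩ := cls_surjective c'
      have hg : G.cls g.1 ≠ G.cls e.1 := fun h => hc' (contract_cls_eq_iff.2 h)
      have hj := MultiGraph.joined_edge (T := G.quotientGraph) (S := {G.cls e.1}ᶜ) hg
      change f ((G.contract S).vcls (G.toContr S (G.src g.1))) =
        f ((G.contract S).vcls (G.toContr S (G.tgt g.1)))
      rw [hf, hf]
      exact propext ⟨fun h => MultiGraph.joined_trans h hj,
        fun h => MultiGraph.joined_trans h (MultiGraph.joined_symm hj)⟩) hc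
  rw [hf, hf] at hmem
  exact h (G.cls e.1) (hmem.mp (MultiGraph.joined_refl _ _))

theorem card_edgeClass_contract [Finite E] (S : Finset G.EdgeClass) (S' : Set G.EdgeClass)
    (hS : ∀ x, x ∈ S ↔ x ∉ S') : Fintype.card (G.contract S').EdgeClass = S.card := by
  rw [← Fintype.card_coe]
  refine Fintype.card_congr (Equiv.ofBijective
    (Quotient.lift (fun g : G.ContrEdge S' => (⟨G.cls g.1, (hS _).2 g.2⟩ : S)) ?_) ⟨?_, ?_⟩)
  · intro e f h
    exact Subtype.ext (contract_cls_eq_iff.1 (Quotient.sound h))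
  · rintro ⟨e⟩ ⟨f⟩ h
    exact contract_cls_eq_iff.2 (congrArg Subtype.val h)
  · rintro ⟨x, hx⟩
    obtain ⟨e, rfl⟩ := cls_surjective x
    exact ⟨(G.contract S').cls ⟨e, (hS _).1 hx⟩, rfl⟩

namespace IsHyperelliptic

/-- If the contracted component of `v` meets a fixed vertex `p`, both `v` and `ι(v)` are joined to
`p`. If it does not, the sheet is constant along it, so it cannot contain `ι(v)`. -/
theorem contract_isFixed_iff [Finite E] (hG : G.IsHyperelliptic) {S : Set G.EdgeClass} {v : V} :
    (G.contract S).IsFixed (G.toContr S v) ↔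
      ∃ k ∈ G.fixedClasses, G.quotientGraph.joined S (G.vcls v) k := by
  rw [IsFixed, contract_iV_toContr, toContr_eq_iff]
  constructor
  · intro h
    by_contra! hk
    obtain ⟨s, hs, hs'⟩ := hG.exists_sheet
    have hnf : ∀ x, G.quotientGraph.joined S (G.vcls v) (G.vcls x) → ¬ G.IsFixed x :=
      fun x hx hx' => hk _ (vcls_mem_fixedClasses.2 hx') hx
    have h1 := MultiGraph.eq_of_joined
      (f := fun x => G.quotientGraph.joined S (G.vcls v) (G.vcls x) ∧ s x = s v) (fun e he => by
        have hj := MultiGraph.joined_edge (T := G.quotientGraph) (S := S) (e := G.cls e) he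
        refine propext ⟨fun ⟨h1, h2⟩ => ?_, fun ⟨h1, h2⟩ => ?_⟩
        · have h3 := MultiGraph.joined_trans h1 hj
          exact ⟨h3, (hs' e (hnf _ h1) (hnf _ h3)).symm.trans h2⟩
        · have h3 := MultiGraph.joined_trans h1 (MultiGraph.joined_symm hj)
          exact ⟨h3, (hs' e (hnf _ h3) (hnf _ h1)).trans h2⟩) h
    have h2 := (h1.mpr ⟨MultiGraph.joined_refl _ _, rfl⟩).2
    rw [hs v (hnf v (MultiGraph.joined_refl _ _))] at h2
    have h3 : (1 : ZMod 2) = 0 := by linear_combination h2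
    exact absurd h3 (by decide)
  · rintro ⟨k, hk, hj⟩
    obtain ⟨p, rfl⟩ := vcls_surjective k
    rw [vcls_mem_fixedClasses] at hk
    have h1 := joined_of_joined_fixed hk hj
    have h2 := G.joined_iV _ _ _ h1
    rw [show G.iV p = p from hk] at h2
    exact MultiGraph.joined_trans h2 (MultiGraph.joined_symm h1)

theorem forall_isFixed_contract_iff [Finite E] (hG : G.IsHyperelliptic) {S : Set G.EdgeClass} :
    (∀ x, (G.contract S).IsFixed x) ↔ G.quotientGraph.Rooted G.fixedClasses S := by
  constructor
  · intro h x
    obtain ⟨v, rfl⟩ := vcls_surjective x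
    exact hG.contract_isFixed_iff.1 (h (G.toContr S v))
  · intro h x
    obtain ⟨v, rfl⟩ := toContr_surjective x
    exact hG.contract_isFixed_iff.2 (h _)

theorem not_joined_ends (hG : G.IsHyperelliptic) {S : Set G.EdgeClass} {e : E} (he : G.cls e ∉ S) :
    ¬ G.quotientGraph.joined S (G.vcls (G.src e)) (G.vcls (G.tgt e)) := by
  intro h
  have hS : S ⊆ {G.cls e}ᶜ := by
    rintro x hx rfl
    exact he hx
  exact hG.tree (G.cls e) (MultiGraph.joined_mono hS h)

theorem contract_isHyperelliptic [Finite E] (hG : G.IsHyperelliptic) {S : Set G.EdgeClass}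
    (hS : G.quotientGraph.Rooted G.fixedClasses S) : (G.contract S).IsHyperelliptic where
  connected := contract_connected hG.connected S
  interval e h := hG.not_joined_ends e.2 (joined_quotientGraph (toContr_eq_iff.1 h))
  edge_ne e h := hG.edge_ne e.1 (congrArg Subtype.val h)
  three_le v hv := absurd (hG.forall_isFixed_contract_iff.2 hS v) hv
  tree := contract_quotientGraph_isAcyclic hG.tree S

/-- By `size_add` for `G^S`, its size falls short of `|S|` by the number of non-fixed classes. So
size `|S|` means that all vertices are fixed, in which case every block is simple and the condition
on valencies is void. -/
theorem keep_semisimple_iff [Finite V] [Finite E] (hG : G.IsHyperelliptic)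
    {S : Finset G.EdgeClass} (hS : S.card = G.size) :
    ((G.keep (S : Set G.EdgeClass)).IsHyperelliptic ∧ (G.keep (S : Set G.EdgeClass)).IsSemisimple ∧
      (G.keep (S : Set G.EdgeClass)).size = G.size) ↔
      G.quotientGraph.Rooted G.fixedClasses (S : Set G.EdgeClass)ᶜ := by
  have hcard := card_edgeClass_contract S (S : Set G.EdgeClass)ᶜ (by simp)
  rw [← hG.forall_isFixed_contract_iff]
  constructor
  · rintro ⟨hH, -, hsz⟩ x
    have : Fintype {x // x ∉ (G.keep (S : Set G.EdgeClass)).fixedClasses} := Fintype.ofFinite _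
    have h1 := hH.size_add
    rw [hsz, ← hS] at h1
    have h2 : Fintype.card (G.keep (S : Set G.EdgeClass)).EdgeClass = S.card := hcard
    have h3 := Fintype.card_eq_zero_iff.1 (show Fintype.card
      {x // x ∉ (G.keep (S : Set G.EdgeClass)).fixedClasses} = 0 by lia)
    by_contra hx
    exact h3.false ⟨(G.keep (S : Set G.EdgeClass)).vcls x,
      fun h => hx (vcls_mem_fixedClasses.1 h)⟩
  · intro h
    have hH : (G.keep (S : Set G.EdgeClass)).IsHyperelliptic :=
      hG.contract_isHyperelliptic (hG.forall_isFixed_contract_iff.1 h)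
    refine ⟨hH, ?_, ?_⟩
    · rintro B ⟨e, rfl⟩
      exact (hH.isSimpleBlock_of_isFixed (MultiGraph.SameBlock.refl e) (h _) (h _)).2
    · have : Fintype {x // x ∉ (G.keep (S : Set G.EdgeClass)).fixedClasses} := Fintype.ofFinite _
      have h1 := hH.size_add
      have h2 : Fintype.card (G.keep (S : Set G.EdgeClass)).EdgeClass = S.card := hcard
      have h3 : Fintype.card {x // x ∉ (G.keep (S : Set G.EdgeClass)).fixedClasses} = 0 :=
        Fintype.card_eq_zero_iff.2 ⟨fun ⟨x, hx⟩ => by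
          obtain ⟨v, rfl⟩ := vcls_surjective x
          exact hx (vcls_mem_fixedClasses.2 (h v))⟩
      lia

end IsHyperelliptic

end

end InvGraph

/-! ### The coefficients of `M_G` -/

namespace MultiGraph
variable {W F : Type*} {T : MultiGraph W F} {K : Set W}

/-- A set of edges rooted at `K` and one further vertex leaves only one component that does not
meet `K`. -/
theorem rooted_insert_iff {S : Set F} {x₀ x : W} (hx₀ : ¬ ∃ k ∈ K, T.joined S x₀ k) :
    T.Rooted (insert x K) S ↔ (¬ ∃ k ∈ K, T.joined S x k) ∧
      ∀ y, (¬ ∃ k ∈ K, T.joined S y k) → T.joined S x y := by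
  constructor
  · intro h
    have h1 : ∀ y, (¬ ∃ k ∈ K, T.joined S y k) → T.joined S y x := by
      intro y hy
      obtain ⟨k, rfl | hk, hj⟩ := h y
      · exact hj
      · exact absurd ⟨k, hk, hj⟩ hy
    refine ⟨fun ⟨k, hk, hj⟩ => hx₀ ⟨k, hk, joined_trans (h1 _ hx₀) hj⟩,
      fun y hy => joined_symm (h1 y hy)⟩
  · rintro ⟨-, h⟩ y
    by_cases hy : ∃ k ∈ K, T.joined S y k
    · obtain ⟨k, hk, hj⟩ := hy
      exact ⟨k, Or.inr hk, hj⟩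
    · exact ⟨x, Or.inl rfl, joined_symm (h y hy)⟩

end MultiGraph

namespace InvGraph

section
variable {V E : Type*} {G : InvGraph V E}

namespace IsHyperelliptic

open Classical in
/-- The classes of vertices that become non-fixed on contracting the edges over `S`. -/
noncomputable def floating [Finite V] (G : InvGraph V E) (S : Set G.EdgeClass) :
    Finset G.VertClass := {y | ¬ ∃ k ∈ G.fixedClasses, G.quotientGraph.joined S y k}

theorem mem_floating [Finite V] {S : Set G.EdgeClass} {y : G.VertClass} :
    y ∈ floating G S ↔ ¬ ∃ k ∈ G.fixedClasses, G.quotientGraph.joined S y k := by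
  simp [floating]

theorem mem_floating_of_joined [Finite V] {S : Set G.EdgeClass} {y z : G.VertClass}
    (h : G.quotientGraph.joined S y z) (hy : y ∈ floating G S) : z ∈ floating G S := by
  rw [mem_floating] at hy ⊢
  rintro ⟨k, hk, hj⟩
  exact hy ⟨k, hk, MultiGraph.joined_trans h hj⟩

theorem vcls_mem_floating [Finite V] [Finite E] (hG : G.IsHyperelliptic) {S : Set G.EdgeClass}
    {v : V} : G.vcls v ∈ floating G S ↔ ¬ (G.contract S).IsFixed (G.toContr S v) := by
  rw [mem_floating, hG.contract_isFixed_iff]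

/-- Edges at `a` map bijectively to the edge classes leaving the floating component. Surjectivity
lifts an end to the sheet of `a`; injectivity holds because an edge and its image cannot both start
from a non-fixed vertex. -/
theorem contract_degree [Finite V] [Finite E] (hG : G.IsHyperelliptic) {S : Set G.EdgeClass}
    (hC : ∀ y ∈ floating G S, ∀ z ∈ floating G S, G.quotientGraph.joined S y z)
    {a : G.ContrVert S} (ha : ¬ (G.contract S).IsFixed a) :
    (G.contract S).degree a = (G.quotientGraph.bdry (floating G S)).card := by
  classical
  obtain ⟨v, rfl⟩ := toContr_surjective a
  have hv := hG.vcls_mem_floating.2 ha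
  have hends : ∀ {e : G.ContrEdge S}, G.toContr S v ∈ (G.contract S).ends e →
      ∃ x ∈ G.ends e.1, G.toContr S x = G.toContr S v := by
    rintro e (h | h)
    · exact ⟨_, Or.inl rfl, h.symm⟩
    · exact ⟨_, Or.inr rfl, h.symm⟩
  have hends' : ∀ {e : G.ContrEdge S} {x}, x ∈ G.ends e.1 → G.toContr S x = G.toContr S v →
      G.toContr S v ∈ (G.contract S).ends e := by
    rintro e x (rfl | rfl) h
    · exact Or.inl h.symm
    · exact Or.inr h.symm
  have hfl : ∀ {x}, G.toContr S x = G.toContr S v → G.vcls x ∈ floating G S := fun {x} h => by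
    rw [hG.vcls_mem_floating, h]
    exact ha
  have hnot : ∀ {e : G.ContrEdge S}, ¬ (G.vcls (G.src e.1) ∈ floating G S ∧
      G.vcls (G.tgt e.1) ∈ floating G S) := fun {e} h =>
    hG.not_joined_ends e.2 (hC _ h.1 _ h.2)
  rw [MultiGraph.degree, ← Set.ncard_coe_finset,
    ← Set.InjOn.ncard_image (f := fun e : G.ContrEdge S => G.cls e.1)]
  · congr 1
    ext x
    simp only [Set.mem_image, Set.mem_ofPred_eq, MultiGraph.bdry, Finset.coe_filter,
      Finset.mem_univ, true_and]
    constructor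
    · rintro ⟨e, he, rfl⟩
      obtain ⟨x, hx, hxv⟩ := hends he
      have h1 := hnot (e := e)
      have h2 := hfl hxv
      rw [quotientGraph_src, quotientGraph_tgt]
      rcases hx with rfl | rfl
      · exact Or.inl ⟨h2, fun h => h1 ⟨h2, h⟩⟩
      · exact Or.inr ⟨fun h => h1 ⟨h, h2⟩, h2⟩
    · intro hx
      have hxS : x ∉ S := fun hxS => by
        have hj := MultiGraph.joined_edge (T := G.quotientGraph) hxS
        rcases hx with ⟨h1, h2⟩ | ⟨h1, h2⟩
        · exact h2 (mem_floating_of_joined hj h1)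
        · exact h1 (mem_floating_of_joined (MultiGraph.joined_symm hj) h2)
      have hx' : ∃ y ∈ G.quotientGraph.ends x, y ∈ floating G S := by
        rcases hx with ⟨h1, h2⟩ | ⟨h1, h2⟩
        · exact ⟨_, Or.inl rfl, h1⟩
        · exact ⟨_, Or.inr rfl, h2⟩
      obtain ⟨y, hy, hyC⟩ := hx'
      obtain ⟨u, rfl⟩ := vcls_surjective y
      rcases joined_of_joined_quotientGraph (hC _ hyC _ hv) with h | h
      · obtain ⟨e, rfl, hu⟩ := exists_mem_ends hy
        exact ⟨⟨e, hxS⟩, hends' hu (toContr_eq_iff.2 h), rfl⟩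
      · rw [← vcls_iV u] at hy
        obtain ⟨e, rfl, hu⟩ := exists_mem_ends hy
        have h' := G.joined_iV _ _ _ h
        rw [G.iV_iV] at h'
        exact ⟨⟨e, hxS⟩, hends' hu (toContr_eq_iff.2 h'), rfl⟩
  · intro e he f hf hef
    rcases cls_eq_iff.1 hef with h | h
    · exact Subtype.ext h
    · exfalso
      obtain ⟨x, hx, hxv⟩ := hends hf
      obtain ⟨z, hz, hzv⟩ := hends he
      have hz' : G.iV z ∈ G.ends f.1 := by
        have := iV_mem_ends hz
        rwa [h, G.iE_iE] at this
      by_cases hxz : x = G.iV z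
      · apply ha
        rw [IsFixed, ← hzv, contract_iV_toContr, ← hxz, hxv, hzv]
      · have h1 := hfl hxv
        have h2 := hfl hzv
        rw [← vcls_iV z] at h2
        have h3 := hnot (e := f)
        rcases hx with rfl | rfl <;> rcases hz' with h4 | h4
        · exact hxz h4.symm
        · exact h3 ⟨h1, h4 ▸ h2⟩
        · exact h3 ⟨h4 ▸ h2, h1⟩
        · exact hxz h4.symm

open Classical in
-- One additional root `x` suffices exactly when there is a single floating component and `x` lies
-- in it. The sum of `deg x - 2` over this component is its number of outgoing edges minus 2, by
-- `sum_degree_sub_two`. With several floating components both sides are 0.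
theorem coeffM_contract [Finite V] [Finite E] (hG : G.IsHyperelliptic) {S : Set G.EdgeClass}
    (hS : ¬ G.quotientGraph.Rooted G.fixedClasses S) :
    ((G.contract S).coeffM : ℝ) = ∑ x : {x // x ∉ G.fixedClasses},
      ((G.quotientGraph.degree x.1 : ℝ) - 2) *
        if G.quotientGraph.Rooted (insert x.1 G.fixedClasses) S then 1 else 0 := by
  obtain ⟨x₀, hx₀⟩ : ∃ x, ¬ ∃ k ∈ G.fixedClasses, G.quotientGraph.joined S x k := by
    by_contra! h
    exact hS h
  have hx₀C := mem_floating.2 hx₀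
  obtain ⟨v₀, rfl⟩ := vcls_surjective x₀
  by_cases hC : ∀ y ∈ floating G S, ∀ z ∈ floating G S, G.quotientGraph.joined S y z
  · have h1 : (G.contract S).nonFixedClasses.ncard = 1 := by
      rw [Set.ncard_eq_one]
      refine ⟨(G.contract S).vcls (G.toContr S v₀), Set.eq_singleton_iff_unique_mem.2
        ⟨⟨_, hG.vcls_mem_floating.1 hx₀C, rfl⟩, ?_⟩⟩
      rintro _ ⟨a, ha, rfl⟩
      obtain ⟨v, rfl⟩ := toContr_surjective a
      exact vcls_toContr_eq_iff.2 (hC _ (hG.vcls_mem_floating.2 ha) _ hx₀C)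
    rw [coeffM, dif_pos h1, hG.contract_degree hC (Classical.choose_spec
      ((G.contract S).exists_nonFixed h1))]
    have h2 := hG.tree.sum_degree_sub_two (C := floating G S) ⟨_, hx₀C⟩ (fun y hy z hz => by
      have h3 := MultiGraph.eq_of_joined (f := fun z => z ∈ floating G S ∧
          G.quotientGraph.joined {e | G.quotientGraph.src e ∈ floating G S ∧
            G.quotientGraph.tgt e ∈ floating G S} y z) (fun e he => by
        have hj := MultiGraph.joined_edge (T := G.quotientGraph) he
        refine propext ⟨fun ⟨h1, h2⟩ => ?_, fun ⟨h1, h2⟩ => ?_⟩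
        · have h3 := mem_floating_of_joined hj h1
          exact ⟨h3, MultiGraph.joined_trans h2 (MultiGraph.joined_edge (T := G.quotientGraph)
            (S := {e | G.quotientGraph.src e ∈ floating G S ∧
              G.quotientGraph.tgt e ∈ floating G S}) ⟨h1, h3⟩)⟩
        · have h3 := mem_floating_of_joined (MultiGraph.joined_symm hj) h1
          exact ⟨h3, MultiGraph.joined_trans h2 (MultiGraph.joined_symm
            (MultiGraph.joined_edge (T := G.quotientGraph)
            (S := {e | G.quotientGraph.src e ∈ floating G S ∧
              G.quotientGraph.tgt e ∈ floating G S}) ⟨h3, h1⟩))⟩) (hC y hy z hz)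
      exact (h3.mp ⟨hy, MultiGraph.joined_refl _ _⟩).2)
    have h3 : ∀ x : {x // x ∉ G.fixedClasses},
        G.quotientGraph.Rooted (insert x.1 G.fixedClasses) S ↔ x.1 ∈ floating G S := by
      intro x
      rw [MultiGraph.rooted_insert_iff hx₀, ← mem_floating]
      exact ⟨fun h => h.1, fun h => ⟨h, fun y hy => hC _ h _ (mem_floating.2 hy)⟩⟩
    simp only [h3, mul_ite, mul_one, mul_zero]
    rw [← Finset.sum_filter]
    have h4 : ∑ x ∈ floating G S, ((G.quotientGraph.degree x : ℝ) - 2) =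
        ((G.quotientGraph.bdry (floating G S)).card : ℝ) - 2 := by exact_mod_cast h2
    push_cast
    rw [← h4]
    refine (Finset.sum_bij (fun x _ => x.1) (fun x hx => (Finset.mem_filter.1 hx).2)
      (fun x _ y _ h => Subtype.ext h) (fun y hy => ?_) (fun _ _ => rfl)).symm
    refine ⟨⟨y, fun hyK => ?_⟩, by simpa using hy, rfl⟩
    exact mem_floating.1 hy ⟨y, hyK, MultiGraph.joined_refl _ _⟩
  · have h1 : (G.contract S).nonFixedClasses.ncard ≠ 1 := by
      intro h1
      obtain ⟨a, ha⟩ := Set.ncard_eq_one.1 h1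
      apply hC
      intro y hy z hz
      obtain ⟨u, rfl⟩ := vcls_surjective y
      obtain ⟨v, rfl⟩ := vcls_surjective z
      have hu : (G.contract S).vcls (G.toContr S u) ∈ (G.contract S).nonFixedClasses :=
        vcls_mem_nonFixedClasses.2 (hG.vcls_mem_floating.1 hy)
      have hv : (G.contract S).vcls (G.toContr S v) ∈ (G.contract S).nonFixedClasses :=
        vcls_mem_nonFixedClasses.2 (hG.vcls_mem_floating.1 hz)
      rw [ha] at hu hv
      exact vcls_toContr_eq_iff.1 (hu.trans hv.symm)
    rw [coeffM, dif_neg h1, Finset.sum_eq_zero, Rat.cast_zero]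
    intro x _
    rw [if_neg, mul_zero]
    rw [MultiGraph.rooted_insert_iff hx₀]
    rintro ⟨-, h⟩
    exact hC fun y hy z hz => MultiGraph.joined_trans (MultiGraph.joined_symm
      (h y (mem_floating.1 hy))) (h z (mem_floating.1 hz))

end IsHyperelliptic

end

end InvGraph

/-! ### `L_G` and `M_G` through the Dirichlet Laplacian of the quotient tree -/

theorem Finset.sum_powersetCard_compl {F M : Type*} [Fintype F] [DecidableEq F] [AddCommMonoid M]
    {m n : ℕ} (h : m + n = Fintype.card F) (f : Finset F → M) :
    ∑ S ∈ (Finset.univ : Finset F).powersetCard m, f S =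
      ∑ S ∈ (Finset.univ : Finset F).powersetCard n, f Sᶜ := by
  refine Finset.sum_nbij' (fun S => Sᶜ) (fun S => Sᶜ) ?_ ?_ ?_ ?_ ?_
  · intro S hS
    simp only [Finset.mem_powersetCard, Finset.subset_univ, true_and] at hS ⊢
    rw [Finset.card_compl]
    lia
  · intro S hS
    simp only [Finset.mem_powersetCard, Finset.subset_univ, true_and] at hS ⊢
    rw [Finset.card_compl]
    lia
  · intro S _
    exact compl_compl S
  · intro S _
    exact compl_compl S
  · intro S _
    rw [compl_compl]

theorem Finset.prod_compl_eq_prod_mul_prod_inv {F : Type*} [Fintype F] [DecidableEq F] {f : F → ℝ}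
    (hf : ∀ e, 0 < f e) (S : Finset F) :
    ∏ e ∈ Sᶜ, f e = (∏ e, f e) * ∏ e ∈ S, (f e)⁻¹ := by
  rw [← Finset.prod_mul_prod_compl S f, Finset.prod_inv_distrib]
  have : ∏ e ∈ S, f e ≠ 0 := Finset.prod_ne_zero_iff.2 fun e _ => (hf e).ne'
  field_simp

namespace InvGraph

section
variable {V E : Type*} {G : InvGraph V E} [Finite V] [Finite E]

open Classical in
-- Passing to complements turns the sets in `L_G` into rooted spanning forests, and their products
-- of lengths into products of conductances up to the product of all lengths.
theorem aeval_polyL (hG : G.IsHyperelliptic) (ℓ : G.Lengths) :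
    aeval ℓ.1 G.polyL = (∏ ē, ℓ.1 ē) *
      (G.quotientGraph.dirLap G.fixedClasses (fun ē => (ℓ.1 ē)⁻¹)).det := by
  have hsz := hG.size_add
  rw [MultiGraph.dirLap, MultiGraph.det_weightedGram_inc, polyL, map_sum, Finset.mul_sum,
    Finset.sum_powersetCard_compl hsz]
  refine Finset.sum_congr rfl fun S hS => ?_
  have hS' : Sᶜ.card = G.size := by
    rw [Finset.card_compl, (Finset.mem_powersetCard.1 hS).2]
    lia
  have h1 := hG.keep_semisimple_iff hS'
  have h2 : (((Sᶜ : Finset G.EdgeClass) : Set G.EdgeClass)ᶜ) = S := by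
    rw [Finset.coe_compl, compl_compl]
  have h3 := h1.trans (iff_of_eq (congrArg (G.quotientGraph.Rooted G.fixedClasses) h2))
  by_cases h : G.quotientGraph.Rooted G.fixedClasses (S : Set G.EdgeClass)
  · rw [if_pos (h3.2 h), if_pos h, map_prod]
    simp only [aeval_X]
    exact Finset.prod_compl_eq_prod_mul_prod_inv ℓ.2 S
  · rw [if_neg fun h' => h (h3.1 h'), if_neg h, map_zero, mul_zero]

open Classical in
-- The complement of a set of `sz(G) + 1` classes has one edge too few to be rooted, so
-- `coeffM_contract` applies. After exchanging the sums, `det_dirLap_mul_green` evaluates the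
-- contribution of each additional root `x`.
theorem aeval_polyM (hG : G.IsHyperelliptic) (ℓ : G.Lengths) :
    aeval ℓ.1 G.polyM = aeval ℓ.1 G.polyL * ∑ x, ((G.quotientGraph.degree x : ℝ) - 2) *
      G.quotientGraph.green G.fixedClasses (fun ē => (ℓ.1 ē)⁻¹) x x := by
  have hsz := hG.size_add
  obtain ⟨p, hp⟩ := hG.exists_fixed
  have hK := vcls_mem_fixedClasses.2 hp
  have h1 : aeval ℓ.1 G.polyM = ∑ S ∈ Finset.univ.powersetCard (G.size + 1),
      ∑ x : {x // x ∉ G.fixedClasses}, (((G.quotientGraph.degree x.1 : ℝ) - 2) *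
        if G.quotientGraph.Rooted (insert x.1 G.fixedClasses) (S : Set G.EdgeClass)ᶜ then
          ∏ ē ∈ S, ℓ.1 ē else 0) := by
    rw [polyM, map_sum]
    refine Finset.sum_congr rfl fun S hS => ?_
    have hS := (Finset.mem_powersetCard.1 hS).2
    have hnr : ¬ G.quotientGraph.Rooted G.fixedClasses (S : Set G.EdgeClass)ᶜ := by
      rw [← Finset.coe_compl]
      intro h
      have h2 := h.card_le
      have h3 := Finset.card_le_univ S
      rw [Finset.card_compl] at h2
      lia
    rw [map_mul, map_prod, aeval_C]
    simp only [aeval_X, eq_ratCast, keep]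
    rw [hG.coeffM_contract hnr, Finset.sum_mul]
    refine Finset.sum_congr rfl fun x _ => ?_
    split_ifs <;> ring
  have h2 : ∑ x, ((G.quotientGraph.degree x : ℝ) - 2) *
      G.quotientGraph.green G.fixedClasses (fun ē => (ℓ.1 ē)⁻¹) x x =
      ∑ x : {x // x ∉ G.fixedClasses}, ((G.quotientGraph.degree x.1 : ℝ) - 2) *
      G.quotientGraph.green G.fixedClasses (fun ē => (ℓ.1 ē)⁻¹) x.1 x.1 := by
    rw [← Finset.sum_subtype (Finset.univ.filter fun x => x ∉ G.fixedClasses) (by simp)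
      (fun x => ((G.quotientGraph.degree x : ℝ) - 2) *
        G.quotientGraph.green G.fixedClasses (fun ē => (ℓ.1 ē)⁻¹) x x)]
    refine (Finset.sum_filter_of_ne (p := fun x => x ∉ G.fixedClasses)
      fun x _ hx hxK => hx ?_).symm
    rw [MultiGraph.green_left_mem hxK, mul_zero]
  rw [h1, h2, Finset.sum_comm, Finset.mul_sum]
  refine Finset.sum_congr rfl fun x _ => ?_
  have hq : 0 < Fintype.card {x // x ∉ G.fixedClasses} := Fintype.card_pos_iff.2 ⟨x⟩
  rw [aeval_polyL hG, mul_left_comm, mul_assoc (∏ ē, ℓ.1 ē),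
    MultiGraph.det_dirLap_mul_green hG.rooted_univ (fun ē => inv_pos.2 (ℓ.2 ē)) hK x.2,
    Finset.sum_powersetCard_compl (n := Fintype.card {x // x ∉ G.fixedClasses} - 1) (by lia),
    ← Finset.mul_sum]
  congr 1
  rw [Finset.mul_sum]
  refine Finset.sum_congr rfl fun S _ => ?_
  rw [Finset.coe_compl, compl_compl]
  split_ifs
  · exact Finset.prod_compl_eq_prod_mul_prod_inv ℓ.2 S
  · simp

theorem aeval_polyL_ne_zero (hG : G.IsHyperelliptic) (ℓ : G.Lengths) :
    aeval ℓ.1 G.polyL ≠ (0 : ℝ) := by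
  classical
  rw [aeval_polyL hG]
  exact mul_ne_zero (Finset.prod_ne_zero_iff.2 fun ē _ => (ℓ.2 ē).ne')
    (MultiGraph.det_dirLap_ne_zero hG.rooted_univ fun ē => inv_pos.2 (ℓ.2 ē))

theorem aeval_polyM_div_polyL (hG : G.IsHyperelliptic) (ℓ : G.Lengths) :
    aeval ℓ.1 G.polyM / aeval ℓ.1 G.polyL = ∑ x, ((G.quotientGraph.degree x : ℝ) - 2) *
      G.quotientGraph.green G.fixedClasses (fun ē => (ℓ.1 ē)⁻¹) x x := by
  rw [aeval_polyM hG, mul_div_cancel_left₀ _ (aeval_polyL_ne_zero hG ℓ)]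

end

end InvGraph

/-! ### Sums over a tree weighted by valency minus 2 -/

namespace MultiGraph
variable {W F : Type*} {T : MultiGraph W F} [Fintype W] [Fintype F]

theorem sum_degree_sub_two_univ (hC : T.Connected) (hA : T.IsAcyclic) :
    ∑ x, ((T.degree x : ℝ) - 2) = -2 := by
  obtain ⟨x⟩ := hC.1
  have h := hA.sum_degree_sub_two (C := Finset.univ) ⟨x, Finset.mem_univ _⟩
    (fun y _ z _ => joined_mono (fun e _ => by simp) (hC.2 y z))
  have h2 : T.bdry Finset.univ = ∅ := by simp [bdry]
  rw [h2, Finset.card_empty] at h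
  have h3 : ((∑ x, ((T.degree x : ℤ) - 2) : ℤ) : ℝ) = ((0 : ℕ) - 2 : ℤ) := by rw [h]
  push_cast at h3
  rw [h3]

/-- One side of `e` is connected with boundary `{e}`, and `1 - 2 = -1`. -/
theorem IsAcyclic.sum_degree_sub_two_mul_sideInd (hA : T.IsAcyclic) (e : F) :
    ∑ x, ((T.degree x : ℝ) - 2) * T.sideInd e x = -1 := by
  classical
  set S : Finset W := {x | T.joined {e}ᶜ (T.tgt e) x} with hS
  have mem : ∀ {x}, x ∈ S ↔ T.joined {e}ᶜ (T.tgt e) x := by simp [hS]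
  have hstep : ∀ f ≠ e, (T.src f ∈ S ↔ T.tgt f ∈ S) := fun f hf => by
    have hj := joined_edge (T := T) (S := {e}ᶜ) hf
    rw [mem, mem]
    exact ⟨fun h => joined_trans h hj, fun h => joined_trans h (joined_symm hj)⟩
  have htgt : T.tgt e ∈ S := mem.2 (joined_refl _ _)
  have hsrc : T.src e ∉ S := fun h => hA e (joined_symm (mem.1 h))
  have hj : ∀ y ∈ S, T.joined {f | T.src f ∈ S ∧ T.tgt f ∈ S} (T.tgt e) y := by
    intro y hy
    have h := eq_of_joined (f := fun y => y ∈ S ∧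
      T.joined {f | T.src f ∈ S ∧ T.tgt f ∈ S} (T.tgt e) y) (fun f hf => by
        have h1 := hstep f hf
        have h2 : T.src f ∈ S → T.joined {f | T.src f ∈ S ∧ T.tgt f ∈ S} (T.src f) (T.tgt f) :=
          fun h => joined_edge (T := T) (S := {f | T.src f ∈ S ∧ T.tgt f ∈ S}) ⟨h, h1.1 h⟩
        exact propext ⟨fun h => ⟨h1.1 h.1, joined_trans h.2 (h2 h.1)⟩,
          fun h => ⟨h1.2 h.1, joined_trans h.2 (joined_symm (h2 (h1.2 h.1)))⟩⟩) (mem.1 hy)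
    exact (h.mp ⟨htgt, joined_refl _ _⟩).2
  have h := hA.sum_degree_sub_two (C := S) ⟨_, htgt⟩
    (fun y hy z hz => joined_trans (joined_symm (hj y hy)) (hj z hz))
  have h2 : T.bdry S = {e} := by
    ext f
    simp only [bdry, Finset.mem_filter, Finset.mem_univ, true_and, Finset.mem_singleton]
    constructor
    · intro hf
      by_contra hne
      have := hstep f hne
      tauto
    · rintro rfl
      exact Or.inr ⟨hsrc, htgt⟩
  rw [h2, Finset.card_singleton] at h
  have h3 : ((∑ x ∈ S, ((T.degree x : ℤ) - 2) : ℤ) : ℝ) = ((1 : ℕ) - 2 : ℤ) := by rw [h]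
  push_cast at h3
  rw [hS, Finset.sum_filter] at h3
  calc _ = ∑ x, (if T.joined {e}ᶜ (T.tgt e) x then ((T.degree x : ℝ) - 2) else 0) := by
        refine Finset.sum_congr rfl fun x _ => ?_
        unfold sideInd
        split_ifs <;> simp
    _ = -1 := by linarith

theorem sum_degree_sub_two_mul_sub (hC : T.Connected) (hA : T.IsAcyclic) (f : W → ℝ) (y : W) :
    ∑ x, ((T.degree x : ℝ) - 2) * (f x - f y) =
      -∑ e, (f (T.tgt e) - f (T.src e)) * (1 - 2 * T.sideInd e y) := by
  simp only [eq_add_sum_coboundary hC hA f _ y, Finset.mul_sum]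
  rw [Finset.sum_comm, ← Finset.sum_neg_distrib]
  refine Finset.sum_congr rfl fun e _ => ?_
  have h1 := sum_degree_sub_two_univ hC hA
  have h2 := hA.sum_degree_sub_two_mul_sideInd e
  calc _ = (f (T.tgt e) - f (T.src e)) * (∑ x, ((T.degree x : ℝ) - 2) * T.sideInd e x -
        (∑ x, ((T.degree x : ℝ) - 2)) * T.sideInd e y) := by
        rw [Finset.sum_mul, ← Finset.sum_sub_distrib, Finset.mul_sum]
        exact Finset.sum_congr rfl fun x _ => by ring
    _ = _ := by rw [h1, h2]; ring

end MultiGraph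

/-! ### The Green kernel of a hyperelliptic graph -/

namespace InvGraph

section
variable {V E : Type*} {G : InvGraph V E}

/-- A sign for each vertex, describing the two sheets of the covering outside the fixed vertices. -/
structure IsSheet (G : InvGraph V E) (σ : V → ℝ) : Prop where
  mul_self : ∀ v, σ v * σ v = 1
  neg : ∀ v, ¬ G.IsFixed v → σ (G.iV v) = - σ v
  edge : ∀ e, ¬ G.IsFixed (G.src e) → ¬ G.IsFixed (G.tgt e) → σ (G.src e) = σ (G.tgt e)

theorem IsHyperelliptic.exists_isSheet [Finite E] (hG : G.IsHyperelliptic) :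
    ∃ σ, G.IsSheet σ := by
  obtain ⟨s, h1, h2⟩ := hG.exists_sheet
  refine ⟨fun v => if s v = 0 then 1 else -1, fun v => by split_ifs <;> norm_num, fun v hv => ?_,
    fun e hs ht => by rw [h2 e hs ht]⟩
  have key : ∀ a : ZMod 2, (a + 1 = 0 ↔ ¬ a = 0) := by decide
  simp only [h1 v hv, key]
  split_ifs <;> simp

/-- The inverse lengths of the edge classes. -/
noncomputable def conductance (ℓ : G.Lengths) (x : G.EdgeClass) : ℝ := (ℓ.1 x)⁻¹

/-- The Green function of the quotient tree with Dirichlet conditions at the fixed vertices. -/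
noncomputable def treeGreen [Finite V] [Finite E] (ℓ : G.Lengths) (u v : V) : ℝ :=
  G.quotientGraph.green G.fixedClasses (conductance ℓ) (G.vcls u) (G.vcls v)

/-- Up to a sign independent of `v`, the indicator of `v` and `v₀` being separated by `x`. -/
noncomputable def offset (G : InvGraph V E) (v₀ v : V) (x : G.EdgeClass) : ℝ :=
  (G.quotientGraph.sideInd x (G.vcls v) : ℝ) - G.quotientGraph.sideInd x (G.vcls v₀)

/-- The Green kernel of a hyperelliptic graph: the sum of the kernels of the quotient tree on the
even and on the odd functions. -/
noncomputable def hypKernel [Finite V] [Finite E] (ℓ : G.Lengths) (v₀ : V) (σ : V → ℝ) (v w : V) :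
    ℝ :=
  (∑ x, ℓ.1 x * G.offset v₀ v x * G.offset v₀ w x) / 2 + σ v * σ w * treeGreen ℓ v w / 2

open Classical in
theorem IsHyperelliptic.offset_tgt_sub (hG : G.IsHyperelliptic) (v₀ : V) (e : E)
    (x : G.EdgeClass) :
    G.offset v₀ (G.tgt e) x - G.offset v₀ (G.src e) x = if G.cls e = x then 1 else 0 := by
  have h := hG.tree.sideInd_sub x (G.cls e)
  rw [quotientGraph_src, quotientGraph_tgt] at h
  have h' : (G.quotientGraph.sideInd x (G.vcls (G.tgt e)) : ℝ) -
      G.quotientGraph.sideInd x (G.vcls (G.src e)) = if G.cls e = x then 1 else 0 := by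
    exact_mod_cast h
  unfold offset
  linarith

section
variable [Finite V] [Finite E] {ℓ : G.Lengths} {σ : V → ℝ}

theorem treeGreen_symm (u v : V) : treeGreen ℓ u v = treeGreen ℓ v u := MultiGraph.green_symm _ _

theorem treeGreen_left {u : V} (hu : G.IsFixed u) (v : V) : treeGreen ℓ u v = 0 :=
  MultiGraph.green_left_mem (vcls_mem_fixedClasses.2 hu) _

theorem treeGreen_right (u : V) {v : V} (hv : G.IsFixed v) : treeGreen ℓ u v = 0 :=
  MultiGraph.green_right_mem _ (vcls_mem_fixedClasses.2 hv)

theorem treeGreen_iV_left (u v : V) : treeGreen ℓ (G.iV u) v = treeGreen ℓ u v := by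
  rw [treeGreen, vcls_iV]
  rfl

theorem treeGreen_iV_right (u v : V) : treeGreen ℓ u (G.iV v) = treeGreen ℓ u v := by
  rw [treeGreen, vcls_iV]
  rfl

/-- The sign at a fixed vertex is arbitrary, but there the Dirichlet condition makes it irrelevant.
-/
theorem IsSheet.iV_mul_treeGreen (hσ : G.IsSheet σ) (u v : V) :
    σ (G.iV v) * treeGreen ℓ u v = -(σ v * treeGreen ℓ u v) := by
  by_cases hv : G.IsFixed v
  · rw [treeGreen_right u hv]; simp
  · rw [hσ.neg v hv]; ring

theorem IsSheet.mul_treeGreen_edge (hσ : G.IsSheet σ) (e : E) :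
    σ (G.src e) * σ (G.tgt e) * treeGreen ℓ (G.src e) (G.tgt e) =
      treeGreen ℓ (G.src e) (G.tgt e) := by
  by_cases hs : G.IsFixed (G.src e)
  · rw [treeGreen_left hs]; simp
  by_cases ht : G.IsFixed (G.tgt e)
  · rw [treeGreen_right _ ht]; simp
  rw [hσ.edge e hs ht, hσ.mul_self, one_mul]

theorem IsHyperelliptic.hypKernel_sub (hG : G.IsHyperelliptic) (v₀ w : V) (e : E) :
    hypKernel ℓ v₀ σ w (G.tgt e) - hypKernel ℓ v₀ σ w (G.src e) =
      ℓ.len e * G.offset v₀ w (G.cls e) / 2 +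
        σ w * (σ (G.tgt e) * treeGreen ℓ w (G.tgt e) - σ (G.src e) * treeGreen ℓ w (G.src e)) / 2 := by
  classical
  have h : (∑ x, ℓ.1 x * G.offset v₀ w x * G.offset v₀ (G.tgt e) x) -
      (∑ x, ℓ.1 x * G.offset v₀ w x * G.offset v₀ (G.src e) x) =
      ℓ.len e * G.offset v₀ w (G.cls e) := by
    rw [← Finset.sum_sub_distrib]
    simp only [← mul_sub, hG.offset_tgt_sub, mul_ite, mul_one, mul_zero, Finset.sum_ite_eq,
      Finset.mem_univ, if_true]
    rfl
  unfold hypKernel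
  linear_combination h / 2

end

/-- Even and odd functions are orthogonal for the Dirichlet form. The even part of `ψ` is recovered
by summation along the tree and the odd part, after multiplication by the sheet sign, by the
Dirichlet Green function; the factors 1/2 come from the two edges over each class. -/
theorem IsHyperelliptic.isGreenKernel [Fintype V] [Fintype E] (hG : G.IsHyperelliptic)
    (ℓ : G.Lengths) {v₀ : V} (hv₀ : G.IsFixed v₀) {σ : V → ℝ} (hσ : G.IsSheet σ) :
    IsGreenKernel ℓ v₀ (hypKernel ℓ v₀ σ) where
  symm v w := by
    unfold hypKernel
    rw [treeGreen_symm, mul_comm (σ v)]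
    congr 2
    exact Finset.sum_congr rfl fun x _ => by ring
  base w := by
    unfold hypKernel
    rw [treeGreen_left hv₀]
    simp [offset]
  weak w ψ := by
    have hout : ∀ v, Quotient.out (G.vcls v) = v ∨ Quotient.out (G.vcls v) = G.iV v := fun v =>
      vcls_eq_iff.1 (Quotient.out_eq (G.vcls v))
    -- the even part
    let ψp : G.VertClass → ℝ := fun x => ψ (Quotient.out x) + ψ (G.iV (Quotient.out x))
    have hψp : ∀ v, ψp (G.vcls v) = ψ v + ψ (G.iV v) := fun v => by
      rcases hout v with h | h
      · simp only [ψp, h]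
      · simp only [ψp, h, G.iV_iV]; ring
    -- the odd part
    let ψm : G.VertClass → ℝ := fun x =>
      σ (Quotient.out x) * (ψ (Quotient.out x) - ψ (G.iV (Quotient.out x)))
    have hfix : ∀ v, G.IsFixed v → ψ v - ψ (G.iV v) = 0 := fun v hv => by
      rw [show G.iV v = v from hv, sub_self]
    have hψm : ∀ v, ψm (G.vcls v) = σ v * (ψ v - ψ (G.iV v)) := fun v => by
      rcases hout v with h | h
      · simp only [ψm, h]
      · by_cases hv : G.IsFixed v
        · simp only [ψm, h, G.iV_iV]
          have := hfix v hv
          rw [this, show ψ (G.iV v) - ψ v = 0 by linarith]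
          simp
        · simp only [ψm, h, G.iV_iV, hσ.neg v hv]; ring
    have h1 := MultiGraph.eq_add_sum_coboundary hG.quotient_connected hG.tree ψp (G.vcls w)
      (G.vcls v₀)
    have h2 := MultiGraph.green_weak (T := G.quotientGraph) (K := G.fixedClasses)
      (c := conductance ℓ) (ψ := ψm) hG.rooted_univ (fun x => inv_pos.2 (ℓ.2 x)) (G.vcls w)
      (fun x hx => by
        obtain ⟨v, rfl⟩ := vcls_surjective x
        rw [hψm, hfix v (vcls_mem_fixedClasses.1 hx), mul_zero])
    rw [hψp, hψp, show G.iV v₀ = v₀ from hv₀] at h1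
    rw [hψm] at h2
    have h3 : ∑ e, (hypKernel ℓ v₀ σ w (G.tgt e) - hypKernel ℓ v₀ σ w (G.src e)) *
        (ψ (G.tgt e) - ψ (G.src e)) / ℓ.len e =
        (∑ x, (ψp (G.quotientGraph.tgt x) - ψp (G.quotientGraph.src x)) *
          ((G.quotientGraph.sideInd x (G.vcls w) : ℝ) - G.quotientGraph.sideInd x (G.vcls v₀))) / 2 +
        σ w * (∑ x, conductance ℓ x * (ψm (G.quotientGraph.tgt x) - ψm (G.quotientGraph.src x)) *
          (G.quotientGraph.green G.fixedClasses (conductance ℓ) (G.vcls w) (G.quotientGraph.tgt x) -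
            G.quotientGraph.green G.fixedClasses (conductance ℓ) (G.vcls w)
              (G.quotientGraph.src x))) / 2 := by
      rw [sum_edges_eq hG.edge_ne, Finset.mul_sum, ← add_div, ← Finset.sum_add_distrib,
        Finset.sum_div]
      refine Finset.sum_congr rfl fun x _ => ?_
      obtain ⟨e, he⟩ : ∃ e, e = Quotient.out x := ⟨_, rfl⟩
      have hx : G.cls e = x := he ▸ Quotient.out_eq x
      rw [← he, ← hx, hG.hypKernel_sub, hG.hypKernel_sub, G.src_iE, G.tgt_iE, cls_iE,
        treeGreen_iV_right, treeGreen_iV_right, hσ.iV_mul_treeGreen, hσ.iV_mul_treeGreen,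
        show ℓ.len (G.iE e) = ℓ.len e by rw [Lengths.len, cls_iE]; rfl,
        quotientGraph_src, quotientGraph_tgt, hψp, hψp, hψm, hψm]
      change _ = (_ * G.offset v₀ w (G.cls e) + σ w * ((ℓ.len e)⁻¹ * _ *
        (treeGreen ℓ w (G.tgt e) - treeGreen ℓ w (G.src e)))) / 2
      have hl := (ℓ.len_pos e).ne'
      -- The sign can be moved from the Green function to the odd part of `ψ`: it agrees at two
      -- non-fixed ends, and at a fixed end both quantities vanish.
      have key : (σ (G.tgt e) * treeGreen ℓ w (G.tgt e) - σ (G.src e) * treeGreen ℓ w (G.src e)) *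
          ((ψ (G.tgt e) - ψ (G.iV (G.tgt e))) - (ψ (G.src e) - ψ (G.iV (G.src e)))) =
          (σ (G.tgt e) * (ψ (G.tgt e) - ψ (G.iV (G.tgt e))) -
            σ (G.src e) * (ψ (G.src e) - ψ (G.iV (G.src e)))) *
          (treeGreen ℓ w (G.tgt e) - treeGreen ℓ w (G.src e)) := by
        by_cases hs : G.IsFixed (G.src e)
        · rw [treeGreen_right w hs, hfix _ hs]; ring
        by_cases ht : G.IsFixed (G.tgt e)
        · rw [treeGreen_right w ht, hfix _ ht]; ring
        rw [hσ.edge e hs ht]; ring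
      field_simp
      linear_combination σ w * key
    rw [h3, ← h1, h2]
    linear_combination (ψ w - ψ (G.iV w)) / 2 * hσ.mul_self w

end

end InvGraph

/-! ### The energy of the admissible potential -/

namespace InvGraph

section
variable {V E : Type*} {G : InvGraph V E} [Fintype V] [Fintype E] {ℓ : G.Lengths} {σ : V → ℝ}
  {D : V → ℝ}

theorem sum_comp_iV (f : V → ℝ) : ∑ v, f (G.iV v) = ∑ v, f v :=
  Equiv.sum_comp (⟨G.iV, G.iV, G.iV_iV, G.iV_iV⟩ : V ≃ V) f

/-- The values at the edge classes of the slopes of the potential of `D`, up to a factor. -/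
noncomputable def divOffset (G : InvGraph V E) (D : V → ℝ) (v₀ : V) (x : G.EdgeClass) : ℝ :=
  ∑ w, D w * G.offset v₀ w x

namespace IsHyperelliptic
variable (hG : G.IsHyperelliptic)
include hG

theorem divisor_iV (hD : ∀ v, ¬ G.IsFixed v → D v = (G.nu v : ℝ) - 2) {v : V}
    (hv : ¬ G.IsFixed v) : D (G.iV v) = D v := by
  have hv' : ¬ G.IsFixed (G.iV v) := by rwa [isFixed_iV]
  rw [hD v hv, hD _ hv', hG.nu_eq_degree hv, hG.nu_eq_degree hv', ← hG.degree_vcls hv,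
    ← hG.degree_vcls hv', vcls_iV]

/-- The twisted Green function is odd under `ι`, whereas `D` is invariant off the fixed vertices,
where the Green function vanishes anyway. So the potential of `D` has no odd part. -/
theorem sum_divisor_mul_sheet (hσ : G.IsSheet σ)
    (hD : ∀ v, ¬ G.IsFixed v → D v = (G.nu v : ℝ) - 2) (v : V) :
    ∑ w, D w * (σ w * treeGreen ℓ w v) = 0 := by
  have h1 : ∀ w, D (G.iV w) * (σ (G.iV w) * treeGreen ℓ (G.iV w) v) =
      -(D w * (σ w * treeGreen ℓ w v)) := by
    intro w
    by_cases hw : G.IsFixed w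
    · rw [treeGreen_iV_left, treeGreen_left hw]; simp
    · rw [hG.divisor_iV hD hw, hσ.neg w hw, treeGreen_iV_left]; ring
  have h2 := sum_comp_iV (G := G) (fun w => D w * (σ w * treeGreen ℓ w v))
  simp only [h1, Finset.sum_neg_distrib] at h2
  linarith

theorem potential_eq (hσ : G.IsSheet σ) (hD : ∀ v, ¬ G.IsFixed v → D v = (G.nu v : ℝ) - 2)
    (v₀ v : V) : ∑ w, D w * hypKernel ℓ v₀ σ w v =
      (∑ x, ℓ.1 x * G.divOffset D v₀ x * G.offset v₀ v x) / 2 := by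
  have h1 := hG.sum_divisor_mul_sheet (ℓ := ℓ) hσ hD v
  have h2 : ∑ x, ℓ.1 x * G.divOffset D v₀ x * G.offset v₀ v x =
      ∑ w, D w * ∑ x, ℓ.1 x * G.offset v₀ w x * G.offset v₀ v x := by
    simp only [divOffset, Finset.mul_sum, Finset.sum_mul]
    rw [Finset.sum_comm]
    exact Finset.sum_congr rfl fun w _ => Finset.sum_congr rfl fun x _ => by ring
  calc _ = (∑ w, D w * ∑ x, ℓ.1 x * G.offset v₀ w x * G.offset v₀ v x) / 2 +
        σ v * (∑ w, D w * (σ w * treeGreen ℓ w v)) / 2 := by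
        rw [Finset.mul_sum, ← add_div, ← Finset.sum_add_distrib, Finset.sum_div]
        refine Finset.sum_congr rfl fun w _ => ?_
        unfold hypKernel
        ring
    _ = _ := by rw [h1, h2]; ring

theorem potential_sub (hσ : G.IsSheet σ) (hD : ∀ v, ¬ G.IsFixed v → D v = (G.nu v : ℝ) - 2)
    (v₀ : V) (e : E) : ∑ w, D w * hypKernel ℓ v₀ σ w (G.tgt e) -
      ∑ w, D w * hypKernel ℓ v₀ σ w (G.src e) = ℓ.len e * G.divOffset D v₀ (G.cls e) / 2 := by
  classical
  rw [hG.potential_eq hσ hD, hG.potential_eq hσ hD, ← sub_div, ← Finset.sum_sub_distrib]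
  simp only [← mul_sub, hG.offset_tgt_sub, mul_ite, mul_one, mul_zero, Finset.sum_ite_eq,
    Finset.mem_univ, if_true]
  rfl

theorem kernel_divisor (hσ : G.IsSheet σ) (hD : ∀ v, ¬ G.IsFixed v → D v = (G.nu v : ℝ) - 2)
    (v₀ : V) : ∑ v, ∑ w, D v * D w * hypKernel ℓ v₀ σ v w =
      (∑ x, ℓ.1 x * G.divOffset D v₀ x ^ 2) / 2 := by
  calc _ = ∑ w, D w * ∑ v, D v * hypKernel ℓ v₀ σ v w := by
        rw [Finset.sum_comm]
        simp only [Finset.mul_sum]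
        exact Finset.sum_congr rfl fun w _ => Finset.sum_congr rfl fun v _ => by ring
    _ = (∑ w, ∑ x, D w * (ℓ.1 x * G.divOffset D v₀ x * G.offset v₀ w x)) / 2 := by
        rw [Finset.sum_div]
        refine Finset.sum_congr rfl fun w _ => ?_
        rw [hG.potential_eq hσ hD, ← Finset.mul_sum]
        ring
    _ = _ := by
        rw [Finset.sum_comm]
        congr 1
        refine Finset.sum_congr rfl fun x _ => ?_
        rw [pow_two, ← mul_assoc]
        conv_rhs => rw [divOffset, Finset.mul_sum]
        exact Finset.sum_congr rfl fun w _ => by rw [divOffset]; ring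

theorem offset_tgt (v₀ : V) (e : E) : G.offset v₀ (G.tgt e) (G.cls e) =
    1 - G.quotientGraph.sideInd (G.cls e) (G.vcls v₀) := by
  have h := G.quotientGraph.sideInd_tgt (G.cls e)
  rw [quotientGraph_tgt] at h
  rw [offset, h, Int.cast_one]

theorem offset_src (v₀ : V) (e : E) : G.offset v₀ (G.src e) (G.cls e) =
    - G.quotientGraph.sideInd (G.cls e) (G.vcls v₀) := by
  have h := hG.tree.sideInd_src (G.cls e)
  rw [quotientGraph_src] at h
  rw [offset, h, Int.cast_zero, zero_sub]

omit hG in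
theorem hypKernel_self (hσ : G.IsSheet σ) (v₀ v : V) : hypKernel ℓ v₀ σ v v =
    (∑ x, ℓ.1 x * G.offset v₀ v x ^ 2) / 2 + treeGreen ℓ v v / 2 := by
  rw [hypKernel, hσ.mul_self, one_mul]
  congr 2
  exact Finset.sum_congr rfl fun x _ => by ring

theorem hypKernel_diag_sub (hσ : G.IsSheet σ) (v₀ : V) (e : E) :
    hypKernel ℓ v₀ σ (G.tgt e) (G.tgt e) - hypKernel ℓ v₀ σ (G.src e) (G.src e) =
      (ℓ.len e * (1 - 2 * G.quotientGraph.sideInd (G.cls e) (G.vcls v₀)) +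
        (treeGreen ℓ (G.tgt e) (G.tgt e) - treeGreen ℓ (G.src e) (G.src e))) / 2 := by
  have h : (∑ x, ℓ.1 x * G.offset v₀ (G.tgt e) x ^ 2) - (∑ x, ℓ.1 x * G.offset v₀ (G.src e) x ^ 2) =
      ℓ.len e * (1 - 2 * G.quotientGraph.sideInd (G.cls e) (G.vcls v₀)) := by
    classical
    rw [← Finset.sum_sub_distrib, Finset.sum_eq_single (G.cls e)]
    · rw [hG.offset_tgt, hG.offset_src, Lengths.len]; ring
    · intro x _ hx
      have := hG.offset_tgt_sub v₀ e x
      rw [if_neg hx.symm] at this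
      rw [sub_eq_zero.1 this, sub_self]
    · simp
  rw [hypKernel_self hσ, hypKernel_self hσ]
  linear_combination h / 2

/-- The effective resistance between the ends of `e` is the average of that in the free tree, which
is the length, and that of the tree grounded at the fixed classes. -/
theorem hypKernel_resistance (hσ : G.IsSheet σ) (v₀ : V) (e : E) :
    hypKernel ℓ v₀ σ (G.src e) (G.src e) + hypKernel ℓ v₀ σ (G.tgt e) (G.tgt e) -
      2 * hypKernel ℓ v₀ σ (G.src e) (G.tgt e) =
      (ℓ.len e + (treeGreen ℓ (G.src e) (G.src e) + treeGreen ℓ (G.tgt e) (G.tgt e) -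
        2 * treeGreen ℓ (G.src e) (G.tgt e))) / 2 := by
  have h1 := hG.hypKernel_sub (ℓ := ℓ) (σ := σ) v₀ (G.tgt e) e
  have h2 := hG.hypKernel_sub (ℓ := ℓ) (σ := σ) v₀ (G.src e) e
  rw [hG.offset_tgt] at h1
  rw [hG.offset_src] at h2
  have h3 : hypKernel ℓ v₀ σ (G.tgt e) (G.src e) = hypKernel ℓ v₀ σ (G.src e) (G.tgt e) := by
    unfold hypKernel
    rw [treeGreen_symm, mul_comm (σ (G.tgt e))]
    congr 2
    exact Finset.sum_congr rfl fun x _ => by ring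
  have h4 := hσ.mul_treeGreen_edge (ℓ := ℓ) e
  have h5 : treeGreen ℓ (G.tgt e) (G.src e) = treeGreen ℓ (G.src e) (G.tgt e) := treeGreen_symm _ _
  rw [h3, h5] at h1
  linear_combination h1 - h2 + treeGreen ℓ (G.tgt e) (G.tgt e) / 2 * hσ.mul_self (G.tgt e) +
    treeGreen ℓ (G.src e) (G.src e) / 2 * hσ.mul_self (G.src e) - h4

open Classical in
omit hG in
theorem sum_vcls (f : G.VertClass → ℝ) (hf : ∀ x ∈ G.fixedClasses, f x = 0) :
    ∑ v, f (G.vcls v) = 2 * ∑ x, f x := by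
  rw [← Finset.sum_fiberwise_of_maps_to (t := Finset.univ) (g := G.vcls)
    (fun _ _ => Finset.mem_univ _), Finset.mul_sum]
  refine Finset.sum_congr rfl fun x _ => ?_
  obtain ⟨u, rfl⟩ := vcls_surjective x
  rw [Finset.sum_congr rfl (g := fun _ => f (G.vcls u))
    (fun v hv => by rw [(Finset.mem_filter.1 hv).2]), Finset.sum_const, nsmul_eq_mul]
  by_cases hu : G.IsFixed u
  · rw [hf _ (vcls_mem_fixedClasses.2 hu)]; simp
  · have : Finset.univ.filter (fun v => G.vcls v = G.vcls u) = {u, G.iV u} := by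
      ext v
      simp [vcls_eq_iff]
    rw [this, Finset.card_pair fun h => hu h.symm]
    norm_num

theorem sum_divisor_mul_green (hD : ∀ v, ¬ G.IsFixed v → D v = (G.nu v : ℝ) - 2) :
    ∑ v, D v * treeGreen ℓ v v = 2 * ∑ x, ((G.quotientGraph.degree x : ℝ) - 2) *
      G.quotientGraph.green G.fixedClasses (conductance ℓ) x x := by
  rw [← sum_vcls]
  · refine Finset.sum_congr rfl fun v _ => ?_
    change _ = _ * treeGreen ℓ v v
    by_cases hv : G.IsFixed v
    · rw [treeGreen_left hv]; simp
    · rw [hD v hv, hG.nu_eq_degree hv, hG.degree_vcls hv]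
  · intro x hx
    rw [MultiGraph.green_left_mem hx, mul_zero]

/-- Summing the increments of the diagonal Green function along the path from `v₀` to each vertex
recovers its value there, as it is 0 at `v₀`. The factor 2 counts the two vertices over a non-fixed
class. -/
theorem sum_divOffset_mul (hD : ∀ v, ¬ G.IsFixed v → D v = (G.nu v : ℝ) - 2) {v₀ : V}
    (hv₀ : G.IsFixed v₀) :
    ∑ x, (G.quotientGraph.green G.fixedClasses (conductance ℓ) (G.quotientGraph.tgt x)
        (G.quotientGraph.tgt x) - G.quotientGraph.green G.fixedClasses (conductance ℓ)
        (G.quotientGraph.src x) (G.quotientGraph.src x)) * G.divOffset D v₀ x =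
      2 * ∑ x, ((G.quotientGraph.degree x : ℝ) - 2) *
        G.quotientGraph.green G.fixedClasses (conductance ℓ) x x := by
  rw [← hG.sum_divisor_mul_green hD]
  simp only [divOffset, Finset.mul_sum]
  rw [Finset.sum_comm]
  refine Finset.sum_congr rfl fun v _ => ?_
  have h := MultiGraph.eq_add_sum_coboundary hG.quotient_connected hG.tree
    (fun x => G.quotientGraph.green G.fixedClasses (conductance ℓ) x x) (G.vcls v) (G.vcls v₀)
  rw [MultiGraph.green_left_mem (vcls_mem_fixedClasses.2 hv₀), sub_zero] at h
  rw [treeGreen, h, Finset.mul_sum]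
  exact Finset.sum_congr rfl fun x _ => by rw [offset]; ring

theorem sum_side_mul {v₀ : V} (hv₀ : G.IsFixed v₀) :
    ∑ x, (G.quotientGraph.green G.fixedClasses (conductance ℓ) (G.quotientGraph.tgt x)
        (G.quotientGraph.tgt x) - G.quotientGraph.green G.fixedClasses (conductance ℓ)
        (G.quotientGraph.src x) (G.quotientGraph.src x)) *
          (1 - 2 * G.quotientGraph.sideInd x (G.vcls v₀)) =
      - ∑ x, ((G.quotientGraph.degree x : ℝ) - 2) *
        G.quotientGraph.green G.fixedClasses (conductance ℓ) x x := by
  have h := MultiGraph.sum_degree_sub_two_mul_sub hG.quotient_connected hG.tree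
    (fun x => G.quotientGraph.green G.fixedClasses (conductance ℓ) x x) (G.vcls v₀)
  simp only [MultiGraph.green_left_mem (vcls_mem_fixedClasses.2 hv₀), sub_zero] at h
  rw [h, neg_neg]

/-- On each edge `-(deg D + 2) h` has increment `(ℓ (P + 1 - 2s) + (b - a)) / 2` and quadratic
coefficient `(1 - R/ℓ) / 2`, where `P = divOffset`, `s` is the side of `v₀`, `a`, `b` are the
diagonal Green values at the ends and `R = a + b - 2m` is the grounded resistance. The terms free of
Green values form the explicit sum, the others reduce to `Θ = Σ (deg x - 2) G(x,x)`. -/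
theorem admEnergy_hypKernel (hσ : G.IsSheet σ)
    (hD : ∀ v, ¬ G.IsFixed v → D v = (G.nu v : ℝ) - 2) (hd : ∑ v, D v + 2 ≠ 0) {v₀ : V}
    (hv₀ : G.IsFixed v₀) :
    (∑ v, D v + 2) ^ 2 * admEnergy ℓ (hypKernel ℓ v₀ σ) D =
      (∑ x, ℓ.1 x * ((G.divOffset D v₀ x + 1 -
        2 * G.quotientGraph.sideInd x (G.vcls v₀)) ^ 2 / 2 + 1 / 6)) +
      2 / 3 * ∑ x, ((G.quotientGraph.degree x : ℝ) - 2) *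
        G.quotientGraph.green G.fixedClasses (conductance ℓ) x x := by
  let a : G.EdgeClass → ℝ := fun x => G.quotientGraph.green G.fixedClasses (conductance ℓ)
    (G.quotientGraph.src x) (G.quotientGraph.src x)
  let b : G.EdgeClass → ℝ := fun x => G.quotientGraph.green G.fixedClasses (conductance ℓ)
    (G.quotientGraph.tgt x) (G.quotientGraph.tgt x)
  let m : G.EdgeClass → ℝ := fun x => G.quotientGraph.green G.fixedClasses (conductance ℓ)
    (G.quotientGraph.src x) (G.quotientGraph.tgt x)
  let s : G.EdgeClass → ℝ := fun x => G.quotientGraph.sideInd x (G.vcls v₀)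
  let P : G.EdgeClass → ℝ := G.divOffset D v₀
  have h1 : (∑ v, D v + 2) ^ 2 * admEnergy ℓ (hypKernel ℓ v₀ σ) D =
      2 * ∑ x, (((ℓ.1 x * (P x + 1 - 2 * s x) + (b x - a x)) / 2) ^ 2 / ℓ.1 x +
        (1 - (a x + b x - 2 * m x) / ℓ.1 x) ^ 2 * ℓ.1 x / 12) := by
    rw [← sum_edges_cls hG.edge_ne, admEnergy, Finset.mul_sum]
    refine Finset.sum_congr rfl fun e _ => ?_
    have h1 := hG.potential_sub (ℓ := ℓ) hσ hD v₀ e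
    have h2 := hG.hypKernel_diag_sub (ℓ := ℓ) hσ v₀ e
    have hl := (ℓ.len_pos e).ne'
    have h3 : admPot (hypKernel ℓ v₀ σ) D (G.tgt e) - admPot (hypKernel ℓ v₀ σ) D (G.src e) =
        -((ℓ.len e * (P (G.cls e) + 1 - 2 * s (G.cls e)) + (b (G.cls e) - a (G.cls e))) / 2 /
          (∑ v, D v + 2)) := by
      change _ = -((ℓ.len e * (G.divOffset D v₀ (G.cls e) + 1 -
        2 * G.quotientGraph.sideInd (G.cls e) (G.vcls v₀)) +
        (treeGreen ℓ (G.tgt e) (G.tgt e) - treeGreen ℓ (G.src e) (G.src e))) / 2 /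
          (∑ v, D v + 2))
      unfold admPot
      rw [← neg_sub_neg, neg_neg, neg_neg, ← neg_sub, ← sub_div]
      congr 2
      linear_combination h1 + h2
    have h4 : admCoeff ℓ (hypKernel ℓ v₀ σ) D e =
        -((1 - (a (G.cls e) + b (G.cls e) - 2 * m (G.cls e)) / ℓ.len e) / 2 / (∑ v, D v + 2)) := by
      change _ = -((1 - (treeGreen ℓ (G.src e) (G.src e) + treeGreen ℓ (G.tgt e) (G.tgt e) -
        2 * treeGreen ℓ (G.src e) (G.tgt e)) / ℓ.len e) / 2 / (∑ v, D v + 2))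
      unfold admCoeff
      rw [hG.hypKernel_resistance hσ]
      congr 2
      field_simp
      ring
    rw [h3, h4]
    change _ = (((ℓ.len e * (P (G.cls e) + 1 - 2 * s (G.cls e)) + (b (G.cls e) - a (G.cls e))) /
      2) ^ 2 / ℓ.len e + (1 - (a (G.cls e) + b (G.cls e) - 2 * m (G.cls e)) / ℓ.len e) ^ 2 *
      ℓ.len e / 12)
    field_simp
    ring
  have h2 : ∑ x, (b x - a x) * P x = _ := hG.sum_divOffset_mul hD hv₀
  have h3 : ∑ x, (b x - a x) * (1 - 2 * s x) = _ := hG.sum_side_mul hv₀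
  have h4 := hG.tree.sum_degree_sub_two_mul_green (K := G.fixedClasses) (c := conductance ℓ)
    hG.rooted_univ fun x => inv_pos.2 (ℓ.2 x)
  change _ = - ∑ x, (conductance ℓ x * (3 * (b x - a x) ^ 2 + (a x + b x - 2 * m x) ^ 2) -
    2 * (a x + b x - 2 * m x)) at h4
  have h5 : 2 * ∑ x, (((ℓ.1 x * (P x + 1 - 2 * s x) + (b x - a x)) / 2) ^ 2 / ℓ.1 x +
        (1 - (a x + b x - 2 * m x) / ℓ.1 x) ^ 2 * ℓ.1 x / 12) =
      ∑ x, ℓ.1 x * ((P x + 1 - 2 * s x) ^ 2 / 2 + 1 / 6) + ∑ x, (b x - a x) * P x +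
        ∑ x, (b x - a x) * (1 - 2 * s x) + (∑ x, (conductance ℓ x * (3 * (b x - a x) ^ 2 +
          (a x + b x - 2 * m x) ^ 2) - 2 * (a x + b x - 2 * m x))) / 6 := by
    rw [Finset.sum_div, ← Finset.sum_add_distrib, ← Finset.sum_add_distrib,
      ← Finset.sum_add_distrib, Finset.mul_sum]
    refine Finset.sum_congr rfl fun x _ => ?_
    have hl := (ℓ.2 x).ne'
    rw [conductance]
    field_simp
    ring
  rw [h1, h5, h2, h3]
  -- The cross terms with `P` and with `1 - 2s` contribute `2Θ` and `-Θ`, the squares and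
  -- resistances contribute `-Θ/3`; in total `2Θ/3`.
  linear_combination h4 / 6

open Classical in
-- Each side of `x` in the tree contains a fixed class, so its preimage in `G` is connected; hence
-- `G^{x}` has only the two vertices that correspond to the sides.
theorem toContr_eq_iff_joined {x : G.EdgeClass} {u v : V} :
    G.toContr {x}ᶜ u = G.toContr {x}ᶜ v ↔ G.quotientGraph.joined {x}ᶜ (G.vcls v) (G.vcls u) := by
  rw [toContr_eq_iff]
  refine ⟨fun h => MultiGraph.joined_symm (joined_quotientGraph h), fun h => ?_⟩
  obtain ⟨p, hp, hj⟩ := hG.exists_fixed_joined x (y := G.vcls v)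
  exact MultiGraph.joined_trans
    (joined_of_joined_fixed hp (MultiGraph.joined_trans (MultiGraph.joined_symm h) hj))
    (MultiGraph.joined_symm (joined_of_joined_fixed hp hj))

theorem contrDiv_tgt (e : E) : G.contrDiv {G.cls e}ᶜ D (G.toContr {G.cls e}ᶜ (G.tgt e)) =
    ∑ v, D v * G.quotientGraph.sideInd (G.cls e) (G.vcls v) := by
  classical
  rw [contrDiv, Finset.sum_filter]
  refine Finset.sum_congr rfl fun v _ => ?_
  have h := MultiGraph.sideInd_eq_one_iff (T := G.quotientGraph) (e := G.cls e) (x := G.vcls v)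
  rw [quotientGraph_tgt, ← hG.toContr_eq_iff_joined] at h
  split_ifs with h'
  · rw [h.2 h']; simp
  · rw [(MultiGraph.sideInd_eq_zero_or_one _ _ _).resolve_right fun h1 => h' (h.1 h1)]; simp

theorem contrDiv_src (e : E) : G.contrDiv {G.cls e}ᶜ D (G.toContr {G.cls e}ᶜ (G.src e)) =
    ∑ v, D v - ∑ v, D v * G.quotientGraph.sideInd (G.cls e) (G.vcls v) := by
  classical
  rw [contrDiv, Finset.sum_filter, ← Finset.sum_sub_distrib]
  refine Finset.sum_congr rfl fun v _ => ?_
  have h := MultiGraph.sideInd_eq_zero_iff hG.quotient_connected hG.tree (e := G.cls e)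
    (x := G.vcls v)
  rw [quotientGraph_src, ← hG.toContr_eq_iff_joined] at h
  split_ifs with h'
  · rw [h.2 h']; simp
  · rw [(MultiGraph.sideInd_eq_zero_or_one _ _ _).resolve_left fun h1 => h' (h.1 h1)]; simp

/-- The two coefficients add up to `deg D`, so `w (deg D - w)` is their product and does not depend
on which of them is the minimum. -/
theorem weight_mul (x : G.EdgeClass) : G.weight D x * (∑ v, D v - G.weight D x) =
    (∑ v, D v - ∑ v, D v * G.quotientGraph.sideInd x (G.vcls v)) *
      ∑ v, D v * G.quotientGraph.sideInd x (G.vcls v) := by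
  obtain ⟨e, he⟩ : ∃ e, e = Quotient.out x := ⟨_, rfl⟩
  have hx : G.cls e = x := he ▸ Quotient.out_eq x
  subst hx
  rw [weight, ← he, hG.contrDiv_src, hG.contrDiv_tgt]
  rcases min_choice (∑ v, D v - ∑ v, D v * (G.quotientGraph.sideInd (G.cls e) (G.vcls v) : ℝ))
    (∑ v, D v * (G.quotientGraph.sideInd (G.cls e) (G.vcls v) : ℝ)) with h | h <;> rw [h] <;> ring

end IsHyperelliptic

end

end InvGraph

/-! ### The formula for the admissible constant -/

theorem theorem3p15 {V E : Type*} [Fintype V] [Fintype E] (G : InvGraph V E)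
    (hG : G.IsHyperelliptic) (D : V → ℝ)
    (hD : ∀ v, ¬ G.IsFixed v → D v = (G.nu v : ℝ) - 2)
    (d : ℝ) (hd : d = ∑ v, D v) (hd2 : d + 2 ≠ 0) (ℓ : G.Lengths) :
    aeval ℓ.1 G.polyL ≠ (0 : ℝ) ∧
    ∀ ε : ℝ, InvGraph.IsAdmissibleConstant ℓ D ε ↔
      ε = ∑ ē : G.EdgeClass,
            (2 / 3 * (d / (d + 2)) + G.weight D ē * (d - G.weight D ē) / (d + 2)) * ℓ.1 ē
          + 2 / 3 * (d / (d + 2)) * (aeval ℓ.1 G.polyM / aeval ℓ.1 G.polyL) := by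
  refine ⟨InvGraph.aeval_polyL_ne_zero hG ℓ, fun ε => ?_⟩
  obtain ⟨v₀, hv₀⟩ := hG.exists_fixed
  obtain ⟨σ, hσ⟩ := hG.exists_isSheet
  have h0 : ∑ v, D v + 2 ≠ 0 := hd ▸ hd2
  rw [InvGraph.isAdmissibleConstant_iff (hG.isGreenKernel ℓ hv₀ hσ) h0]
  have h1 := hG.admEnergy_hypKernel (ℓ := ℓ) hσ hD h0 hv₀
  have h2 : aeval ℓ.1 G.polyM / aeval ℓ.1 G.polyL = ∑ x, ((G.quotientGraph.degree x : ℝ) - 2) *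
      G.quotientGraph.green G.fixedClasses (InvGraph.conductance ℓ) x x :=
    InvGraph.aeval_polyM_div_polyL hG ℓ
  have h3 : ∑ x : G.EdgeClass, (2 / 3 * (d / (d + 2)) +
      G.weight D x * (d - G.weight D x) / (d + 2)) * ℓ.1 x =
      d / (d + 2) * (∑ x, ℓ.1 x * ((G.divOffset D v₀ x + 1 -
        2 * G.quotientGraph.sideInd x (G.vcls v₀)) ^ 2 / 2 + 1 / 6)) -
      (∑ x, ℓ.1 x * G.divOffset D v₀ x ^ 2) / 2 := by
    rw [Finset.mul_sum, Finset.sum_div, ← Finset.sum_sub_distrib]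
    refine Finset.sum_congr rfl fun x _ => ?_
    have hw := hG.weight_mul (D := D) x
    have hP : G.divOffset D v₀ x = ∑ v, D v * (G.quotientGraph.sideInd x (G.vcls v) : ℝ) -
        d * G.quotientGraph.sideInd x (G.vcls v₀) := by
      simp only [InvGraph.divOffset, InvGraph.offset, mul_sub, Finset.sum_sub_distrib, hd,
        Finset.sum_mul]
    rw [← hd] at hw
    rw [hw, hP]
    field_simp
    -- With `T` the degree of `D` on the target side, `P` is `T` or `T - d` according to the side of
    -- `v₀`. In both cases `1/2 + 1/6` gives the `2/3`, and the cross term combines with the squares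
    -- to `T (d - T) / (d + 2)`.
    rcases G.quotientGraph.sideInd_eq_zero_or_one x (G.vcls v₀) with h | h <;> rw [h] <;>
      push_cast <;> ring
  rw [h2, h3, hG.kernel_divisor hσ hD, ← hd]
  rw [← hd] at h1
  suffices h : d * (d + 2) * InvGraph.admEnergy ℓ (InvGraph.hypKernel ℓ v₀ σ) D =
      d / (d + 2) * ((d + 2) ^ 2 * InvGraph.admEnergy ℓ (InvGraph.hypKernel ℓ v₀ σ) D) by
    rw [h, h1]
    ring_nf
  field_simp
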